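/- Let $d\ge 1$ and $z>0$. Let $\Gamma$ be the space of locally finite subsets (configurations) of $\mathbb R^d$, with the vague topology, i.e. the weakest topology making all maps $\gamma\mapsto\langle f,\gamma\rangle:=\sum_{x\in\gamma}f(x)$, $f\in C_0(\mathbb R^d)$, continuous, and with its Borel $\sigma$-algebra; $C_0(\mathbb R^d)$ denotes the real continuous functions on $\mathbb R^d$ with compact support. Let $\pi_z$ be the Poisson measure on $\Gamma$ with intensity measure $z\,dx$. Let $a,b:\mathbb R^d\to[0,\infty]$ be measurable and even, with $a,b\in L^1(\mathbb R^d,dx)$, $\operatorname{ess\,sup} b<\infty$, and $b(x)\to 0$ as $|x|\to\infty$. For $f\in L^1(\mathbb R^d,dx)$ write $\langle f\rangle:=\int_{\mathbb R^d}f(x)\,dx$. For $\varepsilon>0$ set $$q_\varepsilon(x,h_1,h_2):=\varepsilon^{2d}a(\varepsilon h_1)a(\varepsilon h_2)\big(b(x)+b(x+h_2-h_1)\big),$$ and consider the generator of binary jumps $$(L_\varepsilon F)(\gamma)=\sum_{\{x_1,x_2\}\subset\gamma}\int_{(\mathbb R^d)^2}dh_1\,dh_2\;q_\varepsilon(x_2-x_1,h_1,h_2)\big(F(\gamma\setminus\{x_1,x_2\}\cup\{x_1+h_1,x_2+h_2\})-F(\gamma)\big),$$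 initially defined for the cylinder functions $F(\gamma)=g(\langle\varphi_1,\gamma\rangle,\dots,\langle\varphi_N,\gamma\rangle)$ with $N\in\mathbb N$, $\varphi_i\in C_0(\mathbb R^d)$ and $g:\mathbb R^N\to\mathbb R$ continuous and bounded. Let $\varphi\in C_0(\mathbb R^d)$ and $F=e^{\langle\varphi,\cdot\rangle}$. Then: (i) for each $\varepsilon>0$, $F$ lies in the domain of the closure in $L^2(\Gamma,\pi_z)$ of $L_\varepsilon$ on cylinder functions (that is, for some $H$, $(F,H)$ lies in the closure of the graph), and the image $H$ of $F$ is given by the formula above, whose integrals exist and whose sum converges absolutely for $\pi_z$-a.e. $\gamma$; (ii) with $$\begin{aligned}(L_0F)(\gamma):=\langle a\rangle^2\Big[&\sum_{\{x_1,x_2\}\subset\gamma}b(x_2-x_1)\big(F(\gamma\setminus\{x_1,x_2\})-F(\gamma)\big)\\&+\frac12\int_{\mathbb R^d}z\,dx_1\int_{\mathbb R^d}z\,dx_2\,b(x_2-x_1)\big(F(\gamma\cup\{x_1,x_2\})-F(\gamma)\big)\\&+z\langle b\rangle\sum_{x\in\gamma}\big(F(\gamma\setminus\{x\})-F(\gamma)\big)+z\langle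 b\rangle\int_{\mathbb R^d}z\,dx\,\big(F(\gamma\cup\{x\})-F(\gamma)\big)\Big],\end{aligned}$$ whose terms are all finite, with absolutely convergent sums and integrals, for $\pi_z$-a.e. $\gamma$, one has $L_0F\in L^2(\Gamma,\pi_z)$ and $$L_\varepsilon F\to L_0F\quad\text{in }L^2(\Gamma,\pi_z)\text{ as }\varepsilon\to0,\ \varepsilon>0.$$ -/

import Mathlib

open MeasureTheory ProbabilityTheory Filter Topology
open scoped ENNReal NNReal

namespace BinaryJumps

noncomputable section

/-- The underlying space `ℝᵈ` with its Euclidean norm and Lebesgue measure `volume`. -/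
abbrev E (d : ℕ) : Type := EuclideanSpace ℝ (Fin d)

/-! ### The configuration space -/

/-- The space `Γ` of all locally finite subsets of `ℝᵈ`. -/
def Config (d : ℕ) : Type := {γ : Set (E d) // ∀ K : Set (E d), IsCompact K → (γ ∩ K).Finite}

namespace Config

variable {d : ℕ}

instance : Membership (E d) (Config d) := ⟨fun γ x => x ∈ γ.1⟩

/-- `⟨f, γ⟩ = ∑_{x ∈ γ} f(x)`. -/
def pair (f : E d → ℝ) (γ : Config d) : ℝ := ∑' x : γ.1, f x

/-- The vague topology: the weakest topology for which all maps `γ ↦ ⟨f, γ⟩`, with `f` continuous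
and compactly supported, are continuous. -/
instance : TopologicalSpace (Config d) :=
  ⨅ f : {f : E d → ℝ // Continuous f ∧ HasCompactSupport f},
    TopologicalSpace.induced (pair f.1) inferInstance

/-- The Borel `σ`-algebra of the vague topology. -/
instance : MeasurableSpace (Config d) := borel (Config d)

instance : BorelSpace (Config d) := ⟨rfl⟩

/-- `|γ ∩ Λ|` (used for bounded `Λ`, where it is the true cardinality of a finite set). -/
def count (Λ : Set (E d)) (γ : Config d) : ℕ := (γ.1 ∩ Λ).ncard

/-- `γ ∪ {x}`. -/
def add (γ : Config d) (x : E d) : Config d :=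
  ⟨insert x γ.1, fun K hK =>
    ((γ.2 K hK).insert x).subset (by
      rintro y ⟨rfl | hy, hyK⟩
      · exact Set.mem_insert _ _
      · exact Set.mem_insert_of_mem _ ⟨hy, hyK⟩)⟩

/-- `γ \ {x}`. -/
def remove (γ : Config d) (x : E d) : Config d :=
  ⟨γ.1 \ {x}, fun K hK => (γ.2 K hK).subset fun _ hy => ⟨hy.1.1, hy.2⟩⟩

/-- `γ \ {x₁, x₂} ∪ {x₁ + h₁, x₂ + h₂}`. -/
def jump (γ : Config d) (x₁ x₂ h₁ h₂ : E d) : Config d :=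
  (((γ.remove x₁).remove x₂).add (x₁ + h₁)).add (x₂ + h₂)

/-- The ordered pairs of distinct points of `γ`. -/
def orderedPairs (γ : Config d) : Set (E d × E d) := {p | p.1 ∈ γ ∧ p.2 ∈ γ ∧ p.1 ≠ p.2}

/-- `∑_{ {x₁, x₂} ⊂ γ } f(x₁, x₂)`, the sum over unordered pairs of distinct points of `γ`, for
a symmetric function `f`: every unordered pair occurs twice among the ordered ones. -/
def pairSum (γ : Config d) (f : E d → E d → ℝ) : ℝ :=
  (1 / 2) * ∑' p : γ.orderedPairs, f p.1.1 p.1.2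

end Config

variable {d : ℕ}

/-! ### The Poisson measure -/

/-- The measure `z dx` on `ℝᵈ`. -/
def intensity (d : ℕ) (z : ℝ≥0) : Measure (E d) := z • (volume : Measure (E d))

/-- `π` is the Poisson measure on `Γ` with intensity measure `z dx`: the numbers of points in bounded
Borel sets `Λ` are Poisson distributed with parameter `z |Λ|`, and the numbers of points in
disjoint bounded Borel sets are independent. -/
structure IsPoisson (z : ℝ≥0) (π : Measure (Config d)) : Prop where
  isProbabilityMeasure : IsProbabilityMeasure π
  hasLaw_count : ∀ Λ : Set (E d), MeasurableSet Λ → Bornology.IsBounded Λ →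
    HasLaw (Config.count Λ) (poissonMeasure (intensity d z Λ).toNNReal) π
  indep_count : ∀ (n : ℕ) (Λ : Fin n → Set (E d)),
    (∀ i, MeasurableSet (Λ i)) → (∀ i, Bornology.IsBounded (Λ i)) →
    Pairwise (fun i j => Disjoint (Λ i) (Λ j)) →
    iIndepFun (fun i => Config.count (Λ i)) π

/-! ### Functions on the configuration space -/

/-- The class `ℱC_b(C₀(ℝᵈ), Γ)` of functions `γ ↦ g(⟨φ₁, γ⟩, …, ⟨φ_N, γ⟩)` with `g` continuous
and bounded and `φ₁, …, φ_N` continuous with compact support. -/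
def IsCylinder (F : Config d → ℝ) : Prop :=
  ∃ (N : ℕ) (φ : Fin N → E d → ℝ) (g : (Fin N → ℝ) → ℝ),
    1 ≤ N ∧ (∀ i, Continuous (φ i) ∧ HasCompactSupport (φ i)) ∧
    Continuous g ∧ (∃ C : ℝ, ∀ t, |g t| ≤ C) ∧
    ∀ γ, F γ = g (fun i => Config.pair (φ i) γ)

/-- The exponential function `e^{⟨φ, ·⟩}`. -/
def expFun (φ : E d → ℝ) (γ : Config d) : ℝ := Real.exp (Config.pair φ γ)

/-! ### Generators of binary jumps -/

/-- `(LF)(γ) = ∑_{ {x₁,x₂} ⊂ γ } ∫ Q(x₁, x₂, dh₁ × dh₂)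
(F(γ \ {x₁,x₂} ∪ {x₁+h₁, x₂+h₂}) - F(γ))`. -/
def jumpGen (Q : E d → E d → Measure (E d × E d)) (F : Config d → ℝ) (γ : Config d) : ℝ :=
  γ.pairSum fun x₁ x₂ => ∫ h, (F (γ.jump x₁ x₂ h.1 h.2) - F γ) ∂(Q x₁ x₂)

/-- The integrals and the (absolutely convergent) series in `jumpGen Q F γ` exist. -/
def JumpGenConverges (Q : E d → E d → Measure (E d × E d)) (F : Config d → ℝ) (γ : Config d) :
    Prop :=
  (∀ p ∈ γ.orderedPairs,
    Integrable (fun h : E d × E d => F (γ.jump p.1 p.2 h.1 h.2) - F γ) (Q p.1 p.2)) ∧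
  Summable fun p : γ.orderedPairs =>
    ∫ h, (F (γ.jump p.1.1 p.1.2 h.1 h.2) - F γ) ∂(Q p.1.1 p.1.2)

/-- `(F, H)` belongs to the closure in `L²(π) × L²(π)` of the graph of the operator `jumpGen Q` on
the cylinder functions, that is, `F` lies in the domain of the closed generator in `L²(π)`, which
maps it to `H`. -/
def InGenerator (Q : E d → E d → Measure (E d × E d)) (π : Measure (Config d))
    (F H : Config d → ℝ) : Prop :=
  MemLp F 2 π ∧ MemLp H 2 π ∧
  ∃ G : ℕ → Config d → ℝ,
    (∀ n, IsCylinder (G n) ∧ (∀ᵐ γ ∂π, JumpGenConverges Q (G n) γ) ∧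
      MemLp (G n) 2 π ∧ MemLp (jumpGen Q (G n)) 2 π) ∧
    Tendsto (fun n => eLpNorm (G n - F) 2 π) atTop (𝓝 0) ∧
    Tendsto (fun n => eLpNorm (jumpGen Q (G n) - H) 2 π) atTop (𝓝 0)

/-- `q_ε(x, h₁, h₂) = ε^{2d} a(ε h₁) a(ε h₂) (b(x) + b(x + h₂ - h₁))`. -/
def scaledRate (a b : E d → ℝ≥0∞) (ε : ℝ) (x h₁ h₂ : E d) : ℝ≥0∞ :=
  ENNReal.ofReal ε ^ (2 * d) * a (ε • h₁) * a (ε • h₂) * (b x + b (x + h₂ - h₁))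

/-- `Q_ε(x₁, x₂, dh₁ × dh₂) = q_ε(x₂ - x₁, h₁, h₂) dh₁ dh₂`. -/
def scaledKernel (a b : E d → ℝ≥0∞) (ε : ℝ) (x₁ x₂ : E d) : Measure (E d × E d) :=
  volume.withDensity fun h => scaledRate a b ε (x₂ - x₁) h.1 h.2

/-! ### The birth-and-death generator -/

/-- `⟨f⟩ = ∫ f(x) dx`. -/
def mass (f : E d → ℝ≥0∞) : ℝ := (∫⁻ x, f x).toReal

/-- The limiting generator `L₀`, in which pairs and single particles die and are born. -/
def birthDeathGen (a b : E d → ℝ≥0∞) (z : ℝ≥0) (F : Config d → ℝ) (γ : Config d) : ℝ :=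
  mass a ^ 2 *
    (γ.pairSum (fun x₁ x₂ => (b (x₂ - x₁)).toReal * (F ((γ.remove x₁).remove x₂) - F γ))
    + (1 / 2) * ∫ p : E d × E d, (b (p.2 - p.1)).toReal * (F ((γ.add p.1).add p.2) - F γ)
        ∂((intensity d z).prod (intensity d z))
    + z * mass b * ∑' x : γ.1, (F (γ.remove x) - F γ)
    + z * mass b * ∫ x, (F (γ.add x) - F γ) ∂(intensity d z))

/-- The rates, the series and the integrals in `birthDeathGen a b z F γ` are finite, (absolutely)
convergent and existent, respectively. -/
def BirthDeathGenConverges (b : E d → ℝ≥0∞) (z : ℝ≥0) (F : Config d → ℝ) (γ : Config d) : Prop :=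
  (∀ p ∈ γ.orderedPairs, b (p.2 - p.1) ≠ ∞) ∧
  (Summable fun p : γ.orderedPairs =>
    (b (p.1.2 - p.1.1)).toReal * (F ((γ.remove p.1.1).remove p.1.2) - F γ)) ∧
  Integrable
    (fun p : E d × E d => (b (p.2 - p.1)).toReal * (F ((γ.add p.1).add p.2) - F γ))
    ((intensity d z).prod (intensity d z)) ∧
  (Summable fun x : γ.1 => F (γ.remove x) - F γ) ∧
  Integrable (fun x => F (γ.add x) - F γ) (intensity d z)

end

end BinaryJumps

open BinaryJumps

namespace BinaryJumps

noncomputable section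

/-! Write `F = e^{⟨φ,·⟩}` and let `α` be the measure `εᵈ a(εh) dh`. It is even and has mass `⟨a⟩`
for every `ε`. The jump of a pair from `x = (x₁, x₂)` to `y = x + h` has rate `b(x₂ - x₁) + b(y₂ -
y₁)` with respect to `α ⊗ α`, the rate before plus the rate after the jump. Almost every jump lands
at distinct points off `γ`, so it changes `F` by `F(γ)(e^{φ(y₁)+φ(y₂)-φ(x₁)-φ(x₂)} - 1)`.

The factor `F(γ)` comes out of both generators, and an `L²(π)` norm becomes an `L²` norm for the
finite measure with density `e^{2⟨φ,·⟩}` (`eLpNorm_le_tilted`). The Poisson measure satisfies the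
Mecke identity (`IsPoisson.isMecke`), whose seed is the recursion `(k+1) p_{k+1} = r p_k` for
Poisson weights. Tilting preserves this identity and only changes the intensity to `z e^{2φ} dx`
(`IsMecke.tilt`). All moments of sums over points and pairs are computed from it
(`IsMecke.lintegral_pairs`, `IsMecke.lintegral_S2_sq_le`).

The only small quantity is `s`, the sum of `sup_x ∫ 1_{φ≠0}(x+h) α(dh)` and `sup_x ∫ b(x+h) α(dh)`.
It tends to zero because `α` spreads a fixed mass over a region of size `1/ε`
(`tendsto_iSup_smear`).

The increment is expanded in two ways. With the rate before the jump it is the death of the pair,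
plus separate births at `y₁` and `y₂`, plus a mixed term. With the rate after the jump it is the
joint birth of the pair, plus separate deaths of `x₁` and `x₂`, plus a mixed term (`expJump_eq`,
`expJump_eq_reverse`). The five contributions behave as follows. Pair deaths occur with the exact
factor `⟨a⟩²`. Births, single and joint, are sums over pairs of a kernel whose integral does not
depend on `ε`, by translation invariance and evenness, while its supremum and its row integrals are
`O(s)`. The variance of such a sum is `O(s)`, so it concentrates at `z²` times the integral of the
kernel. This produces the integrals in `L₀` (`lintegral_deviation_sq_le`). Single deaths carry the
smeared rate summed over the other particle. For each `x` this inner sum concentrates at `z⟨a⟩²⟨b⟩`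
(`SmearBound.lintegral_deathError_sq_le`). Mixed terms require a jump into the support of `φ` while
another factor keeps the total integrable, so their integral is itself `O(s)`
(`SmearBound.lintegral_mixedMajorant_sq_le`). The tilt changes the means only through points in the
support of `φ`, which again costs `O(s)`. Altogether the squared norm of `L_ε F - L₀ F` is at most
`C s` with `C` independent of `ε`.

For the closed generator, `F` is approximated by the cylinder functions `min(F, n)`. Their
increments are dominated by those of `F`, and for fixed `γ` the truncation is eventually invisible
to all jumps, so dominated convergence applies (`inGenerator_expFun`). -/

lemma tsum_eq_toReal_sub {ι : Type*} {f : ι → ℝ} (hf : Summable f) :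
    ∑' i, f i = (∑' i, ENNReal.ofReal (f i)).toReal - (∑' i, ENNReal.ofReal (-f i)).toReal := by
  have h1 : Summable fun i => max (f i) 0 :=
    Summable.of_nonneg_of_le (fun i => le_max_right _ _)
      (fun i => max_le (le_abs_self _) (abs_nonneg _)) hf.abs
  have h2 : Summable fun i => max (-f i) 0 :=
    Summable.of_nonneg_of_le (fun i => le_max_right _ _)
      (fun i => max_le (neg_le_abs _) (abs_nonneg _)) hf.abs
  have e1 : ∑' i, ENNReal.ofReal (f i) = ENNReal.ofReal (∑' i, max (f i) 0) := by
    rw [ENNReal.ofReal_tsum_of_nonneg (fun i => le_max_right _ _) h1]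
    simp
  have e2 : ∑' i, ENNReal.ofReal (-f i) = ENNReal.ofReal (∑' i, max (-f i) 0) := by
    rw [ENNReal.ofReal_tsum_of_nonneg (fun i => le_max_right _ _) h2]
    simp
  rw [e1, e2, ENNReal.toReal_ofReal (tsum_nonneg fun i => le_max_right _ _),
    ENNReal.toReal_ofReal (tsum_nonneg fun i => le_max_right _ _), ← h1.tsum_sub h2]
  refine tsum_congr fun i => ?_
  rcases le_total 0 (f i) with h | h
  · rw [max_eq_left h, max_eq_right (by linarith)]; ring
  · rw [max_eq_right h, max_eq_left (by linarith)]; ring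

lemma summable_iff_tsum_ofReal_abs {ι : Type*} {f : ι → ℝ} :
    Summable f ↔ ∑' i, ENNReal.ofReal |f i| ≠ ∞ := by
  constructor
  · intro h
    rw [← ENNReal.ofReal_tsum_of_nonneg (fun i => abs_nonneg _) h.abs]
    exact ENNReal.ofReal_ne_top
  · intro h
    refine Summable.of_abs ?_
    have := ENNReal.summable_toReal h
    simpa using this

/-! ### Configurations as counting measures -/

namespace Config

variable {d : ℕ}

lemma finite_inter (γ : Config d) {Λ : Set (E d)} (hΛ : Bornology.IsBounded Λ) :
    (γ.1 ∩ Λ).Finite :=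
  (γ.2 _ hΛ.isCompact_closure).subset (Set.inter_subset_inter_right _ subset_closure)

lemma countable (γ : Config d) : γ.1.Countable := by
  have : γ.1 = ⋃ n : ℕ, γ.1 ∩ Metric.closedBall 0 n := by
    rw [← Set.inter_iUnion, Metric.iUnion_closedBall_nat, Set.inter_univ]
  rw [this]
  exact Set.countable_iUnion fun n => (γ.finite_inter Metric.isBounded_closedBall).countable

lemma measurableSet (γ : Config d) : MeasurableSet γ.1 := γ.countable.measurableSet

/-- The counting measure `∑_{x ∈ γ} δ_x`. -/
def toMeasure (γ : Config d) : Measure (E d) := Measure.count.restrict γ.1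

lemma toMeasure_apply (γ : Config d) {B : Set (E d)} (hB : MeasurableSet B) :
    γ.toMeasure B = (γ.1 ∩ B).encard := by
  rw [toMeasure, Measure.restrict_apply hB, Measure.count_apply (hB.inter γ.measurableSet),
    Set.inter_comm]

lemma lintegral_toMeasure (γ : Config d) (f : E d → ℝ≥0∞) :
    ∫⁻ x, f x ∂γ.toMeasure = ∑' x : γ.1, f x := by
  rw [toMeasure, lintegral_countable _ γ.countable]
  simp

lemma toMeasure_eq_count (γ : Config d) {B : Set (E d)} (hB : MeasurableSet B)
    (hb : Bornology.IsBounded B) : γ.toMeasure B = (count B γ : ℝ≥0∞) := by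
  rw [γ.toMeasure_apply hB, count, ← (γ.finite_inter hb).cast_ncard_eq]
  simp

lemma summable_pair (γ : Config d) {f : E d → ℝ} (hf : HasCompactSupport f) :
    Summable fun x : γ.1 => f x := by
  refine summable_of_hasFiniteSupport ?_
  have h := γ.2 _ hf
  refine Set.Finite.of_finite_image (f := Subtype.val) (h.subset ?_) Subtype.val_injective.injOn
  rintro _ ⟨x, hx, rfl⟩
  exact ⟨x.2, subset_tsupport _ hx⟩

lemma pair_eq_toReal_sub (γ : Config d) {f : E d → ℝ} (hf : HasCompactSupport f) :
    pair f γ = (∫⁻ x, ENNReal.ofReal (f x) ∂γ.toMeasure).toReal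
      - (∫⁻ x, ENNReal.ofReal (-f x) ∂γ.toMeasure).toReal := by
  rw [lintegral_toMeasure, lintegral_toMeasure, pair, tsum_eq_toReal_sub (γ.summable_pair hf)]

lemma ofReal_pair (γ : Config d) {f : E d → ℝ} (hf : HasCompactSupport f) (h0 : ∀ x, 0 ≤ f x) :
    ENNReal.ofReal (pair f γ) = ∫⁻ x, ENNReal.ofReal (f x) ∂γ.toMeasure := by
  rw [lintegral_toMeasure, pair,
    ENNReal.ofReal_tsum_of_nonneg (f := fun x : γ.1 => f x) (fun x => h0 x) (γ.summable_pair hf)]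

lemma mem_add {γ : Config d} {x y : E d} : y ∈ (γ.add x).1 ↔ y = x ∨ y ∈ γ.1 := Iff.rfl

lemma mem_remove {γ : Config d} {x y : E d} : y ∈ (γ.remove x).1 ↔ y ∈ γ.1 ∧ y ≠ x := Iff.rfl

lemma toMeasure_add (γ : Config d) {x : E d} (hx : x ∉ γ.1) :
    (γ.add x).toMeasure = γ.toMeasure + Measure.dirac x := by
  have : (γ.add x).1 = γ.1 ∪ {x} := by
    ext y; simp only [mem_add, Set.mem_union, Set.mem_singleton_iff]; tauto
  rw [toMeasure, toMeasure, this, Measure.restrict_union (by simpa) (measurableSet_singleton x)]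
  congr 1
  ext s hs
  rw [Measure.restrict_apply hs, Measure.dirac_apply' _ hs, Measure.count_apply (by measurability)]
  by_cases h : x ∈ s
  · have : s ∩ {x} = {x} := by simpa using h
    simp [this, h]
  · have : s ∩ {x} = ∅ := by simpa using h
    simp [this, h]

lemma add_eq_self {γ : Config d} {x : E d} (hx : x ∈ γ.1) : γ.add x = γ :=
  Subtype.ext (Set.insert_eq_of_mem hx)

lemma toMeasure_add_le (γ : Config d) (x : E d) :
    (γ.add x).toMeasure ≤ γ.toMeasure + Measure.dirac x := by
  by_cases hx : x ∈ γ.1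
  · rw [add_eq_self hx]; exact Measure.le_add_right le_rfl
  · rw [toMeasure_add γ hx]

lemma pair_add (γ : Config d) {f : E d → ℝ} (hf : HasCompactSupport f) {x : E d} (hx : x ∉ γ.1) :
    pair f (γ.add x) = pair f γ + f x := by
  have h := (γ.summable_pair hf)
  have e : (γ.add x).1 = {x} ∪ γ.1 := rfl
  have hd : Disjoint {x} γ.1 := by simpa using hx
  rw [pair, pair, e, (Summable.of_finite (f := f ∘ ((↑) : ({x} : Set (E d)) → E d))).tsum_union_disjoint hd h,
    add_comm]
  congr 1
  exact tsum_singleton x f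

lemma add_remove {γ : Config d} {x : E d} (hx : x ∈ γ.1) : (γ.remove x).add x = γ := by
  refine Subtype.ext (Set.ext fun y => ?_)
  show y ∈ ((γ.remove x).add x).1 ↔ _
  rw [mem_add, mem_remove]
  by_cases h : y = x
  · subst h; simp [hx]
  · simp [h]

lemma pair_remove (γ : Config d) {f : E d → ℝ} (hf : HasCompactSupport f) {x : E d}
    (hx : x ∈ γ.1) : pair f (γ.remove x) = pair f γ - f x := by
  have := (γ.remove x).pair_add hf (x := x) (fun h => h.2 rfl)
  rw [add_remove hx] at this
  rw [this]; ring

lemma pair_remove_remove (γ : Config d) {f : E d → ℝ} (hf : HasCompactSupport f) {x y : E d}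
    (hx : x ∈ γ.1) (hy : y ∈ γ.1) (hxy : x ≠ y) :
    pair f ((γ.remove x).remove y) = pair f γ - f x - f y := by
  rw [pair_remove _ hf (mem_remove.2 ⟨hy, hxy.symm⟩), pair_remove _ hf hx]

lemma pair_jump (γ : Config d) {f : E d → ℝ} (hf : HasCompactSupport f) {x₁ x₂ h₁ h₂ : E d}
    (hx : x₁ ∈ γ.1) (hy : x₂ ∈ γ.1) (hxy : x₁ ≠ x₂) (h1 : x₁ + h₁ ∉ γ.1) (h2 : x₂ + h₂ ∉ γ.1)
    (h12 : x₁ + h₁ ≠ x₂ + h₂) :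
    pair f (γ.jump x₁ x₂ h₁ h₂) = pair f γ - f x₁ - f x₂ + f (x₁ + h₁) + f (x₂ + h₂) := by
  rw [jump, pair_add _ hf, pair_add _ hf, pair_remove_remove _ hf hx hy hxy]
  · exact fun h => h1 h.1.1
  · rintro (h | h)
    · exact h12 h.symm
    · exact h2 h.1.1

/-! ### The vague topology and its Borel `σ`-algebra -/

lemma continuous_pair {f : E d → ℝ} (hf : Continuous f) (hs : HasCompactSupport f) :
    Continuous (pair f : Config d → ℝ) := by
  have h : (inferInstance : TopologicalSpace (Config d)) ≤
      TopologicalSpace.induced (pair f) inferInstance :=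
    iInf_le (fun f : {f : E d → ℝ // Continuous f ∧ HasCompactSupport f} =>
      TopologicalSpace.induced (pair f.1) inferInstance) ⟨f, hf, hs⟩
  exact continuous_iff_le_induced.2 h

/-- A continuous function with values in `[0, 1]` that is `1` on the ball of radius `R` and vanishes
outside of the ball of radius `R + 1`. -/
def cutoff (R : ℕ) (x : E d) : ℝ := max 0 (min 1 (R + 1 - ‖x‖))

lemma continuous_cutoff (R : ℕ) : Continuous (cutoff R : E d → ℝ) := by
  unfold cutoff; fun_prop

lemma cutoff_nonneg (R : ℕ) (x : E d) : 0 ≤ cutoff R x := le_max_left _ _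

lemma cutoff_eq_one {R : ℕ} {x : E d} (hx : ‖x‖ ≤ R) : cutoff R x = 1 := by
  rw [cutoff, min_eq_left (by linarith), max_eq_right zero_le_one]

lemma cutoff_eq_zero {R : ℕ} {x : E d} (hx : (R : ℝ) + 1 ≤ ‖x‖) : cutoff R x = 0 := by
  rw [cutoff, min_eq_right (by linarith), max_eq_left (by linarith)]

lemma hasCompactSupport_cutoff (R : ℕ) : HasCompactSupport (cutoff R : E d → ℝ) := by
  refine HasCompactSupport.intro (isCompact_closedBall (0 : E d) (R + 1)) fun x hx => ?_
  refine cutoff_eq_zero ?_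
  simpa using (lt_of_not_ge (fun h => hx (by simpa using h))).le

/-- Countably many continuous functions with compact support whose pairings determine the vague
topology. -/
def testFun (p : ℕ × ℕ) (x : E d) : ℝ :=
  TopologicalSpace.denseSeq C(E d, ℝ) p.1 x * cutoff p.2 x

lemma continuous_testFun (p : ℕ × ℕ) : Continuous (testFun p : E d → ℝ) :=
  (map_continuous _).mul (continuous_cutoff _)

lemma hasCompactSupport_testFun (p : ℕ × ℕ) : HasCompactSupport (testFun p : E d → ℝ) :=
  (hasCompactSupport_cutoff p.2).mul_left

lemma abs_pair_sub_le (γ : Config d) {f f' g : E d → ℝ} (hf : HasCompactSupport f)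
    (hf' : HasCompactSupport f') (hg : HasCompactSupport g) (h : ∀ x, |f x - f' x| ≤ g x) :
    |pair f γ - pair f' γ| ≤ pair g γ := by
  rw [pair, pair, ← (γ.summable_pair hf).tsum_sub (γ.summable_pair hf')]
  exact tsum_of_norm_bounded (f := fun x : γ.1 => f x - f' x) (γ.summable_pair hg).hasSum
    fun x => h x

/-- Density of a sequence in the compact-open topology gives uniform approximation on a ball;
multiplying by a cutoff that is `1` on the support of `f` does not change `f`. The radius `R` is
chosen before `δ`, so that the error for any configuration is `δ` times one fixed statistic. -/
lemma exists_testFun_approx {f : E d → ℝ} (hf : Continuous f) (hs : HasCompactSupport f) :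
    ∃ R : ℕ, ∀ δ : ℝ, 0 < δ → ∃ p : ℕ × ℕ, p.2 = R ∧
      ∀ x, |f x - testFun p x| ≤ δ * cutoff R x := by
  obtain ⟨r, hr⟩ := hs.isCompact.isBounded.subset_closedBall 0
  obtain ⟨R, hR⟩ := exists_nat_ge r
  refine ⟨R, fun δ hδ => ?_⟩
  have hK := isCompact_closedBall (0 : E d) (R + 1)
  have hopen : {u : C(E d, ℝ) | ∀ x ∈ Metric.closedBall (0 : E d) (R + 1), |f x - u x| < δ} ∈
      𝓝 (⟨f, hf⟩ : C(E d, ℝ)) := by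
    have := (ContinuousMap.tendsto_iff_forall_isCompact_tendstoUniformlyOn
      (F := fun u : C(E d, ℝ) => u) (p := 𝓝 ⟨f, hf⟩) (f := ⟨f, hf⟩)).1 tendsto_id _ hK
    exact (Metric.tendstoUniformlyOn_iff.1 this δ hδ)
  obtain ⟨n, hn⟩ := (TopologicalSpace.denseRange_denseSeq C(E d, ℝ)).exists_mem_open
    isOpen_interior ⟨_, mem_interior_iff_mem_nhds.2 hopen⟩
  have hu := interior_subset hn
  refine ⟨(n, R), rfl, fun x => ?_⟩
  have e : f x - testFun (n, R) x
      = (f x - TopologicalSpace.denseSeq C(E d, ℝ) n x) * cutoff R x := by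
    have : f x = f x * cutoff R x := by
      by_cases hx : ‖x‖ ≤ R
      · rw [cutoff_eq_one hx, mul_one]
      · have : f x = 0 := by
          by_contra h0
          have h1 := hr (subset_tsupport _ h0)
          simp at h1
          exact hx (h1.trans hR)
        simp [this]
    rw [sub_mul, ← this]; rfl
  rw [e, abs_mul, abs_of_nonneg (cutoff_nonneg R x)]
  by_cases hx : x ∈ Metric.closedBall (0 : E d) (R + 1)
  · exact mul_le_mul_of_nonneg_right (hu x hx).le (cutoff_nonneg R x)
  · rw [cutoff_eq_zero]
    · simp
    · simpa using (lt_of_not_ge (fun h => hx (by simpa using h))).le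

/-- The pairings with the cutoffs and with the countable family of test functions. -/
def testMap (γ : Config d) : (ℕ → ℝ) × (ℕ × ℕ → ℝ) :=
  (fun R => pair (cutoff R) γ, fun p => pair (testFun p) γ)

/-- The uncountably many pairings defining the vague topology can be replaced by countably many:
near a given configuration the cutoff statistic stays bounded, hence `⟨f,·⟩` is there a uniform
limit of the pairings with test functions. Countability is what ties the Borel `σ`-algebra to the
pairings. -/
lemma topology_eq_induced :
    (inferInstance : TopologicalSpace (Config d)) =
      TopologicalSpace.induced (testMap (d := d)) inferInstance := by
  refine le_antisymm ?_ ?_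
  · refine continuous_iff_le_induced.1 (Continuous.prodMk ?_ ?_)
    · exact continuous_pi fun R => continuous_pair (continuous_cutoff R) (hasCompactSupport_cutoff R)
    · exact continuous_pi fun p =>
        continuous_pair (continuous_testFun p) (hasCompactSupport_testFun p)
  · refine le_iInf fun ⟨f, hf, hs⟩ => ?_
    let t : TopologicalSpace (Config d) :=
      TopologicalSpace.induced (testMap (d := d)) inferInstance
    have hΦ : Continuous[t, _] (testMap (d := d)) := continuous_induced_dom
    suffices Continuous[t, _] (pair f : Config d → ℝ) from continuous_iff_le_induced.1 this
    have hc : ∀ R, Continuous[t, _] (pair (cutoff R) : Config d → ℝ) := fun R =>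
      (continuous_apply R).comp (continuous_fst.comp hΦ)
    have ht : ∀ p, Continuous[t, _] (pair (testFun p) : Config d → ℝ) := fun p =>
      (continuous_apply p).comp (continuous_snd.comp hΦ)
    obtain ⟨R, hR⟩ := exists_testFun_approx hf hs
    refine continuous_iff_continuousAt.2 fun γ₀ => Metric.tendsto_nhds.2 fun r hr => ?_
    have h0 : 0 ≤ pair (cutoff R) γ₀ := tsum_nonneg fun x => cutoff_nonneg R _
    set c := pair (cutoff R) γ₀ with hcdef
    -- Near `γ₀` the cutoff statistic is below `c + 1`, so this `δ` makes the approximation error at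
    -- most `r/4` both at `γ` and at `γ₀`; the variation of the test pairing adds another `r/4`.
    obtain ⟨p, rfl, hp⟩ := hR (r / (4 * (c + 1))) (by positivity)
    set δ := r / (4 * (c + 1)) with hδ
    have key : ∀ γ : Config d, |pair f γ - pair (testFun p) γ| ≤ δ * pair (cutoff p.2) γ := by
      intro γ
      have := γ.abs_pair_sub_le hs (hasCompactSupport_testFun p)
        ((hasCompactSupport_cutoff p.2).mul_left (f := fun _ => δ)) hp
      refine this.trans (le_of_eq ?_)
      exact tsum_mul_left
    have e1 : ∀ᶠ γ in @nhds _ t γ₀, pair (cutoff p.2) γ < c + 1 :=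
      (hc p.2).continuousAt.eventually_lt continuousAt_const (lt_add_one c)
    have e2 : ∀ᶠ γ in @nhds _ t γ₀, dist (pair (testFun p) γ) (pair (testFun p) γ₀) < r / 4 :=
      Metric.tendsto_nhds.1 (ht p).continuousAt _ (by positivity)
    filter_upwards [e1, e2] with γ h1 h2
    have k1 := key γ
    have k2 := key γ₀
    have hδ0 : 0 < δ := by positivity
    have hδ1 : δ * (c + 1) = r / 4 := by rw [hδ]; field_simp
    have k3 : δ * pair (cutoff p.2) γ ≤ r / 4 := by rw [← hδ1]; gcongr
    have k4 : δ * pair (cutoff p.2) γ₀ ≤ r / 4 := by rw [← hδ1]; gcongr; exact (lt_add_one c).le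
    rw [Real.dist_eq] at h2 ⊢
    rw [abs_lt] at h2 ⊢
    rw [abs_le] at k1 k2
    constructor <;> linarith

/-- Taking Borel `σ`-algebras commutes with inducing a topology, and on a countable product of real
lines the product and the Borel `σ`-algebra agree. Hence measurability into `Config d` can be tested
on pairings. -/
lemma measurableSpace_eq_comap :
    (inferInstance : MeasurableSpace (Config d)) =
      MeasurableSpace.comap (testMap (d := d)) inferInstance := by
  have h : (inferInstance : MeasurableSpace (Config d)) = borel (Config d) := rfl
  have h2 : (inferInstance : MeasurableSpace ((ℕ → ℝ) × (ℕ × ℕ → ℝ))) = borel _ :=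
    BorelSpace.measurable_eq
  rw [h2, ← borel_comap, h]
  congr 1
  exact topology_eq_induced

lemma measurable_of_pair {Ω : Type*} [MeasurableSpace Ω] {T : Ω → Config d}
    (h : ∀ f : E d → ℝ, Continuous f → HasCompactSupport f → Measurable fun ω => pair f (T ω)) :
    Measurable T := by
  suffices h' : Measurable[_, MeasurableSpace.comap (testMap (d := d)) inferInstance] T by
    rw [← measurableSpace_eq_comap] at h'
    exact h'
  rw [measurable_comap_iff]
  refine Measurable.prodMk ?_ ?_
  · exact measurable_pi_iff.2 fun R => h _ (continuous_cutoff R) (hasCompactSupport_cutoff R)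
  · exact measurable_pi_iff.2 fun p => h _ (continuous_testFun p) (hasCompactSupport_testFun p)

lemma measurable_of_toMeasure {Ω : Type*} [MeasurableSpace Ω] {T : Ω → Config d}
    (h : Measurable fun ω => (T ω).toMeasure) : Measurable T := by
  refine measurable_of_pair fun f hf hs => ?_
  simp only [pair_eq_toReal_sub _ hs]
  refine Measurable.sub ?_ ?_
  · exact ((Measure.measurable_lintegral (by fun_prop)).comp h).ennreal_toReal
  · exact ((Measure.measurable_lintegral (by fun_prop)).comp h).ennreal_toReal

lemma toMeasure_eq_iSup (γ : Config d) {B : Set (E d)} (hB : MeasurableSet B) :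
    γ.toMeasure B = ⨆ n : ℕ, (count (B ∩ Metric.closedBall 0 n) γ : ℝ≥0∞) := by
  have : B = ⋃ n : ℕ, B ∩ Metric.closedBall 0 n := by
    rw [← Set.inter_iUnion, Metric.iUnion_closedBall_nat, Set.inter_univ]
  conv_lhs => rw [this]
  rw [Monotone.measure_iUnion]
  · congr 1; ext n
    exact γ.toMeasure_eq_count (hB.inter measurableSet_closedBall)
      (Metric.isBounded_closedBall.subset Set.inter_subset_right)
  · intro n m hnm
    exact Set.inter_subset_inter_right _ (Metric.closedBall_subset_closedBall (by exact_mod_cast hnm))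

/-- Numbers of points determine the counting measure, hence all pairings. Together with
`measurable_count` this says that the Borel `σ`-algebra is generated by the numbers of points in
bounded Borel sets. -/
lemma measurable_of_count {Ω : Type*} [MeasurableSpace Ω] {T : Ω → Config d}
    (h : ∀ B : Set (E d), MeasurableSet B → Bornology.IsBounded B →
      Measurable fun ω => count B (T ω)) : Measurable T := by
  refine measurable_of_toMeasure (Measure.measurable_of_measurable_coe _ fun B hB => ?_)
  simp only [toMeasure_eq_iSup _ hB]
  refine Measurable.iSup fun n => ?_
  exact (measurable_from_top (f := fun n : ℕ => (n : ℝ≥0∞))).comp (h _ (hB.inter measurableSet_closedBall)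
    (Metric.isBounded_closedBall.subset Set.inter_subset_right))

lemma toMeasure_lt_top (γ : Config d) {B : Set (E d)} (hb : Bornology.IsBounded B) :
    γ.toMeasure B < ∞ := by
  refine (measure_mono subset_closure).trans_lt ?_
  rw [γ.toMeasure_eq_count isClosed_closure.measurableSet hb.closure]
  exact ENNReal.natCast_lt_top _

/-- The indicator of a compact set is a decreasing limit of continuous functions with compact
support, the thickened indicators, so the number of points in it is a pointwise limit of pairings.
-/
lemma measurable_toMeasure_isCompact {K : Set (E d)} (hK : IsCompact K) :
    Measurable fun γ : Config d => γ.toMeasure K := by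
  have hpos : ∀ n : ℕ, 0 < (1 / ((n : ℝ) + 1)) := fun n => Nat.one_div_pos_of_nat
  have hlim := tendsto_one_div_add_atTop_nhds_zero_nat (𝕜 := ℝ)
  refine measurable_of_tendsto_metrizable (f := fun (n : ℕ) (γ : Config d) =>
    ENNReal.ofReal (pair (fun x => (thickenedIndicator (hpos n) K x : ℝ)) γ)) (fun n => ?_) ?_
  · have hcs : HasCompactSupport fun x => (thickenedIndicator (hpos n) K x : ℝ) := by
      refine HasCompactSupport.intro (hK.cthickening (r := 1 / ((n : ℝ) + 1))) fun x hx => ?_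
      have := thickenedIndicator_zero (hpos n) K
        (fun h => hx (Metric.thickening_subset_cthickening _ _ h))
      rw [this]; rfl
    exact (continuous_pair (by fun_prop) hcs).measurable.ennreal_ofReal
  · refine tendsto_pi_nhds.2 fun γ => ?_
    have hKb : Bornology.IsBounded (Metric.cthickening 1 K) := hK.isBounded.cthickening
    -- The convergence of the integrals needs a finite measure. All thickenings have radius at most
    -- `1`, so restricting to the closed `1`-thickening of `K` loses nothing.
    have : IsFiniteMeasure (γ.toMeasure.restrict (Metric.cthickening 1 K)) :=
      ⟨by rw [Measure.restrict_apply_univ]; exact γ.toMeasure_lt_top hKb⟩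
    have h := tendsto_lintegral_thickenedIndicator_of_isClosed
      (γ.toMeasure.restrict (Metric.cthickening 1 K)) hK.isClosed hpos hlim
    rw [Measure.restrict_apply hK.measurableSet,
      Set.inter_eq_left.2 (Metric.self_subset_cthickening K)] at h
    refine h.congr fun n => ?_
    have hz : ∀ x, x ∉ Metric.cthickening 1 K → thickenedIndicator (hpos n) K x = 0 := by
      intro x hx
      refine thickenedIndicator_zero (hpos n) K fun h => hx ?_
      refine Metric.thickening_subset_cthickening _ _ (Metric.thickening_mono ?_ _ h)
      rw [div_le_one (by positivity)]; linarith [(Nat.cast_nonneg n : (0 : ℝ) ≤ n)]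
    have hcs : HasCompactSupport fun x => (thickenedIndicator (hpos n) K x : ℝ) :=
      HasCompactSupport.intro (hK.cthickening (r := 1)) fun x hx => by rw [hz x hx]; rfl
    rw [ofReal_pair _ hcs (fun x => NNReal.coe_nonneg _)]
    simp only [ENNReal.ofReal_coe_nnreal]
    refine setLIntegral_eq_of_support_subset ?_
    intro x hx
    by_contra h
    refine hx ?_
    show ((thickenedIndicator (hpos n) K x : ℝ≥0) : ℝ≥0∞) = 0
    rw [hz x h]; rfl

/-- Inside a ball the counting measures are finite, and closed sets form a generating `π`-system on
which measurability is known from the compact case. General Borel sets follow by exhausting the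
space with balls. -/
lemma measurable_toMeasure : Measurable (toMeasure : Config d → Measure (E d)) := by
  have h1 : ∀ n : ℕ, Measurable fun γ : Config d =>
      γ.toMeasure.restrict (Metric.closedBall 0 n) := by
    intro n
    have : ∀ γ : Config d, IsFiniteMeasure (γ.toMeasure.restrict (Metric.closedBall 0 n)) :=
      fun γ => ⟨by rw [Measure.restrict_apply_univ]
                   exact γ.toMeasure_lt_top Metric.isBounded_closedBall⟩
    refine Measurable.measure_of_isPiSystem (S := {s | IsClosed s}) ?_ isPiSystem_isClosed ?_ ?_
    · rw [← borel_eq_generateFrom_isClosed]; exact BorelSpace.measurable_eq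
    · intro s hs
      simp only [Measure.restrict_apply (IsClosed.measurableSet hs)]
      exact measurable_toMeasure_isCompact
        (by rw [Set.inter_comm]; exact (isCompact_closedBall _ _).inter_right hs)
    · simp only [Measure.restrict_apply_univ]
      exact measurable_toMeasure_isCompact (isCompact_closedBall _ _)
  refine Measure.measurable_of_measurable_coe _ fun B hB => ?_
  have : (fun γ : Config d => γ.toMeasure B)
      = fun γ => ⨆ n : ℕ, γ.toMeasure.restrict (Metric.closedBall 0 n) B := by
    ext γ
    rw [γ.toMeasure_eq_iSup hB]
    congr 1; ext n
    rw [Measure.restrict_apply hB, γ.toMeasure_eq_count (hB.inter measurableSet_closedBall)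
      (Metric.isBounded_closedBall.subset Set.inter_subset_right)]
  rw [this]
  exact Measurable.iSup fun n => (Measure.measurable_coe hB).comp (h1 n)

lemma measurable_count {B : Set (E d)} (hB : MeasurableSet B) (hb : Bornology.IsBounded B) :
    Measurable (count B : Config d → ℕ) := by
  have h : Measurable fun γ : Config d => (γ.toMeasure B).toReal :=
    ((Measure.measurable_coe hB).comp measurable_toMeasure).ennreal_toReal
  have h2 : Measurable fun γ : Config d => ⌊(γ.toMeasure B).toReal⌋₊ := Nat.measurable_floor.comp h
  convert h2 using 2 with γ
  rw [γ.toMeasure_eq_count hB hb]; simp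

end Config
end
end BinaryJumps

/-! ### Joint measurability in the configuration and the point -/

namespace BinaryJumps

noncomputable section

namespace Config

variable {d : ℕ}

/-- The counting measures of the configurations, as a kernel. -/
def kap (d : ℕ) : Kernel (Config d) (E d) := ⟨toMeasure, measurable_toMeasure⟩

lemma kap_apply (γ : Config d) : kap d γ = γ.toMeasure := rfl

/-- The number of points is not bounded uniformly in `γ`, even in a bounded set. The space is
therefore cut into bounded shells, and for each shell the configurations are sorted by their number
`k` of points there: each piece is a kernel of mass at most `k`. This gives access to Tonelli and to
composition products. -/
instance : IsSFiniteKernel (kap d) := by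
  let A : ℕ → Set (E d) := disjointed fun n : ℕ => Metric.closedBall (0 : E d) n
  have hA : ∀ n, MeasurableSet (A n) :=
    MeasurableSet.disjointed fun n => measurableSet_closedBall
  have hAb : ∀ n, Bornology.IsBounded (A n) := fun n =>
    Metric.isBounded_closedBall.subset (disjointed_subset _ n)
  have hS : ∀ n k, MeasurableSet {γ : Config d | count (A n) γ = k} := fun n k =>
    measurable_count (hA n) (hAb n) (measurableSet_singleton k)
  classical
  let κ : ℕ × ℕ → Kernel (Config d) (E d) := fun p =>
    Kernel.piecewise (hS p.1 p.2) ((kap d).restrict (hA p.1)) 0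
  have hκ : ∀ p, IsFiniteKernel (κ p) := fun p => by
    refine ⟨⟨p.2, ENNReal.natCast_lt_top _, fun γ => ?_⟩⟩
    simp only [κ, Kernel.piecewise_apply]
    split_ifs with h
    · rw [Kernel.restrict_apply, Measure.restrict_apply_univ, kap_apply,
        γ.toMeasure_eq_count (hA _) (hAb _)]
      rw [Set.mem_ofPred_eq] at h
      rw [h]
    · simp
  have hsum : kap d = Kernel.sum κ := by
    ext γ B hB
    rw [Kernel.sum_apply, Measure.sum_apply _ hB, ENNReal.tsum_prod']
    have h1 : ∀ n, ∑' k, κ (n, k) γ B = γ.toMeasure (B ∩ A n) := by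
      intro n
      rw [tsum_eq_single (count (A n) γ)]
      · simp only [κ, Kernel.piecewise_apply]
        rw [if_pos (by simp), Kernel.restrict_apply, Measure.restrict_apply hB, kap_apply]
      · intro k hk
        simp only [κ, Kernel.piecewise_apply]
        rw [if_neg (fun h => hk (by simpa using h.symm))]
        simp
    simp only [h1]
    rw [← measure_iUnion, ← Set.inter_iUnion, iUnion_disjointed, Metric.iUnion_closedBall_nat,
      Set.inter_univ, kap_apply]
    · exact fun i j hij => ((disjoint_disjointed _) hij).mono Set.inter_subset_right
        Set.inter_subset_right
    · exact fun n => hB.inter (hA n)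
  rw [hsum]
  infer_instance

lemma measurable_lintegral_toMeasure {Ω : Type*} [MeasurableSpace Ω] {T : Ω → Config d}
    (hT : Measurable T) {f : Ω → E d → ℝ≥0∞} (hf : Measurable (Function.uncurry f)) :
    Measurable fun ω => ∫⁻ x, f ω x ∂(T ω).toMeasure :=
  Measurable.lintegral_kernel_prod_right (κ := (kap d).comap T hT) hf

/-- Membership of `x` means that `∑_{y ∈ γ} 1_{y = x}` is nonzero, and this sum is a parametrised
kernel integral. -/
lemma measurableSet_mem : MeasurableSet {p : Config d × E d | p.2 ∈ p.1.1} := by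
  have h : Measurable fun p : Config d × E d =>
      ∫⁻ x, (if x = p.2 then 1 else 0 : ℝ≥0∞) ∂p.1.toMeasure := by
    refine measurable_lintegral_toMeasure measurable_fst ?_
    refine Measurable.ite ?_ measurable_const measurable_const
    exact measurableSet_eq_fun measurable_snd (measurable_snd.comp measurable_fst)
  convert h (measurableSet_singleton 0).compl using 1
  ext ⟨γ, x⟩
  simp only [Set.mem_ofPred_eq, Set.mem_preimage, Set.mem_compl_iff, Set.mem_singleton_iff,
    lintegral_toMeasure, ENNReal.tsum_eq_zero]
  push Not
  constructor
  · intro hx; exact ⟨⟨x, hx⟩, by simp⟩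
  · rintro ⟨y, hy⟩
    have : (y : E d) = x := by by_contra h; simp [h] at hy
    exact this ▸ y.2

/-- On counting measures, insertion adds a Dirac mass with coefficient `0` or `1` according to
whether the point is already present. -/
lemma measurable_add : Measurable fun p : Config d × E d => p.1.add p.2 := by
  classical
  refine measurable_of_toMeasure ?_
  have h : (fun p : Config d × E d => (p.1.add p.2).toMeasure) = fun p =>
      p.1.toMeasure + (if p.2 ∈ p.1.1 then 0 else 1 : ℝ≥0∞) • Measure.dirac p.2 := by
    ext1 p
    split_ifs with h
    · rw [add_eq_self h]; simp
    · rw [toMeasure_add _ h]; simp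
  rw [h]
  refine Measure.measurable_of_measurable_coe _ fun B hB => ?_
  simp only [Measure.add_apply, Measure.smul_apply, smul_eq_mul]
  refine ((Measure.measurable_coe hB).comp (measurable_toMeasure.comp measurable_fst)).add ?_
  refine Measurable.mul ?_ ?_
  · exact Measurable.ite measurableSet_mem measurable_const measurable_const
  · exact (Measure.measurable_coe hB).comp (Measure.measurable_dirac.comp measurable_snd)

lemma measurable_pair {f : E d → ℝ} (hf : Continuous f) (hs : HasCompactSupport f) :
    Measurable (pair f : Config d → ℝ) := (continuous_pair hf hs).measurable

lemma ae_notMem (γ : Config d) (ρ : Measure (E d)) [NullSingletonClass ρ] : ∀ᵐ x ∂ρ, x ∉ γ.1 :=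
  γ.countable.ae_notMem ρ

end Config

end
end BinaryJumps

/-! ### The Mecke identity for the Poisson measure -/

namespace BinaryJumps

noncomputable section

variable {d : ℕ}

/-- The Mecke identity with intensity measure `ρ`. -/
def IsMecke (P : Measure (Config d)) (ρ : Measure (E d)) : Prop :=
  ∀ f : Config d → E d → ℝ≥0∞, Measurable (Function.uncurry f) →
    ∫⁻ γ, ∫⁻ x, f γ x ∂γ.toMeasure ∂P = ∫⁻ γ, ∫⁻ x, f (γ.add x) x ∂ρ ∂P

instance (z : ℝ≥0) : IsLocallyFiniteMeasure (intensity d z) := by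
  unfold intensity; infer_instance

instance (z : ℝ≥0) : SigmaFinite (intensity d z) := by
  unfold intensity; infer_instance

instance [Nonempty (Fin d)] (z : ℝ≥0) : NullSingletonClass (intensity d z) :=
  ⟨fun x => by
    have : (volume : Measure (E d)) {x} = 0 := measure_singleton x
    simp [intensity, this]⟩

lemma intensity_lt_top (z : ℝ≥0) {Λ : Set (E d)} (hb : Bornology.IsBounded Λ) :
    intensity d z Λ < ∞ := hb.measure_lt_top

/-- This recursion is the Mecke identity for a single set: weighting by the number of points amounts
to adding a point and multiplying by the intensity. -/
lemma natCast_mul_poissonMeasure (r : ℝ≥0) (k : ℕ) :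
    ((k + 1 : ℕ) : ℝ≥0∞) * poissonMeasure r {k + 1} = r * poissonMeasure r {k} := by
  rw [poissonMeasure_singleton, poissonMeasure_singleton, ← ENNReal.ofReal_natCast,
    ← ENNReal.ofReal_coe_nnreal, ← ENNReal.ofReal_mul (by positivity),
    ← ENNReal.ofReal_mul (by positivity)]
  congr 1
  rw [Nat.factorial_succ]
  push_cast
  field_simp
  ring

namespace Config

lemma count_add (γ : Config d) {x : E d} (hx : x ∉ γ.1) {Λ : Set (E d)} [Decidable (x ∈ Λ)]
    (hΛ : MeasurableSet Λ) (hb : Bornology.IsBounded Λ) :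
    count Λ (γ.add x) = count Λ γ + if x ∈ Λ then 1 else 0 := by
  have h : ((count Λ (γ.add x) : ℕ) : ℝ≥0∞) = (count Λ γ + if x ∈ Λ then 1 else 0 : ℕ) := by
    rw [← toMeasure_eq_count _ hΛ hb, toMeasure_add _ hx, Measure.add_apply,
      toMeasure_eq_count _ hΛ hb, Measure.dirac_apply' _ hΛ]
    split_ifs with h <;> simp [h]
  exact_mod_cast h

lemma count_eq_sum {ι : Type*} (S : Finset ι) {A : ι → Set (E d)} {Λ : Set (E d)}
    (hA : ∀ i ∈ S, MeasurableSet (A i)) (hΛ : MeasurableSet Λ) (hb : Bornology.IsBounded Λ)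
    (hd : (S : Set ι).PairwiseDisjoint A) (hU : Λ = ⋃ i ∈ S, A i) (γ : Config d) :
    count Λ γ = ∑ i ∈ S, count (A i) γ := by
  have h : ((count Λ γ : ℕ) : ℝ≥0∞) = (∑ i ∈ S, count (A i) γ : ℕ) := by
    rw [← toMeasure_eq_count _ hΛ hb, hU, measure_biUnion_finset hd hA, Nat.cast_sum]
    refine Finset.sum_congr rfl fun i hi => toMeasure_eq_count _ (hA i hi) (hb.subset ?_)
    rw [hU]
    exact Set.subset_biUnion_of_mem hi
  exact_mod_cast h

end Config

open Config

namespace IsPoisson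

variable {z : ℝ≥0} {π : Measure (Config d)}

lemma measure_count_eq (hπ : IsPoisson z π) {Λ : Set (E d)} (hΛ : MeasurableSet Λ)
    (hb : Bornology.IsBounded Λ) (k : ℕ) :
    π (count Λ ⁻¹' {k}) = poissonMeasure (intensity d z Λ).toNNReal {k} := by
  have h := hπ.hasLaw_count Λ hΛ hb
  rw [← h.map_eq, Measure.map_apply_of_aemeasurable h.aemeasurable (measurableSet_singleton k)]

lemma measure_counts_eq (hπ : IsPoisson z π) {ι : Type*} [Fintype ι] {A : ι → Set (E d)}
    (hA : ∀ i, MeasurableSet (A i)) (hb : ∀ i, Bornology.IsBounded (A i))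
    (hd : Pairwise fun i j => Disjoint (A i) (A j)) (k : ι → ℕ) :
    π {γ | (fun i => count (A i) γ) = k}
      = ∏ i, poissonMeasure (intensity d z (A i)).toNNReal {k i} := by
  let e := (Fintype.equivFin ι).symm
  have h := hπ.indep_count (Fintype.card ι) (fun i => A (e i)) (fun i => hA _) (fun i => hb _)
    (fun i j hij => hd (fun h => hij (e.injective h)))
  have h2 := h.measure_inter_preimage_eq_mul Finset.univ (sets := fun i => {k (e i)})
    (fun i _ => measurableSet_singleton _)
  rw [← Equiv.prod_comp e]
  simp only [hπ.measure_count_eq (hA _) (hb _)] at h2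
  rw [← h2]
  congr 1
  ext γ
  simp only [Set.mem_ofPred_eq, funext_iff, Finset.mem_univ, Set.iInter_true, Set.mem_iInter,
    Set.mem_preimage, Set.mem_singleton_iff]
  exact e.surjective.forall

/-- For disjoint sets the joint law of the counts is a product, so the one-dimensional recursion is
applied in the coordinate `i₀` alone. If `k i₀ = 0` both sides vanish, as no count increased by one
is zero. -/
lemma mul_measure_counts_eq (hπ : IsPoisson z π) {ι : Type*} [Fintype ι] [DecidableEq ι]
    {A : ι → Set (E d)}
    (hA : ∀ i, MeasurableSet (A i)) (hb : ∀ i, Bornology.IsBounded (A i))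
    (hd : Pairwise fun i j => Disjoint (A i) (A j)) (i₀ : ι) (k : ι → ℕ) :
    (k i₀ : ℝ≥0∞) * π {γ | (fun i => count (A i) γ) = k}
      = intensity d z (A i₀) * π {γ | (fun i => count (A i) γ) + Pi.single i₀ 1 = k} := by
  rcases Nat.eq_zero_or_pos (k i₀) with h0 | h0
  · have : {γ : Config d | (fun i => count (A i) γ) + Pi.single i₀ 1 = k} = ∅ := by
      ext γ
      simp only [Set.mem_ofPred_eq, Set.mem_empty_iff_false, iff_false]
      intro h
      have := congrFun h i₀
      simp at this
      omega
    rw [this, h0]; simp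
  · have e : {γ : Config d | (fun i => count (A i) γ) + Pi.single i₀ 1 = k}
        = {γ | (fun i => count (A i) γ) = Function.update k i₀ (k i₀ - 1)} := by
      ext γ
      simp only [Set.mem_ofPred_eq, funext_iff]
      refine forall_congr' fun i => ?_
      by_cases hi : i = i₀
      · subst hi; simp; omega
      · simp [hi]
    rw [e, hπ.measure_counts_eq hA hb hd, hπ.measure_counts_eq hA hb hd,
      ← Finset.mul_prod_erase _ _ (Finset.mem_univ i₀),
      ← Finset.mul_prod_erase _ _ (Finset.mem_univ i₀), ← mul_assoc, ← mul_assoc]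
    congr 1
    · have := natCast_mul_poissonMeasure (intensity d z (A i₀)).toNNReal (k i₀ - 1)
      rw [Nat.sub_add_cancel h0, ENNReal.coe_toNNReal (intensity_lt_top z (hb i₀)).ne] at this
      simpa using this
    · refine Finset.prod_congr rfl fun i hi => ?_
      rw [Function.update_of_ne (Finset.ne_of_mem_erase hi)]

lemma lintegral_count_mul (hπ : IsPoisson z π) {ι : Type*} [Fintype ι] [DecidableEq ι]
    {A : ι → Set (E d)}
    (hA : ∀ i, MeasurableSet (A i)) (hb : ∀ i, Bornology.IsBounded (A i))
    (hd : Pairwise fun i j => Disjoint (A i) (A j)) (i₀ : ι) (f : (ι → ℕ) → ℝ≥0∞) :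
    ∫⁻ γ, (count (A i₀) γ : ℝ≥0∞) * f (fun i => count (A i) γ) ∂π
      = intensity d z (A i₀) * ∫⁻ γ, f ((fun i => count (A i) γ) + Pi.single i₀ 1) ∂π := by
  have hN : Measurable fun (γ : Config d) (i : ι) => count (A i) γ :=
    measurable_pi_iff.2 fun i => measurable_count (hA i) (hb i)
  have hN' : Measurable fun γ : Config d => (fun i => count (A i) γ) + Pi.single i₀ 1 :=
    hN.add_const _
  have hf : Measurable f := measurable_of_countable f
  have hf' : Measurable fun n : ι → ℕ => (n i₀ : ℝ≥0∞) * f n := measurable_of_countable _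
  have e1 := lintegral_map (μ := π) hf' hN
  have e2 := lintegral_map (μ := π) hf hN'
  rw [← e1, ← e2, lintegral_countable', lintegral_countable', ← ENNReal.tsum_mul_left]
  refine tsum_congr fun k => ?_
  rw [Measure.map_apply hN (measurableSet_singleton k),
    Measure.map_apply hN' (measurableSet_singleton k)]
  have := hπ.mul_measure_counts_eq hA hb hd i₀ k
  calc (k i₀ : ℝ≥0∞) * f k * π {γ | (fun i => count (A i) γ) = k}
      = f k * ((k i₀ : ℝ≥0∞) * π {γ | (fun i => count (A i) γ) = k}) := by ring
    _ = intensity d z (A i₀) * (f k * π {γ | (fun i => count (A i) γ) + Pi.single i₀ 1 = k}) := by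
      rw [this]; ring

/-- The set of points which lie in `Λ j` exactly for `j ∈ s`, and in at least one of these sets. -/
def atom {ι : Type*} (Λ : ι → Set (E d)) (s : Finset ι) : Set (E d) :=
  (⋃ j, Λ j) ∩ ⋂ j, {x | x ∈ Λ j ↔ j ∈ s}

-- Overlapping sets are reduced to disjoint ones by passing to the atoms they generate. The counts
-- of the `Λ j` are a linear image `L` of the counts of the atoms, and a new point in the atom `s`
-- raises exactly the coordinate `s`. It then remains to sum `lintegral_count_mul` over the atoms
-- contained in `Λ j₀`.
set_option maxHeartbeats 1000000 in
lemma mecke_counts [Nonempty (Fin d)] (hπ : IsPoisson z π) {ι : Type*} [Fintype ι]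
    [DecidableEq ι] {Λ : ι → Set (E d)} (hΛ : ∀ i, MeasurableSet (Λ i))
    (hb : ∀ i, Bornology.IsBounded (Λ i)) (j₀ : ι) (g : (ι → ℕ) → ℝ≥0∞) :
    ∫⁻ γ, (count (Λ j₀) γ : ℝ≥0∞) * g (fun j => count (Λ j) γ) ∂π
      = ∫⁻ γ, ∫⁻ x in Λ j₀, g (fun j => count (Λ j) (γ.add x)) ∂(intensity d z) ∂π := by
  classical
  have hmem : ∀ s x, x ∈ atom Λ s ↔ (∃ j, x ∈ Λ j) ∧ ∀ j, x ∈ Λ j ↔ j ∈ s := by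
    intro s x; simp [atom]
  have hA : ∀ s, MeasurableSet (atom Λ s) := fun s => by
    refine (MeasurableSet.iUnion hΛ).inter (MeasurableSet.iInter fun j => ?_)
    exact (hΛ j).iff (MeasurableSet.const _)
  -- The union in `atom` is essential here: it makes the atom of `s = ∅` empty, instead of the
  -- unbounded complement of all the sets.
  have hAb : ∀ s, Bornology.IsBounded (atom Λ s) := fun s =>
    (Bornology.isBounded_iUnion.2 hb).subset Set.inter_subset_left
  have hd : Pairwise fun s t => Disjoint (atom Λ s) (atom Λ t) := by
    intro s t hst
    refine Set.disjoint_left.2 fun x hs ht => hst ?_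
    ext j
    exact (((hmem s x).1 hs).2 j).symm.trans (((hmem t x).1 ht).2 j)
  have hU : ∀ j, Λ j = ⋃ s ∈ (Finset.univ.filter fun s : Finset ι => j ∈ s), atom Λ s := by
    intro j
    ext x
    simp only [Finset.mem_filter, Finset.mem_univ, true_and, Set.mem_iUnion, exists_prop]
    constructor
    · intro hx
      exact ⟨Finset.univ.filter fun i => x ∈ Λ i, by simpa, (hmem _ _).2 ⟨⟨j, hx⟩, by simp⟩⟩
    · rintro ⟨s, hjs, hx⟩
      exact (((hmem s x).1 hx).2 j).2 hjs
  let L : (Finset ι → ℕ) → ι → ℕ := fun n j => ∑ s ∈ Finset.univ.filter (fun s => j ∈ s), n s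
  have hLdef : ∀ n j, (L n j : ℝ≥0∞) = ∑ s ∈ Finset.univ.filter (fun s => j ∈ s), (n s : ℝ≥0∞) := by
    intro n j; simp [L]
  have hL : ∀ γ, (fun j => count (Λ j) γ) = L fun s => count (atom Λ s) γ := by
    intro γ; ext j
    exact count_eq_sum _ (fun s _ => hA s) (hΛ j) (hb j) (fun s _ t _ h => hd h) (hU j) γ
  have hL' : ∀ γ : Config d, ∀ s, ∀ x ∈ atom Λ s, x ∉ γ.1 → (fun j => count (Λ j) (γ.add x))
      = L ((fun s => count (atom Λ s) γ) + Pi.single s 1) := by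
    intro γ s x hx hxγ
    ext j
    rw [count_add γ hxγ (hΛ j) (hb j), congrFun (hL γ) j]
    simp [L, Finset.sum_add_distrib, Pi.single_apply, ((hmem s x).1 hx).2 j]
  have hNm : ∀ s, Measurable fun γ : Config d => (count (atom Λ s) γ : ℝ≥0∞) := fun s =>
    (measurable_from_top (f := fun n : ℕ => (n : ℝ≥0∞))).comp (measurable_count (hA s) (hAb s))
  have hNm' : ∀ h : (Finset ι → ℕ) → ℝ≥0∞,
      Measurable fun γ : Config d => h fun s => count (atom Λ s) γ := fun h =>
    (measurable_of_countable h).comp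
      (measurable_pi_iff.2 fun s => measurable_count (hA s) (hAb s))
  have hgL : ∀ s, Measurable fun γ : Config d =>
      g (L ((fun s => count (atom Λ s) γ) + Pi.single s 1)) := fun s =>
    hNm' fun n => g (L (n + Pi.single s 1))
  have hgL' : Measurable fun γ : Config d => g (L fun s => count (atom Λ s) γ) :=
    hNm' fun n => g (L n)
  clear_value L
  have lhs : ∀ γ, (count (Λ j₀) γ : ℝ≥0∞) * g (fun j => count (Λ j) γ)
      = ∑ s ∈ Finset.univ.filter (fun s : Finset ι => j₀ ∈ s),
        (count (atom Λ s) γ : ℝ≥0∞) * g (L fun s => count (atom Λ s) γ) := by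
    intro γ
    rw [hL, ← Finset.sum_mul]
    congr 1
    rw [congrFun (hL γ) j₀]
    exact hLdef _ _
  have rhs : ∀ γ, ∫⁻ x in Λ j₀, g (fun j => count (Λ j) (γ.add x)) ∂(intensity d z)
      = ∑ s ∈ Finset.univ.filter (fun s : Finset ι => j₀ ∈ s),
        intensity d z (atom Λ s) * g (L ((fun s => count (atom Λ s) γ) + Pi.single s 1)) := by
    intro γ
    rw [hU j₀, lintegral_biUnion_finset (fun s _ t _ h => hd h) (fun s _ => hA s)]
    refine Finset.sum_congr rfl fun s _ => ?_
    rw [setLIntegral_congr_fun_ae (g := fun _ =>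
      g (L ((fun s => count (atom Λ s) γ) + Pi.single s 1))) (hA s), setLIntegral_const, mul_comm]
    filter_upwards [γ.ae_notMem (intensity d z)] with x hx hxs
    rw [hL' γ s x hxs hx]
  simp only [lhs, rhs]
  rw [lintegral_finsetSum, lintegral_finsetSum]
  · refine Finset.sum_congr rfl fun s _ => ?_
    rw [hπ.lintegral_count_mul hA hAb hd s (fun n => g (L n)), lintegral_const_mul]
    exact hgL s
  · intro s _
    exact (hgL s).const_mul _
  · intro s _
    exact (hNm s).mul hgL'

end IsPoisson

/-- The bounded measurable sets. -/
abbrev BddSet (d : ℕ) : Type := {B : Set (E d) // MeasurableSet B ∧ Bornology.IsBounded B}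

/-- Finite intersections of events on counts form a `π`-system generating the Borel `σ`-algebra,
which is the class on which two measures on configurations will be compared. -/
lemma generateFrom_counts :
    (inferInstance : MeasurableSpace (Config d)) = MeasurableSpace.generateFrom
      (piiUnionInter (fun B : BddSet d =>
        {s | MeasurableSet[MeasurableSpace.comap (count B.1) ⊤] s}) Set.univ) := by
  refine Eq.trans ?_ (generateFrom_piiUnionInter_measurableSet (fun B : BddSet d =>
    MeasurableSpace.comap (count B.1) ⊤) Set.univ).symm
  refine le_antisymm ?_ ?_
  · have h : Measurable[⨆ B ∈ (Set.univ : Set (BddSet d)), MeasurableSpace.comap (count B.1) ⊤]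
        (id : Config d → Config d) := by
      let m : MeasurableSpace (Config d) :=
        ⨆ B ∈ (Set.univ : Set (BddSet d)), MeasurableSpace.comap (count B.1) ⊤
      refine @measurable_of_count d (Config d) m id fun B hB hb => ?_
      have hle : MeasurableSpace.comap (count B) ⊤ ≤ m :=
        le_iSup₂_of_le (f := fun (B : BddSet d) (_ : B ∈ (Set.univ : Set (BddSet d))) =>
          MeasurableSpace.comap (count B.1) ⊤) ⟨B, hB, hb⟩ (Set.mem_univ _) le_rfl
      exact measurable_iff_comap_le.2 hle
    intro s hs
    exact h hs
  · refine iSup₂_le fun B _ => ?_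
    exact measurable_iff_comap_le.1 (measurable_count B.2.1 B.2.2)

namespace IsPoisson

variable {z : ℝ≥0} {π : Measure (Config d)}

/-- For fixed `B` both sides are measures in `s`. On finite intersections of events on counts they
agree by `mecke_counts`, their total mass is finite because `B` is bounded, and so they agree on all
measurable `s`. -/
lemma mecke_rect [Nonempty (Fin d)] (hπ : IsPoisson z π) {B : Set (E d)} (hB : MeasurableSet B)
    (hb : Bornology.IsBounded B) {s : Set (Config d)} (hs : MeasurableSet s) :
    (π ⊗ₘ kap d) (s ×ˢ B)
      = ((π.prod (intensity d z)).map fun p => (p.1.add p.2, p.2)) (s ×ˢ B) := by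
  classical
  have := hπ.isProbabilityMeasure
  have hadd : Measurable fun p : Config d × E d => (p.1.add p.2, p.2) :=
    measurable_add.prodMk measurable_snd
  set M₁ := π ⊗ₘ kap d
  set M₂ := (π.prod (intensity d z)).map fun p => (p.1.add p.2, p.2)
  have e1 : ∀ s, MeasurableSet s → M₁ (s ×ˢ B)
      = ∫⁻ γ, (count B γ : ℝ≥0∞) * s.indicator 1 γ ∂π := by
    intro s hs
    rw [Measure.compProd_apply_prod hs hB, ← lintegral_indicator hs]
    congr 1; ext γ
    by_cases h : γ ∈ s <;> simp [h, kap_apply, toMeasure_eq_count _ hB hb]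
  have e2 : ∀ s, MeasurableSet s → M₂ (s ×ˢ B)
      = ∫⁻ γ, ∫⁻ x in B, s.indicator 1 (γ.add x) ∂(intensity d z) ∂π := by
    intro s hs
    rw [Measure.map_apply hadd (hs.prod hB), Measure.prod_apply (hadd (hs.prod hB))]
    congr 1; ext γ
    have hm : Measurable fun x => γ.add x := measurable_add.comp measurable_prodMk_left
    have : (fun x => s.indicator (1 : Config d → ℝ≥0∞) (γ.add x))
        = ((fun x => γ.add x) ⁻¹' s).indicator 1 := by
      ext x; simp [Set.indicator]
    rw [this, lintegral_indicator_one (hm hs), Measure.restrict_apply (hm hs)]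
    rfl
  have hfst : ∀ (M : Measure (Config d × E d)) (s), MeasurableSet s →
      (M.restrict (Set.univ ×ˢ B)).map Prod.fst s = M (s ×ˢ B) := by
    intro M s hs
    rw [Measure.map_apply measurable_fst hs, Measure.restrict_apply (measurable_fst hs)]
    congr 1; ext p; simp
  have hC : ∀ s ∈ piiUnionInter (fun B : BddSet d =>
        {s | MeasurableSet[MeasurableSpace.comap (count B.1) ⊤] s}) Set.univ,
      M₁ (s ×ˢ B) = M₂ (s ×ˢ B) := by
    intro s hs
    have hsm : MeasurableSet s := by
      have := MeasurableSpace.measurableSet_generateFrom hs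
      rwa [← generateFrom_counts] at this
    obtain ⟨t, -, f, hf, rfl⟩ := hs
    choose! S hS using fun Λ hΛ => (hf Λ hΛ)
    -- The index `none` carries the set `B` whose points are counted as weight; the indices `some i`
    -- carry the sets that define the event `s`.
    let Λ : Option t → Set (E d) := fun o => o.elim B fun i => i.1.1
    have key := hπ.mecke_counts (Λ := Λ)
      (fun i => by cases i with | none => exact hB | some i => exact i.1.2.1)
      (fun i => by cases i with | none => exact hb | some i => exact i.1.2.2) none
      (fun n => if ∀ i : t, n (some i) ∈ S i.1 then 1 else 0)
    have hind : ∀ γ : Config d, (⋂ x ∈ t, f x).indicator (1 : Config d → ℝ≥0∞) γ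
        = if ∀ i : t, count (Λ (some i)) γ ∈ S i.1 then 1 else 0 := by
      intro γ
      have : γ ∈ (⋂ x ∈ t, f x) ↔ ∀ i : t, count (Λ (some i)) γ ∈ S i.1 := by
        have hx' : ∀ x ∈ t, γ ∈ f x ↔ count x.1 γ ∈ S x := fun x hx => by
          rw [← (hS x hx).2]; rfl
        rw [Set.mem_iInter₂]
        exact ⟨fun h i => (hx' i.1 i.2).1 (h _ i.2), fun h x hx => (hx' x hx).2 (h ⟨x, hx⟩)⟩
      simp only [Set.indicator, this, Pi.one_apply]
    rw [e1 _ hsm, e2 _ hsm]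
    simp only [hind]
    exact key
  have huniv : M₁ (Set.univ ×ˢ B) = M₂ (Set.univ ×ˢ B) := by
    refine hC _ ⟨∅, by simp, fun _ => Set.univ, by simp, by simp⟩
  have hfin : M₂ (Set.univ ×ˢ B) < ∞ := by
    rw [e2 _ MeasurableSet.univ]
    simp [intensity_lt_top z hb]
  -- Finiteness is evident for the product measure behind `M₂`; it passes to `M₁` because the total
  -- masses over `B` agree.
  have : IsFiniteMeasure ((M₁.restrict (Set.univ ×ˢ B)).map Prod.fst) :=
    ⟨by rw [hfst _ _ MeasurableSet.univ, huniv]; exact hfin⟩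
  have heq : (M₁.restrict (Set.univ ×ˢ B)).map Prod.fst
      = (M₂.restrict (Set.univ ×ˢ B)).map Prod.fst := by
    refine ext_of_generate_finite _ generateFrom_counts
      (isPiSystem_piiUnionInter _ (fun B => ?_) _) (fun s hs => ?_) ?_
    · exact @MeasurableSpace.isPiSystem_measurableSet _ (MeasurableSpace.comap (count B.1) ⊤)
    · have hsm : MeasurableSet s := by
        have := MeasurableSpace.measurableSet_generateFrom hs
        rwa [← generateFrom_counts] at this
      rw [hfst _ _ hsm, hfst _ _ hsm, hC s hs]
    · rw [hfst _ _ MeasurableSet.univ, hfst _ _ MeasurableSet.univ, huniv]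
  rw [← hfst _ _ hs, ← hfst _ _ hs, heq]

/-- The Mecke identity is an equality of two measures on pairs (configuration, point). Restricted to
points in a ball both are finite and agree on rectangles; the balls exhaust the space. -/
theorem isMecke [Nonempty (Fin d)] (hπ : IsPoisson z π) : IsMecke π (intensity d z) := by
  have := hπ.isProbabilityMeasure
  have hadd : Measurable fun p : Config d × E d => (p.1.add p.2, p.2) :=
    measurable_add.prodMk measurable_snd
  have heq : π ⊗ₘ kap d = (π.prod (intensity d z)).map fun p => (p.1.add p.2, p.2) := by
    have hball : ∀ n : ℕ, (π ⊗ₘ kap d).restrict (Set.univ ×ˢ Metric.closedBall 0 n)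
        = ((π.prod (intensity d z)).map fun p => (p.1.add p.2, p.2)).restrict
          (Set.univ ×ˢ Metric.closedBall 0 n) := by
      intro n
      have hr : ∀ (M : Measure (Config d × E d)) (s t), MeasurableSet s → MeasurableSet t →
          M.restrict (Set.univ ×ˢ Metric.closedBall 0 n) (s ×ˢ t)
            = M (s ×ˢ (t ∩ Metric.closedBall 0 n)) := by
        intro M s t hs ht
        rw [Measure.restrict_apply (hs.prod ht), Set.prod_inter_prod, Set.inter_univ]
      have hb : ∀ t : Set (E d), Bornology.IsBounded (t ∩ Metric.closedBall 0 n) := fun t =>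
        Metric.isBounded_closedBall.subset Set.inter_subset_right
      have : IsFiniteMeasure ((π ⊗ₘ kap d).restrict (Set.univ ×ˢ Metric.closedBall 0 n)) := by
        refine ⟨?_⟩
        rw [Measure.restrict_apply_univ, hπ.mecke_rect measurableSet_closedBall
          Metric.isBounded_closedBall MeasurableSet.univ, Measure.map_apply hadd
          (MeasurableSet.univ.prod measurableSet_closedBall)]
        have : (fun p : Config d × E d => (p.1.add p.2, p.2)) ⁻¹'
            (Set.univ ×ˢ Metric.closedBall 0 n) = Set.univ ×ˢ Metric.closedBall 0 n := by
          ext p; simp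
        rw [this, Measure.prod_prod]
        simp [intensity_lt_top z Metric.isBounded_closedBall]
      refine Measure.ext_prod fun {s t} hs ht => ?_
      rw [hr _ _ _ hs ht, hr _ _ _ hs ht]
      exact hπ.mecke_rect (ht.inter measurableSet_closedBall) (hb t) hs
    have h := Measure.restrict_iUnion_congr.2 hball
    rwa [← Set.prod_iUnion, Metric.iUnion_closedBall_nat, Set.univ_prod_univ,
      Measure.restrict_univ, Measure.restrict_univ] at h
  intro f hf
  have h1 := Measure.lintegral_compProd (μ := π) (κ := kap d) hf
  rw [heq, lintegral_map hf hadd, lintegral_prod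
    (fun p : Config d × E d => Function.uncurry f (p.1.add p.2, p.2)) (hf.comp hadd).aemeasurable] at h1
  exact h1.symm

end IsPoisson

end
end BinaryJumps

namespace BinaryJumps

noncomputable section

variable {d : ℕ}

open Config

/-! ### Exponential tilting -/

/-- The exponential weight `e^{c⟨φ, γ⟩}`. -/
def expWeight (c : ℝ) (φ : E d → ℝ) (γ : Config d) : ℝ≥0∞ :=
  ENNReal.ofReal (Real.exp (c * pair φ γ))

lemma measurable_expWeight (c : ℝ) {φ : E d → ℝ} (hφ : Continuous φ) (hs : HasCompactSupport φ) :
    Measurable (expWeight c φ) :=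
  (Real.measurable_exp.comp ((measurable_pair hφ hs).const_mul c)).ennreal_ofReal

/-- For `x ∉ γ`, hence for `ρ`-almost every `x`, the weight factorises as `e^{c⟨φ,γ∪{x}⟩} =
e^{c⟨φ,γ⟩} e^{cφ(x)}`. The second factor is absorbed into the intensity. -/
lemma IsMecke.tilt {P : Measure (Config d)} {ρ : Measure (E d)} [NullSingletonClass ρ]
    [SFinite ρ] (h : IsMecke P ρ) (c : ℝ) {φ : E d → ℝ} (hφ : Continuous φ)
    (hs : HasCompactSupport φ) :
    IsMecke (P.withDensity (expWeight c φ))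
      (ρ.withDensity fun x => ENNReal.ofReal (Real.exp (c * φ x))) := by
  intro f hf
  have hw := measurable_expWeight c hφ hs
  have hexp : Measurable fun x => ENNReal.ofReal (Real.exp (c * φ x)) := by
    have := hφ.measurable
    fun_prop
  have hf' : Measurable fun p : Config d × E d => f (p.1.add p.2) p.2 :=
    hf.comp (measurable_add.prodMk measurable_snd)
  rw [lintegral_withDensity_eq_lintegral_mul _ hw 
    (measurable_lintegral_toMeasure (T := fun γ => γ) measurable_id hf)]
  have e1 : ∀ γ : Config d, ∫⁻ x, f (γ.add x) x ∂(ρ.withDensity fun x =>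
      ENNReal.ofReal (Real.exp (c * φ x)))
      = ∫⁻ x, ENNReal.ofReal (Real.exp (c * φ x)) * f (γ.add x) x ∂ρ := fun γ =>
    lintegral_withDensity_eq_lintegral_mul _ hexp (hf'.comp measurable_prodMk_left)
  simp only [e1]
  rw [lintegral_withDensity_eq_lintegral_mul _ hw
    (Measurable.lintegral_prod_right' (f := fun p : Config d × E d =>
      ENNReal.ofReal (Real.exp (c * φ p.2)) * f (p.1.add p.2) p.2)
      ((hexp.comp measurable_snd).mul hf'))]
  have e2 := h (fun γ x => expWeight c φ γ * f γ x) ((hw.comp measurable_fst).mul hf)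
  calc _ = ∫⁻ γ, ∫⁻ x, expWeight c φ γ * f γ x ∂γ.toMeasure ∂P := by
        congr 1; ext γ
        have hfγ : Measurable fun x => f γ x := hf.comp measurable_prodMk_left
        rw [lintegral_const_mul _ hfγ]; rfl
    _ = _ := e2
    _ = _ := by
        congr 1; ext γ
        have hfγ : Measurable fun x => f (γ.add x) x := hf'.comp measurable_prodMk_left
        have hm : Measurable fun x => ENNReal.ofReal (Real.exp (c * φ x)) * f (γ.add x) x :=
          hexp.mul hfγ
        rw [Pi.mul_apply, ← lintegral_const_mul _ hm]
        refine lintegral_congr_ae ?_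
        filter_upwards [γ.ae_notMem ρ] with x hx
        rw [← mul_assoc]
        congr 1
        rw [expWeight, expWeight, pair_add _ hs hx, mul_add, Real.exp_add,
          ENNReal.ofReal_mul (Real.exp_pos _).le]

/-- The exponential moment of a Poisson variable with parameter `r` is `e^{-r} ∑ (e^c r)ⁿ/n!`, a
convergent series. -/
lemma lintegral_exp_count_lt_top {z : ℝ≥0} {π : Measure (Config d)} (hπ : IsPoisson z π)
    {Λ : Set (E d)} (hΛ : MeasurableSet Λ) (hb : Bornology.IsBounded Λ) (c : ℝ) :
    ∫⁻ γ, ENNReal.ofReal (Real.exp (c * count Λ γ)) ∂π < ∞ := by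
  have hm := measurable_count hΛ hb
  have e := lintegral_map (μ := π) (f := fun n : ℕ => ENNReal.ofReal (Real.exp (c * n)))
    (measurable_of_countable _) hm
  rw [← e, (hπ.hasLaw_count Λ hΛ hb).map_eq, lintegral_countable']
  set r := (intensity d z Λ).toNNReal
  have : ∀ n : ℕ, ENNReal.ofReal (Real.exp (c * n)) * poissonMeasure r {n}
      = ENNReal.ofReal (Real.exp (-r) * ((Real.exp c * r) ^ n / n.factorial)) := by
    intro n
    rw [poissonMeasure_singleton, ← ENNReal.ofReal_mul (Real.exp_pos _).le]
    congr 1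
    rw [mul_pow, ← Real.exp_nat_mul, mul_comm c]
    ring
  simp only [this]
  rw [lt_top_iff_ne_top]
  exact ((Real.summable_pow_div_factorial _).mul_left _).tsum_ofReal_ne_top

lemma lintegral_expWeight_lt_top {z : ℝ≥0} {π : Measure (Config d)} (hπ : IsPoisson z π)
    (c : ℝ) {φ : E d → ℝ} (hφ : Continuous φ) (hs : HasCompactSupport φ) :
    ∫⁻ γ, expWeight c φ γ ∂π < ∞ := by
  obtain ⟨M, hM⟩ := hs.exists_bound_of_continuous hφ
  have hM0 : 0 ≤ M := (norm_nonneg _).trans (hM 0)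
  have hb := hs.isCompact.isBounded
  have hm : MeasurableSet (tsupport φ) := (isClosed_tsupport φ).measurableSet
  refine lt_of_le_of_lt (lintegral_mono fun γ => ?_)
    (lintegral_exp_count_lt_top hπ hm hb (|c| * M))
  refine ENNReal.ofReal_le_ofReal (Real.exp_le_exp.2 ?_)
  have key : |pair φ γ| ≤ M * count (tsupport φ) γ := by
    have hle : ∀ f : E d → ℝ, (∀ x, f x ≤ M) → Function.support f ⊆ tsupport φ →
        (∫⁻ x, ENNReal.ofReal (f x) ∂γ.toMeasure).toReal ≤ M * count (tsupport φ) γ := by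
      intro f hfM hfs
      have h1 : ∫⁻ x, ENNReal.ofReal (f x) ∂γ.toMeasure
          ≤ ENNReal.ofReal M * γ.toMeasure (tsupport φ) := by
        rw [← lintegral_indicator_const hm]
        refine lintegral_mono fun x => ?_
        by_cases hx : x ∈ tsupport φ
        · rw [Set.indicator_of_mem hx]; exact ENNReal.ofReal_le_ofReal (hfM x)
        · have : f x = 0 := by by_contra h; exact hx (hfs h)
          simp [this]
      rw [toMeasure_eq_count _ hm hb] at h1
      have h2 := ENNReal.toReal_mono (ENNReal.mul_ne_top ENNReal.ofReal_ne_top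
        (ENNReal.natCast_ne_top _)) h1
      rwa [ENNReal.toReal_mul, ENNReal.toReal_ofReal hM0, ENNReal.toReal_natCast] at h2
    have h1 := hle φ (fun x => (le_abs_self _).trans (hM x)) (subset_tsupport φ)
    have h2 := hle (fun x => -φ x) (fun x => (neg_le_abs _).trans (hM x))
      (by intro x hx; exact subset_tsupport φ (by simpa using hx))
    rw [pair_eq_toReal_sub _ hs, abs_le]
    constructor <;> linarith [ENNReal.toReal_nonneg (a := ∫⁻ x, ENNReal.ofReal (φ x) ∂γ.toMeasure),
      ENNReal.toReal_nonneg (a := ∫⁻ x, ENNReal.ofReal (-φ x) ∂γ.toMeasure)]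
  calc c * pair φ γ ≤ |c| * |pair φ γ| := by rw [← abs_mul]; exact le_abs_self _
    _ ≤ |c| * (M * count (tsupport φ) γ) := by gcongr
    _ = _ := by ring

/-! ### Sums over pairs -/

/-- `K` set to zero on the diagonal. -/
def offDiag (K : E d → E d → ℝ≥0∞) (x y : E d) : ℝ≥0∞ :=
  open Classical in if x = y then 0 else K x y

lemma offDiag_le (K : E d → E d → ℝ≥0∞) (x y : E d) : offDiag K x y ≤ K x y := by
  unfold offDiag; split_ifs <;> simp

lemma offDiag_self (K : E d → E d → ℝ≥0∞) (x : E d) : offDiag K x x = 0 := by simp [offDiag]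

lemma offDiag_of_ne (K : E d → E d → ℝ≥0∞) {x y : E d} (h : x ≠ y) : offDiag K x y = K x y := by
  simp [offDiag, h]

lemma measurable_offDiag {Ω : Type*} [MeasurableSpace Ω] {G : Ω → E d → E d → ℝ≥0∞}
    (hG : Measurable fun p : Ω × E d × E d => G p.1 p.2.1 p.2.2) :
    Measurable fun p : Ω × E d × E d => offDiag (G p.1) p.2.1 p.2.2 := by
  unfold offDiag
  refine Measurable.ite ?_ measurable_const hG
  exact measurableSet_eq_fun (by fun_prop) (by fun_prop)

lemma ae_offDiag (ρ : Measure (E d)) [NullSingletonClass ρ] (K : E d → E d → ℝ≥0∞) (x : E d) :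
    ∀ᵐ y ∂ρ, offDiag K x y = K x y := by
  have : ∀ᵐ y ∂ρ, y ∉ ({x} : Set (E d)) := (Set.countable_singleton x).ae_notMem ρ
  filter_upwards [this] with y hy
  exact offDiag_of_ne K (fun h => hy h.symm)

/-- `∑_{x ≠ y ∈ γ} K(x, y)` over the ordered pairs. -/
def S2 (K : E d → E d → ℝ≥0∞) (γ : Config d) : ℝ≥0∞ := ∑' p : γ.orderedPairs, K p.1.1 p.1.2

lemma tsum_orderedPairs_eq {α : Type*} [AddCommMonoid α] [TopologicalSpace α] (γ : Config d)
    (f : E d → E d → α) :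
    ∑' p : γ.orderedPairs, f p.1.1 p.1.2
      = ∑' q : γ.1 × γ.1, open Classical in if q.1.1 = q.2.1 then 0 else f q.1 q.2 := by
  classical
  let i : γ.orderedPairs → γ.1 × γ.1 := fun p => (⟨p.1.1, p.2.1⟩, ⟨p.1.2, p.2.2.1⟩)
  have hi : Function.Injective i := by
    intro p q h
    simp only [i, Prod.mk.injEq, Subtype.mk.injEq] at h
    exact Subtype.ext (Prod.ext h.1 h.2)
  rw [← hi.tsum_eq]
  · refine tsum_congr fun p => ?_
    rw [if_neg p.2.2.2]
  · rintro ⟨x, y⟩ hxy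
    have h : (x : E d) ≠ y := by
      intro h; simp [h] at hxy
    exact ⟨⟨(x, y), x.2, y.2, h⟩, rfl⟩

lemma S2_eq_lintegral (K : E d → E d → ℝ≥0∞) (γ : Config d) :
    S2 K γ = ∫⁻ x, ∫⁻ y, offDiag K x y ∂γ.toMeasure ∂γ.toMeasure := by
  rw [S2, tsum_orderedPairs_eq, ENNReal.tsum_prod', lintegral_toMeasure]
  refine tsum_congr fun x => ?_
  rw [lintegral_toMeasure]
  rfl

lemma measurable_tsum_orderedPairs {Ω : Type*} [MeasurableSpace Ω] {T : Ω → Config d}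
    (hT : Measurable T) {G : Ω → E d → E d → ℝ≥0∞}
    (hG : Measurable fun p : Ω × E d × E d => G p.1 p.2.1 p.2.2) :
    Measurable fun ω => S2 (G ω) (T ω) := by
  simp only [S2_eq_lintegral]
  refine measurable_lintegral_toMeasure hT ?_
  refine measurable_lintegral_toMeasure (Ω := Ω × E d) (hT.comp measurable_fst)
    (f := fun q y => offDiag (G q.1) q.2 y) ?_
  exact (measurable_offDiag hG).comp (f := fun p : (Ω × E d) × E d => (p.1.1, p.1.2, p.2))
    (by fun_prop)

lemma measurable_S2 {K : E d → E d → ℝ≥0∞} (hK : Measurable (Function.uncurry K)) :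
    Measurable (S2 K) :=
  measurable_tsum_orderedPairs measurable_id (G := fun _ => K) (hK.comp measurable_snd)

/-- `∑_{x ∈ γ} g(x)`. -/
def S1 (g : E d → ℝ≥0∞) (γ : Config d) : ℝ≥0∞ := ∫⁻ x, g x ∂γ.toMeasure

lemma measurable_S1 {g : E d → ℝ≥0∞} (hg : Measurable g) : Measurable (S1 g) :=
  measurable_lintegral_toMeasure measurable_id (hg.comp measurable_snd)

lemma lintegral_add_le (γ : Config d) (x : E d) {g : E d → ℝ≥0∞} (hg : Measurable g) :
    ∫⁻ y, g y ∂(γ.add x).toMeasure ≤ ∫⁻ y, g y ∂γ.toMeasure + g x := by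
  refine (lintegral_mono' (toMeasure_add_le γ x) le_rfl).trans ?_
  rw [lintegral_add_measure, lintegral_dirac' _ hg]

lemma S1_add_le (γ : Config d) (x : E d) {g : E d → ℝ≥0∞} (hg : Measurable g) :
    S1 g (γ.add x) ≤ S1 g γ + g x := lintegral_add_le γ x hg

/-- A new point only contributes its pairs with the old points, in both orders. An inequality
suffices and spares the distinction whether `x` already belongs to `γ`. -/
lemma S2_add_le (γ : Config d) (x : E d) {K : E d → E d → ℝ≥0∞}
    (hK : Measurable (Function.uncurry K)) :
    S2 K (γ.add x) ≤ S2 K γ + S1 (fun y => K x y + K y x) γ := by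
  have hO : Measurable (Function.uncurry (offDiag K)) :=
    (measurable_offDiag (Ω := Unit) (G := fun _ => K) (hK.comp measurable_snd)).comp
      (f := fun p : E d × E d => ((), p)) (by fun_prop)
  have hI : ∀ γ : Config d, Measurable fun x => ∫⁻ y, offDiag K x y ∂γ.toMeasure := fun γ =>
    measurable_lintegral_toMeasure measurable_const hO
  have hKx : Measurable fun y => K x y := hK.comp measurable_prodMk_left
  have hxK : Measurable fun y => K y x := hK.comp measurable_prodMk_right
  have hOx : Measurable fun y => offDiag K x y := hO.comp measurable_prodMk_left
  have hxO : Measurable fun y => offDiag K y x := hO.comp measurable_prodMk_right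
  rw [S2_eq_lintegral, S2_eq_lintegral, S1, lintegral_add_left hKx]
  refine (lintegral_add_le γ x (hI _)).trans ?_
  have h1 : ∫⁻ y, ∫⁻ y', offDiag K y y' ∂(γ.add x).toMeasure ∂γ.toMeasure
      ≤ ∫⁻ y, ∫⁻ y', offDiag K y y' ∂γ.toMeasure ∂γ.toMeasure + ∫⁻ y, K y x ∂γ.toMeasure := by
    rw [← lintegral_add_right _ hxK]
    refine lintegral_mono fun y => ?_
    exact (lintegral_add_le γ x (g := fun y' => offDiag K y y')
      (hO.comp measurable_prodMk_left)).trans (by gcongr; exact offDiag_le K y x)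
  have h2 : ∫⁻ y, offDiag K x y ∂(γ.add x).toMeasure ≤ ∫⁻ y, K x y ∂γ.toMeasure := by
    refine (lintegral_add_le γ x hOx).trans ?_
    rw [offDiag_self, add_zero]
    exact lintegral_mono fun y => offDiag_le K x y
  calc _ ≤ _ := add_le_add h1 h2
    _ = _ := by ring

lemma add_comm' (γ : Config d) (x y : E d) : (γ.add x).add y = (γ.add y).add x :=
  Subtype.ext (Set.insert_comm _ _ _)

/-! ### First and second moments from the Mecke identity -/

section Moments

variable {P : Measure (Config d)} {ρ : Measure (E d)}

lemma IsMecke.lintegral_S1 (h : IsMecke P ρ) {g : E d → ℝ≥0∞} (hg : Measurable g) :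
    ∫⁻ γ, S1 g γ ∂P = P Set.univ * ∫⁻ x, g x ∂ρ := by
  have := h (fun _ x => g x) (hg.comp measurable_snd)
  rw [lintegral_const, mul_comm] at this
  exact this

/-- The Mecke identity is used once for each point of the pair. Between the two uses the inner sum
runs over `γ ∪ {x}`, but the point `x` itself contributes only on the diagonal, where `offDiag`
vanishes. -/
lemma IsMecke.lintegral_pairs [SFinite P] [SFinite ρ] [NullSingletonClass ρ] (h : IsMecke P ρ)
    {G : Config d → E d → E d → ℝ≥0∞}
    (hG : Measurable fun p : Config d × E d × E d => G p.1 p.2.1 p.2.2) :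
    ∫⁻ γ, S2 (G γ) γ ∂P = ∫⁻ x, ∫⁻ y, ∫⁻ γ, G ((γ.add x).add y) x y ∂P ∂ρ ∂ρ := by
  have hO := measurable_offDiag hG
  simp only [S2_eq_lintegral]
  have hI : Measurable fun p : Config d × E d => ∫⁻ y, offDiag (G p.1) p.2 y ∂p.1.toMeasure := by
    refine measurable_lintegral_toMeasure (Ω := Config d × E d) measurable_fst
      (f := fun q y => offDiag (G q.1) q.2 y) ?_
    exact hO.comp (f := fun p : (Config d × E d) × E d => (p.1.1, p.1.2, p.2)) (by fun_prop)
  have hO2 : Measurable fun p : (Config d × E d) × E d =>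
      offDiag (G (p.1.1.add p.1.2)) p.1.2 p.2 :=
    hO.comp (f := fun p : (Config d × E d) × E d => (p.1.1.add p.1.2, p.1.2, p.2))
      ((measurable_add.comp measurable_fst).prodMk (by fun_prop))
  have hO3 : Measurable fun p : (E d × Config d) × E d =>
      offDiag (G ((p.1.2.add p.1.1).add p.2)) p.1.1 p.2 := by
    refine hO.comp (f := fun p : (E d × Config d) × E d =>
      ((p.1.2.add p.1.1).add p.2, p.1.1, p.2)) (Measurable.prodMk ?_ (by fun_prop))
    exact measurable_add.comp (Measurable.prodMk
      (measurable_add.comp (f := fun p : (E d × Config d) × E d => (p.1.2, p.1.1)) (by fun_prop))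
      measurable_snd)
  rw [h (fun γ x => ∫⁻ y, offDiag (G γ) x y ∂γ.toMeasure) hI]
  have e1 : ∀ γ : Config d, ∫⁻ x, ∫⁻ y, offDiag (G (γ.add x)) x y ∂(γ.add x).toMeasure ∂ρ
      = ∫⁻ x, ∫⁻ y, offDiag (G (γ.add x)) x y ∂γ.toMeasure ∂ρ := by
    intro γ
    refine lintegral_congr_ae ?_
    filter_upwards [γ.ae_notMem ρ] with x hx
    rw [toMeasure_add _ hx, lintegral_add_measure, lintegral_dirac', offDiag_self, add_zero]
    exact hO.comp (f := fun y : E d => (γ.add x, x, y)) (by fun_prop)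
  simp only [e1]
  rw [lintegral_lintegral_swap (measurable_lintegral_toMeasure (Ω := Config d × E d)
    measurable_fst (f := fun q y => offDiag (G (q.1.add q.2)) q.2 y) hO2).aemeasurable]
  congr 1; ext x
  rw [h (fun γ y => offDiag (G (γ.add x)) x y)
    (hO2.comp (f := fun p : Config d × E d => ((p.1, x), p.2)) (by fun_prop)),
    lintegral_lintegral_swap]
  · refine lintegral_congr_ae ?_
    filter_upwards [(Set.countable_singleton x).ae_notMem ρ] with y hy
    congr 1; ext γ
    rw [offDiag_of_ne _ (fun h => hy h.symm), add_comm']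
  · refine (hO3.comp (f := fun p : Config d × E d => ((x, p.1), p.2)) (by fun_prop)).aemeasurable.congr
      (ae_of_all _ fun p => ?_)
    simp only [Function.comp_apply, Function.uncurry]
    rw [add_comm']

lemma IsMecke.lintegral_S2 [SFinite P] [SFinite ρ] [NullSingletonClass ρ] (h : IsMecke P ρ)
    {K : E d → E d → ℝ≥0∞} (hK : Measurable (Function.uncurry K)) :
    ∫⁻ γ, S2 K γ ∂P = P Set.univ * ∫⁻ x, ∫⁻ y, K x y ∂ρ ∂ρ := by
  rw [h.lintegral_pairs (G := fun _ => K) (hK.comp measurable_snd)]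
  have hKx : ∀ x, Measurable fun y => K x y := fun x => hK.comp measurable_prodMk_left
  simp only [lintegral_const]
  rw [← lintegral_const_mul _ (Measurable.lintegral_prod_right hK)]
  congr 1; ext x
  rw [lintegral_mul_const _ (hKx x), mul_comm]

/-- One factor of the square is expanded as a sum over `x ∈ γ`. The Mecke identity replaces the
other factor by its value at `γ ∪ {x}`, which exceeds the value at `γ` by at most `g x`; this excess
is the variance. -/
lemma IsMecke.lintegral_S1_sq_le [SFinite P] [SFinite ρ] (h : IsMecke P ρ) {g : E d → ℝ≥0∞}
    (hg : Measurable g) :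
    ∫⁻ γ, S1 g γ ^ 2 ∂P ≤ P Set.univ * ((∫⁻ x, g x ∂ρ) ^ 2 + ∫⁻ x, g x ^ 2 ∂ρ) := by
  have hS := measurable_S1 hg
  have e : ∀ γ, S1 g γ ^ 2 = ∫⁻ x, g x * S1 g γ ∂γ.toMeasure := by
    intro γ
    rw [lintegral_mul_const _ hg, sq]; rfl
  simp only [e]
  rw [h (fun γ x => g x * S1 g γ) ((hg.comp measurable_snd).mul (hS.comp measurable_fst))]
  calc ∫⁻ γ, ∫⁻ x, g x * S1 g (γ.add x) ∂ρ ∂P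
      ≤ ∫⁻ γ, ∫⁻ x, (g x * S1 g γ + g x ^ 2) ∂ρ ∂P := by
        refine lintegral_mono fun γ => lintegral_mono fun x => ?_
        calc g x * S1 g (γ.add x) ≤ g x * (S1 g γ + g x) := by gcongr; exact S1_add_le γ x hg
          _ = _ := by ring
    _ = ∫⁻ γ, ((∫⁻ x, g x ∂ρ) * S1 g γ + ∫⁻ x, g x ^ 2 ∂ρ) ∂P := by
        congr 1; ext γ
        rw [lintegral_add_left (hg.mul_const _), lintegral_mul_const _ hg]
    _ = _ := by
        rw [lintegral_add_left (hS.const_mul _), lintegral_const_mul _ hS, h.lintegral_S1 hg,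
          lintegral_const]
        ring

/-- One factor is expanded over pairs, and the other is evaluated after adding `x` and `y`. The
additional pairs are `x` or `y` with an old point, with mean at most `R` each, and the pair `{x, y}`
itself, at most `S`. Beyond the square of the mean this leaves `T(2R + S)`, which is small once rows
and supremum are small, even when the total `T` is not. -/
lemma IsMecke.lintegral_S2_sq_le [SFinite P] [SFinite ρ] [NullSingletonClass ρ] (h : IsMecke P ρ)
    {K : E d → E d → ℝ≥0∞} (hK : Measurable (Function.uncurry K)) {R S : ℝ≥0∞}
    (hR : ∀ x, ∫⁻ y, (K x y + K y x) ∂ρ ≤ R) (hS : ∀ x y, K x y + K y x ≤ S) :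
    ∫⁻ γ, S2 K γ ^ 2 ∂P ≤ P Set.univ * ((∫⁻ x, ∫⁻ y, K x y ∂ρ ∂ρ) ^ 2
      + (∫⁻ x, ∫⁻ y, K x y ∂ρ ∂ρ) * (2 * R + S)) := by
  set T := ∫⁻ x, ∫⁻ y, K x y ∂ρ ∂ρ with hT
  have hS2 := measurable_S2 hK
  have hsym : ∀ x, Measurable fun y => K x y + K y x := fun x =>
    (hK.comp measurable_prodMk_left).add (hK.comp measurable_prodMk_right)
  have e : ∀ γ, S2 K γ ^ 2 = S2 (fun x y => K x y * S2 K γ) γ := by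
    intro γ
    rw [sq]
    conv_rhs => rw [S2, ENNReal.tsum_mul_right]
    rfl
  simp only [e]
  rw [h.lintegral_pairs (G := fun γ x y => K x y * S2 K γ)
    ((hK.comp measurable_snd).mul (hS2.comp measurable_fst))]
  have hin : ∀ x y, ∫⁻ γ, K x y * S2 K ((γ.add x).add y) ∂P
      ≤ K x y * (P Set.univ * (T + 2 * R + S)) := by
    intro x y
    have hSxy : Measurable fun γ : Config d => S2 K ((γ.add x).add y) :=
      hS2.comp (Config.measurable_add.comp (f := fun γ : Config d => (γ.add x, y))
        ((Config.measurable_add.comp (f := fun γ : Config d => (γ, x)) (by fun_prop)).prodMk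
          measurable_const))
    rw [lintegral_const_mul _ hSxy]
    gcongr
    calc ∫⁻ γ, S2 K ((γ.add x).add y) ∂P
        ≤ ∫⁻ γ, (S2 K γ + S1 (fun y => K x y + K y x) γ
            + (S1 (fun x => K y x + K x y) γ + S)) ∂P := by
          refine lintegral_mono fun γ => (S2_add_le _ y hK).trans ?_
          refine add_le_add (S2_add_le _ x hK) ((S1_add_le _ x (hsym y)).trans ?_)
          gcongr
          exact hS y x
      _ = P Set.univ * T + P Set.univ * ∫⁻ y, (K x y + K y x) ∂ρ
            + (P Set.univ * ∫⁻ x, (K y x + K x y) ∂ρ + S * P Set.univ) := by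
          have hm : Measurable fun γ => S2 K γ + S1 (fun y => K x y + K y x) γ :=
            hS2.add (measurable_S1 (hsym x))
          rw [lintegral_add_left hm, lintegral_add_left hS2,
            lintegral_add_left (measurable_S1 (hsym y)), h.lintegral_S2 hK,
            h.lintegral_S1 (hsym x), h.lintegral_S1 (hsym y), lintegral_const]
      _ ≤ P Set.univ * T + P Set.univ * R + (P Set.univ * R + S * P Set.univ) := by
          gcongr
          · exact hR x
          · exact hR y
      _ = _ := by ring
  calc _ ≤ ∫⁻ x, ∫⁻ y, K x y * (P Set.univ * (T + 2 * R + S)) ∂ρ ∂ρ :=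
        lintegral_mono fun x => lintegral_mono fun y => hin x y
    _ = T * (P Set.univ * (T + 2 * R + S)) := by
        rw [hT, ← lintegral_mul_const _ (Measurable.lintegral_prod_right hK)]
        congr 1; ext x
        have hKx : Measurable fun y => K x y := hK.comp measurable_prodMk_left
        rw [lintegral_mul_const _ hKx]
    _ = _ := by ring

/-- Variance from two moments. The measure need not have mass one, hence the factors `P Set.univ`.
The identity `(Y - T)² + 2TY = Y² + T²` is arranged so that nothing is subtracted in `ℝ≥0∞` until a
finite term is cancelled. -/
lemma lintegral_sub_sq_le_of_moments [IsFiniteMeasure P] {Y : Config d → ℝ≥0∞} (hY : Measurable Y)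
    {T D : ℝ≥0∞} (hT : T ≠ ∞) (h1 : ∫⁻ γ, Y γ ∂P = P Set.univ * T)
    (h2 : ∫⁻ γ, Y γ ^ 2 ∂P ≤ P Set.univ * (T ^ 2 + D)) :
    ∫⁻ γ, ENNReal.ofReal (((Y γ).toReal - T.toReal) ^ 2) ∂P ≤ P Set.univ * D := by
  have hfin : ∀ᵐ γ ∂P, Y γ < ∞ := by
    refine ae_lt_top hY ?_
    rw [h1]
    exact ENNReal.mul_ne_top (measure_ne_top P _) hT
  have hpt : ∀ᵐ γ ∂P, ENNReal.ofReal (((Y γ).toReal - T.toReal) ^ 2) + 2 * T * Y γ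
      = Y γ ^ 2 + T ^ 2 := by
    filter_upwards [hfin] with γ hγ
    obtain ⟨y, hy⟩ : ∃ y : ℝ≥0, (y : ℝ≥0∞) = Y γ := ⟨_, ENNReal.coe_toNNReal hγ.ne⟩
    lift T to ℝ≥0 using hT
    rw [← hy, ENNReal.coe_toReal, ENNReal.coe_toReal, ← ENNReal.ofReal_coe_nnreal,
      ← ENNReal.ofReal_coe_nnreal (p := y), ← ENNReal.ofReal_ofNat, ← ENNReal.ofReal_mul (by simp),
      ← ENNReal.ofReal_mul (by positivity), ← ENNReal.ofReal_add (by positivity) (by positivity),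
      ← ENNReal.ofReal_pow (by positivity), ← ENNReal.ofReal_pow (by positivity),
      ← ENNReal.ofReal_add (by positivity) (by positivity)]
    congr 1
    ring
  have hm : Measurable fun γ => ENNReal.ofReal (((Y γ).toReal - T.toReal) ^ 2) :=
    ((hY.ennreal_toReal.sub_const _).pow_const 2).ennreal_ofReal
  have hI := lintegral_congr_ae hpt
  rw [lintegral_add_left hm, lintegral_const_mul _ hY, h1, lintegral_add_left (hY.pow_const 2),
    lintegral_const] at hI
  have hC : 2 * T * (P Set.univ * T) ≠ ∞ := by
    have := measure_ne_top P Set.univ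
    finiteness
  refine (ENNReal.add_le_add_iff_right hC).1 ?_
  rw [hI]
  calc _ ≤ P Set.univ * (T ^ 2 + D) + T ^ 2 * P Set.univ := by gcongr
    _ = _ := by ring

lemma IsMecke.lintegral_S1_sub_sq_le [IsFiniteMeasure P] [SFinite ρ] (h : IsMecke P ρ)
    {g : E d → ℝ≥0∞} (hg : Measurable g) (hT : ∫⁻ x, g x ∂ρ ≠ ∞) :
    ∫⁻ γ, ENNReal.ofReal (((S1 g γ).toReal - (∫⁻ x, g x ∂ρ).toReal) ^ 2) ∂P
      ≤ P Set.univ * ∫⁻ x, g x ^ 2 ∂ρ :=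
  lintegral_sub_sq_le_of_moments (measurable_S1 hg) hT (h.lintegral_S1 hg) (h.lintegral_S1_sq_le hg)

lemma IsMecke.lintegral_S2_sub_sq_le [IsFiniteMeasure P] [SFinite ρ] [NullSingletonClass ρ]
    (h : IsMecke P ρ) {K : E d → E d → ℝ≥0∞} (hK : Measurable (Function.uncurry K)) {R S : ℝ≥0∞}
    (hR : ∀ x, ∫⁻ y, (K x y + K y x) ∂ρ ≤ R) (hS : ∀ x y, K x y + K y x ≤ S)
    (hT : ∫⁻ x, ∫⁻ y, K x y ∂ρ ∂ρ ≠ ∞) :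
    ∫⁻ γ, ENNReal.ofReal (((S2 K γ).toReal - (∫⁻ x, ∫⁻ y, K x y ∂ρ ∂ρ).toReal) ^ 2) ∂P
      ≤ P Set.univ * ((∫⁻ x, ∫⁻ y, K x y ∂ρ ∂ρ) * (2 * R + S)) :=
  lintegral_sub_sq_le_of_moments (measurable_S2 hK) hT (h.lintegral_S2 hK)
    (h.lintegral_S2_sq_le hK hR hS)

/-- The squared deviation from `β` of the sum of `B(x, ·)` over the points of `γ` other than
`x`. -/
def sqDev (B : E d → E d → ℝ≥0∞) (β : ℝ) (γ : Config d) (x : E d) : ℝ≥0∞ :=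
  ENNReal.ofReal (((∫⁻ y, offDiag B x y ∂γ.toMeasure).toReal - β) ^ 2)

lemma measurable_sqDev {B : E d → E d → ℝ≥0∞} (hB : Measurable (Function.uncurry B)) (β : ℝ) :
    Measurable (Function.uncurry (sqDev B β)) := by
  have hO : Measurable fun p : (Config d × E d) × E d => offDiag B p.1.2 p.2 :=
    (measurable_offDiag (Ω := Unit) (G := fun _ => B) (hB.comp measurable_snd)).comp
      (f := fun p : (Config d × E d) × E d => ((), p.1.2, p.2)) (by fun_prop)
  exact (((measurable_lintegral_toMeasure (Ω := Config d × E d) measurable_fst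
    (f := fun q y => offDiag B q.2 y) hO).ennreal_toReal.sub_const _).pow_const 2).ennreal_ofReal

/-- The sum defining the deviation at `x` omits `x` itself, so it does not see the insertion of `x`.
This is what decouples deviation and weight after the Mecke identity. -/
lemma sqDev_add_self (B : E d → E d → ℝ≥0∞) (hB : Measurable (Function.uncurry B)) (β : ℝ)
    {γ : Config d} {x : E d} (hx : x ∉ γ.1) : sqDev B β (γ.add x) x = sqDev B β γ x := by
  have hO : Measurable fun y => offDiag B x y :=
    (measurable_offDiag (Ω := Unit) (G := fun _ => B) (hB.comp measurable_snd)).comp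
      (f := fun y : E d => ((), x, y)) (by fun_prop)
  rw [sqDev, sqDev, toMeasure_add _ hx, lintegral_add_measure, lintegral_dirac' _ hO, offDiag_self,
    add_zero]

/-- Inserting a point moves the sum by at most `s`, and `(u + w)² ≤ 2u² + 2w²`. -/
lemma sqDev_add_le (B : E d → E d → ℝ≥0∞) (hB : Measurable (Function.uncurry B)) (β : ℝ)
    {γ : Config d} {x y : E d} (hy : y ∉ γ.1) {s : ℝ≥0∞} (hs : ∀ x y, B x y ≤ s) (hs' : s ≠ ∞) :
    sqDev B β (γ.add y) x ≤ 2 * sqDev B β γ x + 2 * s ^ 2 := by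
  have hO : Measurable fun y => offDiag B x y :=
    (measurable_offDiag (Ω := Unit) (G := fun _ => B) (hB.comp measurable_snd)).comp
      (f := fun y : E d => ((), x, y)) (by fun_prop)
  rw [sqDev, sqDev, toMeasure_add _ hy, lintegral_add_measure, lintegral_dirac' _ hO]
  set Y := ∫⁻ y, offDiag B x y ∂γ.toMeasure
  have hb : offDiag B x y ≤ s := (offDiag_le B x y).trans (hs x y)
  have hb' : offDiag B x y ≠ ∞ := ne_top_of_le_ne_top hs' hb
  -- An infinite sum stays infinite after the insertion, and `toReal` gives both the same value, so
  -- the two squared deviations coincide.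
  by_cases hY : Y = ∞
  · rw [hY, top_add]
    refine le_add_right ?_
    rw [two_mul]
    exact le_add_right le_rfl
  · rw [ENNReal.toReal_add hY hb']
    have hbs := ENNReal.toReal_mono hs' hb
    have h0 := ENNReal.toReal_nonneg (a := offDiag B x y)
    lift s to ℝ≥0 using hs'
    rw [← ENNReal.ofReal_coe_nnreal (p := s), ← ENNReal.ofReal_ofNat, ← ENNReal.ofReal_mul (by simp),
      ← ENNReal.ofReal_pow (by positivity), ← ENNReal.ofReal_mul (by simp),
      ← ENNReal.ofReal_add (by positivity) (by positivity)]
    refine ENNReal.ofReal_le_ofReal ?_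
    rw [ENNReal.coe_toReal] at hbs
    have h1 : (offDiag B x y).toReal ^ 2 ≤ (s : ℝ) ^ 2 := by gcongr
    nlinarith [sq_nonneg (Y.toReal - β - (offDiag B x y).toReal)]

lemma ofReal_sub_sq_le (u v w : ℝ) : ENNReal.ofReal ((u - v) ^ 2)
    ≤ 2 * ENNReal.ofReal ((u - w) ^ 2) + 2 * ENNReal.ofReal ((w - v) ^ 2) := by
  rw [← ENNReal.ofReal_ofNat, ← ENNReal.ofReal_mul (by simp), ← ENNReal.ofReal_mul (by simp),
    ← ENNReal.ofReal_add (by positivity) (by positivity)]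
  refine ENNReal.ofReal_le_ofReal ?_
  nlinarith [sq_nonneg (u - w - (w - v))]

/-- Cauchy–Schwarz for the factorisation `k √D = √k · √(k D)`. -/
lemma lintegral_mul_sqrt_sq_le {Ω : Type*} [MeasurableSpace Ω] (μ : Measure Ω) {k D : Ω → ℝ≥0∞}
    (hk : Measurable k) (hD : Measurable D) :
    (∫⁻ x, k x * D x ^ (1 / 2 : ℝ) ∂μ) ^ 2 ≤ (∫⁻ x, k x ∂μ) * ∫⁻ x, k x * D x ∂μ := by
  have h0 := ENNReal.lintegral_mul_le_Lp_mul_Lq μ Real.HolderConjugate.two_two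
    (f := fun x => k x ^ (1 / 2 : ℝ)) (g := fun x => k x ^ (1 / 2 : ℝ) * D x ^ (1 / 2 : ℝ))
    (by fun_prop) ((hk.pow_const _).mul (hD.pow_const _)).aemeasurable
  have e1 : ∀ a : ℝ≥0∞, a ^ (1 / 2 : ℝ) * a ^ (1 / 2 : ℝ) = a := fun a => by
    rw [← ENNReal.rpow_add_of_nonneg _ _ (by norm_num) (by norm_num)]; norm_num
  have e2 : ∀ a : ℝ≥0∞, (a ^ (1 / 2 : ℝ)) ^ (2 : ℝ) = a := fun a => by
    rw [← ENNReal.rpow_mul]; norm_num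
  have e3 : ∀ a : ℝ≥0∞, (a ^ (1 / 2 : ℝ)) ^ 2 = a := fun a => by
    rw [sq, e1]
  simp only [Pi.mul_apply, ← mul_assoc, e1, ENNReal.mul_rpow_of_nonneg _ _ (zero_le_two (α := ℝ)), e2]
    at h0
  calc _ ≤ ((∫⁻ x, k x ∂μ) ^ (1 / 2 : ℝ) * (∫⁻ x, k x * D x ∂μ) ^ (1 / 2 : ℝ)) ^ 2 := by gcongr
    _ = _ := by rw [mul_pow, e3, e3]

/-- The deviation from `β` splits into the fluctuation of the sum around its own mean and the bias
of that mean. The fluctuation has variance at most `∫ B² ≤ s R`, the bias is at most `δ`. -/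
lemma IsMecke.lintegral_sqDev_le [IsFiniteMeasure P] [SFinite ρ] [NullSingletonClass ρ]
    (h : IsMecke P ρ) {B : E d → E d → ℝ≥0∞} (hB : Measurable (Function.uncurry B)) (β : ℝ)
    {s R δ : ℝ≥0∞} (hs : ∀ x y, B x y ≤ s) (hR : ∀ x, ∫⁻ y, B x y ∂ρ ≤ R) (hR' : R ≠ ∞)
    (hβ : ∀ x, ENNReal.ofReal (((∫⁻ y, B x y ∂ρ).toReal - β) ^ 2) ≤ δ) (x : E d) :
    ∫⁻ γ, sqDev B β γ x ∂P ≤ P Set.univ * (2 * (s * R + δ)) := by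
  have hO : Measurable fun y => offDiag B x y :=
    (measurable_offDiag (Ω := Unit) (G := fun _ => B) (hB.comp measurable_snd)).comp
      (f := fun y : E d => ((), x, y)) (by fun_prop)
  have hBx : Measurable fun y => B x y := hB.comp measurable_prodMk_left
  have e : ∫⁻ y, offDiag B x y ∂ρ = ∫⁻ y, B x y ∂ρ := lintegral_congr_ae (ae_offDiag ρ B x)
  have hvar := h.lintegral_S1_sub_sq_le hO (by rw [e]; exact ne_top_of_le_ne_top hR' (hR x))
  have hsq : ∫⁻ y, offDiag B x y ^ 2 ∂ρ ≤ s * R := by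
    calc ∫⁻ y, offDiag B x y ^ 2 ∂ρ ≤ ∫⁻ y, s * B x y ∂ρ := by
          refine lintegral_mono fun y => ?_
          rw [sq]
          exact mul_le_mul' ((offDiag_le B x y).trans (hs x y)) (offDiag_le B x y)
      _ ≤ s * R := by rw [lintegral_const_mul _ hBx]; gcongr; exact hR x
  rw [e] at hvar
  set G := ∫⁻ y, B x y ∂ρ
  have hm : Measurable fun γ : Config d =>
      ENNReal.ofReal (((S1 (fun y => offDiag B x y) γ).toReal - G.toReal) ^ 2) :=
    (((measurable_S1 hO).ennreal_toReal.sub_const _).pow_const 2).ennreal_ofReal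
  calc ∫⁻ γ, sqDev B β γ x ∂P
      ≤ ∫⁻ γ, (2 * ENNReal.ofReal (((S1 (fun y => offDiag B x y) γ).toReal - G.toReal) ^ 2)
          + 2 * δ) ∂P := by
        refine lintegral_mono fun γ => ?_
        refine le_trans ?_ (add_le_add_right (mul_le_mul_right (hβ x) 2) _)
        exact ofReal_sub_sq_le _ _ _
    _ = 2 * (∫⁻ γ, ENNReal.ofReal (((S1 (fun y => offDiag B x y) γ).toReal - G.toReal) ^ 2) ∂P)
          + 2 * δ * P Set.univ := by
        rw [lintegral_add_left (hm.const_mul 2), lintegral_const_mul _ hm, lintegral_const]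
    _ ≤ 2 * (P Set.univ * (s * R)) + 2 * δ * P Set.univ := by
        gcongr
        exact hvar.trans (by gcongr)
    _ = _ := by ring

/-- The weight and the deviation at a fixed `x` depend on the same configuration; the Mecke identity
decouples them, since an extra point changes the deviation by a bounded amount only. -/
lemma IsMecke.lintegral_S1_mul_sqDev_le [IsFiniteMeasure P] [SFinite ρ] [NullSingletonClass ρ]
    (h : IsMecke P ρ) {B : E d → E d → ℝ≥0∞} (hB : Measurable (Function.uncurry B)) (β : ℝ)
    {s Δ : ℝ≥0∞} (hs : ∀ x y, B x y ≤ s) (hs' : s ≠ ∞)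
    (hΔ : ∀ x, ∫⁻ γ, sqDev B β γ x ∂P ≤ P Set.univ * Δ)
    {k : E d → ℝ≥0∞} (hk : Measurable k) (x : E d) :
    ∫⁻ γ, S1 k γ * sqDev B β γ x ∂P
      ≤ (∫⁻ x, k x ∂ρ) * (2 * (P Set.univ * (Δ + s ^ 2))) := by
  have hDx : ∀ x, Measurable fun γ => sqDev B β γ x := fun x =>
    (measurable_sqDev hB β).of_uncurry_right
  have e : ∀ γ, S1 k γ * sqDev B β γ x = ∫⁻ y, k y * sqDev B β γ x ∂γ.toMeasure := fun γ => by
    rw [lintegral_mul_const _ hk]; rfl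
  simp only [e]
  rw [h (fun γ y => k y * sqDev B β γ x)
    ((hk.comp measurable_snd).mul ((hDx x).comp measurable_fst))]
  calc ∫⁻ γ, ∫⁻ y, k y * sqDev B β (γ.add y) x ∂ρ ∂P
      ≤ ∫⁻ γ, ∫⁻ y, k y * (2 * sqDev B β γ x + 2 * s ^ 2) ∂ρ ∂P := by
        refine lintegral_mono fun γ => lintegral_mono_ae ?_
        filter_upwards [γ.ae_notMem ρ] with y hy
        gcongr
        exact sqDev_add_le B hB β hy hs hs'
    _ = (∫⁻ x, k x ∂ρ) * (2 * ∫⁻ γ, sqDev B β γ x ∂P + 2 * s ^ 2 * P Set.univ) := by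
        simp only [lintegral_mul_const _ hk]
        rw [lintegral_const_mul _ (((hDx x).const_mul 2).add_const _),
          lintegral_add_left ((hDx x).const_mul 2), lintegral_const_mul _ (hDx x),
          lintegral_const]
    _ ≤ (∫⁻ x, k x ∂ρ) * (2 * (P Set.univ * Δ) + 2 * s ^ 2 * P Set.univ) := by
        gcongr; exact hΔ x
    _ = _ := by ring

/-- Cauchy–Schwarz over the points of `γ` bounds the square by `(∑ k)(∑ k·sqDev)`. The Mecke
identity then removes the outer sum: the deviation at `x` is unaffected by inserting `x`, and the
weight grows by `k x ≤ κ`. What remains is the mean of weight times deviation at a fixed point. -/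
lemma IsMecke.lintegral_weighted_sqDev_le [IsFiniteMeasure P] [SFinite ρ] [NullSingletonClass ρ]
    (h : IsMecke P ρ) {B : E d → E d → ℝ≥0∞} (hB : Measurable (Function.uncurry B)) (β : ℝ)
    {s Δ κ : ℝ≥0∞} (hs : ∀ x y, B x y ≤ s) (hs' : s ≠ ∞)
    (hΔ : ∀ x, ∫⁻ γ, sqDev B β γ x ∂P ≤ P Set.univ * Δ)
    {k : E d → ℝ≥0∞} (hk : Measurable k) (hκ : ∀ x, k x ≤ κ) :
    ∫⁻ γ, (∫⁻ x, k x * sqDev B β γ x ^ (1 / 2 : ℝ) ∂γ.toMeasure) ^ 2 ∂P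
      ≤ P Set.univ * (∫⁻ x, k x ∂ρ) * (2 * (∫⁻ x, k x ∂ρ) * (Δ + s ^ 2) + κ * Δ) := by
  have hD := measurable_sqDev hB β
  have hD' : Measurable fun p : Config d × E d => sqDev B β p.1 p.2 := by
    rwa [Function.uncurry_def] at hD
  have hDγ : ∀ γ, Measurable fun x => sqDev B β γ x := fun γ => hD.of_uncurry_left
  have hDx : ∀ x, Measurable fun γ => sqDev B β γ x := fun x => hD.of_uncurry_right
  have hS := measurable_S1 hk
  have hcs : ∀ γ : Config d, (∫⁻ x, k x * sqDev B β γ x ^ (1 / 2 : ℝ) ∂γ.toMeasure) ^ 2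
      ≤ ∫⁻ x, S1 k γ * (k x * sqDev B β γ x) ∂γ.toMeasure := by
    intro γ
    have hm : Measurable fun x => k x * sqDev B β γ x := hk.mul (hDγ γ)
    rw [lintegral_const_mul _ hm]
    exact lintegral_mul_sqrt_sq_le _ hk (hDγ γ)
  have hweak := h.lintegral_S1_mul_sqDev_le hB β hs hs' hΔ hk
  have hm1 : Measurable fun p : Config d × E d => S1 k p.1 * (k p.2 * sqDev B β p.1 p.2) :=
    (hS.comp measurable_fst).mul ((hk.comp measurable_snd).mul hD')
  have hm2 : Measurable fun p : Config d × E d => k p.2 * (k p.2 * sqDev B β p.1 p.2) :=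
    (hk.comp measurable_snd).mul ((hk.comp measurable_snd).mul hD')
  calc _ ≤ ∫⁻ γ, ∫⁻ x, S1 k γ * (k x * sqDev B β γ x) ∂γ.toMeasure ∂P := lintegral_mono hcs
    _ = ∫⁻ γ, ∫⁻ x, S1 k (γ.add x) * (k x * sqDev B β (γ.add x) x) ∂ρ ∂P :=
        h (fun γ x => S1 k γ * (k x * sqDev B β γ x)) hm1
    _ ≤ ∫⁻ γ, ∫⁻ x, (S1 k γ * (k x * sqDev B β γ x) + k x * (k x * sqDev B β γ x)) ∂ρ ∂P := by
        refine lintegral_mono fun γ => lintegral_mono_ae ?_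
        filter_upwards [γ.ae_notMem ρ] with x hx
        rw [sqDev_add_self B hB β hx, ← add_mul]
        gcongr
        exact S1_add_le γ x hk
    _ = ∫⁻ x, ∫⁻ γ, (S1 k γ * (k x * sqDev B β γ x) + k x * (k x * sqDev B β γ x)) ∂P ∂ρ :=
        lintegral_lintegral_swap (f := fun γ x =>
          S1 k γ * (k x * sqDev B β γ x) + k x * (k x * sqDev B β γ x)) (hm1.add hm2).aemeasurable
    _ ≤ ∫⁻ x, k x * (P Set.univ * (2 * (∫⁻ x, k x ∂ρ) * (Δ + s ^ 2) + κ * Δ)) ∂ρ := by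
        refine lintegral_mono fun x => ?_
        have hm3 : Measurable fun γ => S1 k γ * (k x * sqDev B β γ x) :=
          hS.mul ((hDx x).const_mul _)
        rw [lintegral_add_left hm3]
        have e : ∀ γ, S1 k γ * (k x * sqDev B β γ x) = k x * (S1 k γ * sqDev B β γ x) :=
          fun γ => by ring
        simp only [e]
        have hm4 : Measurable fun γ => S1 k γ * sqDev B β γ x := hS.mul (hDx x)
        rw [lintegral_const_mul _ hm4, lintegral_const_mul _ ((hDx x).const_mul _),
          lintegral_const_mul _ (hDx x)]
        calc _ ≤ k x * ((∫⁻ x, k x ∂ρ) * (2 * (P Set.univ * (Δ + s ^ 2))))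
              + k x * (κ * (P Set.univ * Δ)) := by
              gcongr
              · exact hweak x
              · exact hκ x
              · exact hΔ x
          _ = _ := by ring
    _ = _ := by rw [lintegral_mul_const _ hk]; ring

end Moments

end
end BinaryJumps

namespace BinaryJumps

noncomputable section

variable {d : ℕ}

/-! ### Jump integrals -/

/-- The pair rate `b(x₂ - x₁)`. -/
def pairRate (b : E d → ℝ≥0) (x : E d × E d) : ℝ≥0 := b (x.2 - x.1)

lemma measurable_pairRate {b : E d → ℝ≥0} (hb : Measurable b) : Measurable (pairRate b) :=
  hb.comp (measurable_snd.sub measurable_fst)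

lemma pairRate_swap {b : E d → ℝ≥0} (hb : ∀ x, b (-x) = b x) (x : E d × E d) :
    pairRate b x.swap = pairRate b x := by
  rw [pairRate, pairRate, ← hb, neg_sub]; rfl

/-- The integral over the jumps `h` from `x` to `x + h`, weighted with the rate before the jump. -/
def jumpPre (μ : Measure (E d × E d)) (b : E d → ℝ≥0) (v : E d × E d → E d × E d → ℝ≥0∞)
    (x : E d × E d) : ℝ≥0∞ := ∫⁻ h, pairRate b x * v x (x + h) ∂μ

/-- The integral over the jumps `h` from `x` to `x + h`, weighted with the rate after the jump. -/
def jumpPost (μ : Measure (E d × E d)) (b : E d → ℝ≥0) (v : E d × E d → E d × E d → ℝ≥0∞)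
    (x : E d × E d) : ℝ≥0∞ := ∫⁻ h, pairRate b (x + h) * v x (x + h) ∂μ

section

variable {μ : Measure (E d × E d)} [SFinite μ] {b : E d → ℝ≥0}
  {v : E d × E d → E d × E d → ℝ≥0∞}

lemma measurable_shift (hv : Measurable (Function.uncurry v)) :
    Measurable fun p : (E d × E d) × (E d × E d) => v p.1 (p.1 + p.2) :=
  hv.comp (f := fun p : (E d × E d) × (E d × E d) => (p.1, p.1 + p.2)) (by fun_prop)

lemma measurable_pre (hb : Measurable b) (hv : Measurable (Function.uncurry v)) :
    Measurable fun p : (E d × E d) × (E d × E d) => (pairRate b p.1 : ℝ≥0∞) * v p.1 (p.1 + p.2) :=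
  ((measurable_pairRate hb).comp measurable_fst).coe_nnreal_ennreal.mul (measurable_shift hv)

lemma measurable_post (hb : Measurable b) (hv : Measurable (Function.uncurry v)) :
    Measurable fun p : (E d × E d) × (E d × E d) =>
      (pairRate b (p.1 + p.2) : ℝ≥0∞) * v p.1 (p.1 + p.2) :=
  ((measurable_pairRate hb).comp (measurable_fst.add measurable_snd)).coe_nnreal_ennreal.mul
    (measurable_shift hv)

lemma measurable_jumpPre (hb : Measurable b) (hv : Measurable (Function.uncurry v)) :
    Measurable (jumpPre μ b v) := (measurable_pre hb hv).lintegral_prod_right'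

lemma measurable_jumpPost (hb : Measurable b) (hv : Measurable (Function.uncurry v)) :
    Measurable (jumpPost μ b v) := (measurable_post hb hv).lintegral_prod_right'

end

/-- Translation by `-h` makes `x` the endpoint of the jump and `x - h` its start; evenness of the
jump measure then turns `-h` into `h`. It expresses reversibility of the jumps with respect to
Lebesgue measure. -/
lemma lintegral_reverse {G : Type*} [AddCommGroup G] [MeasurableSpace G] [MeasurableAdd₂ G]
    [MeasurableNeg G] {μ ν : Measure G} [SFinite μ] [SFinite ν] [ν.IsAddRightInvariant]
    (hμ : μ.map Neg.neg = μ) {f : G → G → ℝ≥0∞} (hf : Measurable (Function.uncurry f)) :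
    ∫⁻ x, ∫⁻ h, f x (x + h) ∂μ ∂ν = ∫⁻ x, ∫⁻ h, f (x + h) x ∂μ ∂ν := by
  have h1 : Measurable fun p : G × G => f p.1 (p.1 + p.2) :=
    hf.comp (f := fun p : G × G => (p.1, p.1 + p.2)) (by fun_prop)
  have h2 : Measurable fun p : G × G => f (p.1 + p.2) p.1 :=
    hf.comp (f := fun p : G × G => (p.1 + p.2, p.1)) (by fun_prop)
  rw [lintegral_lintegral_swap (f := fun x h => f x (x + h)) h1.aemeasurable,
    lintegral_lintegral_swap (f := fun x h => f (x + h) x) h2.aemeasurable]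
  conv_rhs => rw [← hμ, lintegral_map (Measurable.lintegral_prod_left' h2) measurable_neg]
  congr 1; ext h
  rw [← lintegral_add_right_eq_self _ (-h)]
  simp

lemma lintegral_swap_shift {G : Type*} [Add G] [MeasurableSpace G] {μ : Measure (G × G)}
    (hμ : μ.map Prod.swap = μ) (g : G × G → ℝ≥0∞) (x : G × G) :
    ∫⁻ h, g (x.swap + h) ∂μ = ∫⁻ h, g (x + h).swap ∂μ := by
  conv_lhs => rw [← hμ]
  exact lintegral_map_equiv _ MeasurableEquiv.prodComm

section

variable {μ : Measure (E d × E d)} {b : E d → ℝ≥0} {v : E d × E d → E d × E d → ℝ≥0∞}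

lemma jumpPre_eq (hv : Measurable (Function.uncurry v)) (x : E d × E d) :
    jumpPre μ b v x = pairRate b x * ∫⁻ h, v x (x + h) ∂μ := by
  have h : Measurable fun h => v x (x + h) := (measurable_shift hv).comp measurable_prodMk_left
  rw [jumpPre, lintegral_const_mul _ h]

/-- Reversal of the jumps. -/
lemma lintegral_jumpPost [SFinite μ] (hμ : μ.map Neg.neg = μ) (hb : Measurable b)
    (hv : Measurable (Function.uncurry v)) :
    ∫⁻ x, jumpPost μ b v x = ∫⁻ x, jumpPre μ b (fun x y => v y x) x := by
  have : (volume : Measure (E d × E d)).IsAddRightInvariant := by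
    rw [Measure.volume_eq_prod]; infer_instance
  exact lintegral_reverse hμ (f := fun x y => (pairRate b y : ℝ≥0∞) * v x y)
    (((measurable_pairRate hb).comp measurable_snd).coe_nnreal_ennreal.mul hv)

lemma jumpPre_swap (hμ : μ.map Prod.swap = μ) (hbe : ∀ x, b (-x) = b x)
    (hvs : ∀ x y, v x.swap y.swap = v x y) (x : E d × E d) :
    jumpPre μ b v x.swap = jumpPre μ b v x := by
  simp only [jumpPre, pairRate_swap hbe]
  rw [lintegral_swap_shift hμ (fun y => (pairRate b x : ℝ≥0∞) * v x.swap y)]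
  simp only [hvs]

lemma jumpPost_swap (hμ : μ.map Prod.swap = μ) (hbe : ∀ x, b (-x) = b x)
    (hvs : ∀ x y, v x.swap y.swap = v x y) (x : E d × E d) :
    jumpPost μ b v x.swap = jumpPost μ b v x := by
  simp only [jumpPost]
  rw [lintegral_swap_shift hμ (fun y => (pairRate b y : ℝ≥0∞) * v x.swap y)]
  simp only [hvs, pairRate_swap hbe]

end

/-- `g(x₁) + g(x₂)`. -/
def sum2 (g : E d → ℝ≥0∞) (x : E d × E d) : ℝ≥0∞ := g x.1 + g x.2

lemma measurable_sum2 {g : E d → ℝ≥0∞} (hg : Measurable g) : Measurable (sum2 g) :=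
  (hg.comp measurable_fst).add (hg.comp measurable_snd)

lemma sum2_swap (g : E d → ℝ≥0∞) (x : E d × E d) : sum2 g x.swap = sum2 g x := by
  simp [sum2, add_comm]

section

variable {b : E d → ℝ≥0} {k : E d → ℝ≥0∞}

lemma lintegral_pairRate_fst (hb : Measurable b) (hk : Measurable k) :
    ∫⁻ x : E d × E d, pairRate b x * k x.1 = (∫⁻ x, b x) * ∫⁻ x, k x := by
  have hm : Measurable fun x : E d × E d => (pairRate b x : ℝ≥0∞) * k x.1 :=
    (measurable_pairRate hb).coe_nnreal_ennreal.mul (hk.comp measurable_fst)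
  rw [Measure.volume_eq_prod, lintegral_prod _ hm.aemeasurable, ← lintegral_const_mul _ hk]
  congr 1; ext x
  have hx : Measurable fun y => (pairRate b (x, y) : ℝ≥0∞) :=
    ((measurable_pairRate hb).comp measurable_prodMk_left).coe_nnreal_ennreal
  show ∫⁻ y, (pairRate b (x, y) : ℝ≥0∞) * k x = _
  rw [lintegral_mul_const _ hx]
  congr 1
  exact lintegral_sub_right_eq_self (fun y => (b y : ℝ≥0∞)) x

lemma lintegral_pairRate_snd (hb : Measurable b) (hbe : ∀ x, b (-x) = b x) (hk : Measurable k) :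
    ∫⁻ x : E d × E d, pairRate b x * k x.2 = (∫⁻ x, b x) * ∫⁻ x, k x := by
  rw [← lintegral_pairRate_fst hb hk]
  have hm : Measurable fun x : E d × E d => (pairRate b x : ℝ≥0∞) * k x.1 :=
    (measurable_pairRate hb).coe_nnreal_ennreal.mul (hk.comp measurable_fst)
  have := (Measure.measurePreserving_swap (μ := (volume : Measure (E d)))
    (ν := (volume : Measure (E d)))).lintegral_comp hm
  simp only [pairRate_swap hbe] at this
  exact this

lemma lintegral_pairRate_sum2 (hb : Measurable b) (hbe : ∀ x, b (-x) = b x) (hk : Measurable k) :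
    ∫⁻ x : E d × E d, pairRate b x * sum2 k x = 2 * (∫⁻ x, b x) * ∫⁻ x, k x := by
  have hm : Measurable fun x : E d × E d => (pairRate b x : ℝ≥0∞) * k x.1 :=
    (measurable_pairRate hb).coe_nnreal_ennreal.mul (hk.comp measurable_fst)
  simp only [sum2, mul_add]
  rw [lintegral_add_left hm, lintegral_pairRate_fst hb hk, lintegral_pairRate_snd hb hbe hk]
  ring

variable {α : Measure (E d)} [IsFiniteMeasure α]

/-- The convolution `x ↦ ∫ k(x + h) α(dh)`. -/
def smear (α : Measure (E d)) (k : E d → ℝ≥0∞) (x : E d) : ℝ≥0∞ := ∫⁻ h, k (x + h) ∂α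

lemma measurable_smear (hk : Measurable k) : Measurable (smear α k) :=
  Measurable.lintegral_prod_right' (f := fun p : E d × E d => k (p.1 + p.2))
    (hk.comp (by fun_prop))

lemma lintegral_smear (hk : Measurable k) : ∫⁻ x, smear α k x = α Set.univ * ∫⁻ x, k x := by
  have := lintegral_lintegral_swap (μ := (volume : Measure (E d))) (ν := α)
    (f := fun x h => k (x + h)) (hk.comp (by fun_prop)).aemeasurable
  simp only [smear]
  rw [this]
  simp only [lintegral_add_right_eq_self]
  rw [lintegral_const, mul_comm]

lemma lintegral_prod_fst' {f : E d → ℝ≥0∞} (hf : Measurable f) :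
    ∫⁻ h : E d × E d, f h.1 ∂(α.prod α) = α Set.univ * ∫⁻ h, f h ∂α := by
  rw [lintegral_prod (fun h : E d × E d => f h.1) (hf.comp measurable_fst).aemeasurable]
  simp only [lintegral_const]
  rw [lintegral_mul_const _ hf, mul_comm]

lemma lintegral_prod_snd' {f : E d → ℝ≥0∞} (hf : Measurable f) :
    ∫⁻ h : E d × E d, f h.2 ∂(α.prod α) = α Set.univ * ∫⁻ h, f h ∂α := by
  rw [lintegral_prod (fun h : E d × E d => f h.2) (hf.comp measurable_snd).aemeasurable]
  show ∫⁻ _, ∫⁻ y, f y ∂α ∂α = _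
  rw [lintegral_const, mul_comm]

lemma lintegral_sum2_shift (hk : Measurable k) (x : E d × E d) :
    ∫⁻ h, sum2 k (x + h) ∂(α.prod α) = α Set.univ * sum2 (smear α k) x := by
  have h1 : Measurable fun h : E d => k (x.1 + h) := hk.comp (by fun_prop)
  have h2 : Measurable fun h : E d => k (x.2 + h) := hk.comp (by fun_prop)
  simp only [sum2, Prod.fst_add, Prod.snd_add]
  have h3 : Measurable fun h : E d × E d => k (x.1 + h.1) := h1.comp measurable_fst
  rw [lintegral_add_left h3, lintegral_prod_fst' h1, lintegral_prod_snd' h2,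
    mul_add]
  rfl

lemma lintegral_mul_shift (hk : Measurable k) (x : E d × E d) :
    ∫⁻ h : E d × E d, k (x.1 + h.1) * k (x.2 + h.2) ∂(α.prod α) = smear α k x.1 * smear α k x.2 := by
  have h1 : Measurable fun h : E d => k (x.1 + h) := hk.comp (by fun_prop)
  have h2 : Measurable fun h : E d => k (x.2 + h) := hk.comp (by fun_prop)
  exact lintegral_prod_mul h1.aemeasurable h2.aemeasurable

lemma prod_univ_eq : (α.prod α) Set.univ = α Set.univ ^ 2 := by
  rw [← Set.univ_prod_univ, Measure.prod_prod, sq]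

/-! #### Bounds for the total jump integral -/

/-- The majorant `∑ᵢ k(xᵢ) + k(yᵢ)`. -/
def majTotal (k : E d → ℝ≥0∞) (x y : E d × E d) : ℝ≥0∞ := sum2 k x + sum2 k y

lemma measurable_majTotal (hk : Measurable k) : Measurable (Function.uncurry (majTotal k)) :=
  ((measurable_sum2 hk).comp measurable_fst).add ((measurable_sum2 hk).comp measurable_snd)

/-- Smearing multiplies an integral by the mass of `α`, so the two points after the jump contribute
exactly as much as the two points before it; the `4` counts these points. -/
lemma lintegral_jumpPre_majTotal (hb : Measurable b) (hbe : ∀ x, b (-x) = b x)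
    (hk : Measurable k) : ∫⁻ x, jumpPre (α.prod α) b (majTotal k) x
      = 4 * (∫⁻ x, b x) * α Set.univ ^ 2 * ∫⁻ x, k x := by
  have hm1 : Measurable fun x => (pairRate b x : ℝ≥0∞) * sum2 k x :=
    (measurable_pairRate hb).coe_nnreal_ennreal.mul (measurable_sum2 hk)
  have hm2 : Measurable fun x => (pairRate b x : ℝ≥0∞) * sum2 (smear α k) x :=
    (measurable_pairRate hb).coe_nnreal_ennreal.mul (measurable_sum2 (measurable_smear hk))
  have e : ∀ x, jumpPre (α.prod α) b (majTotal k) x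
      = α Set.univ ^ 2 * (pairRate b x * sum2 k x)
        + α Set.univ * (pairRate b x * sum2 (smear α k) x) := by
    intro x
    rw [jumpPre_eq (measurable_majTotal hk)]
    simp only [majTotal]
    rw [lintegral_add_left measurable_const, lintegral_sum2_shift hk, lintegral_const, prod_univ_eq]
    ring
  simp only [e]
  rw [lintegral_add_left (hm1.const_mul _), lintegral_const_mul _ hm1, lintegral_const_mul _ hm2,
    lintegral_pairRate_sum2 hb hbe hk, lintegral_pairRate_sum2 hb hbe (measurable_smear hk),
    lintegral_smear hk]
  ring

lemma lintegral_pairRate_right (x : E d) : ∫⁻ y, (pairRate b (x, y) : ℝ≥0∞) = ∫⁻ x, (b x : ℝ≥0∞) :=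
  lintegral_sub_right_eq_self (fun y => (b y : ℝ≥0∞)) x

lemma lintegral_pairRate_right_shift (x : E d) (h : E d × E d) :
    ∫⁻ y, (pairRate b ((x, y) + h) : ℝ≥0∞) = ∫⁻ x, (b x : ℝ≥0∞) := by
  have e : ∀ y, (pairRate b ((x, y) + h) : ℝ≥0∞) = b (y + (h.2 - (x + h.1))) := by
    intro y
    simp only [pairRate, Prod.fst_add, Prod.snd_add]
    congr 2; abel
  simp only [e]
  exact lintegral_add_right_eq_self (fun y => (b y : ℝ≥0∞)) _

lemma lintegral_jumpPre_right_le (hb : Measurable b) {v : E d × E d → E d × E d → ℝ≥0∞}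
    {c : ℝ≥0∞} (hc : ∀ x y, v x y ≤ c) (x : E d) :
    ∫⁻ y, jumpPre (α.prod α) b v (x, y) ≤ c * α Set.univ ^ 2 * ∫⁻ x, b x := by
  have hm : Measurable fun y => (pairRate b (x, y) : ℝ≥0∞) :=
    ((measurable_pairRate hb).comp measurable_prodMk_left).coe_nnreal_ennreal
  calc ∫⁻ y, jumpPre (α.prod α) b v (x, y)
      ≤ ∫⁻ y, pairRate b (x, y) * (c * α Set.univ ^ 2) := by
        refine lintegral_mono fun y => ?_
        rw [← mul_assoc, ← prod_univ_eq, ← lintegral_const]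
        exact lintegral_mono fun h => mul_le_mul_right (hc _ _) _
    _ = _ := by
        rw [lintegral_mul_const _ hm, lintegral_pairRate_right, mul_comm]

lemma lintegral_jumpPost_right_le (hb : Measurable b) {v : E d × E d → E d × E d → ℝ≥0∞}
    {c : ℝ≥0∞} (hc : ∀ x y, v x y ≤ c) (x : E d) :
    ∫⁻ y, jumpPost (α.prod α) b v (x, y) ≤ c * α Set.univ ^ 2 * ∫⁻ x, b x := by
  have hm2 : Measurable fun p : E d × (E d × E d) => (pairRate b ((x, p.1) + p.2) : ℝ≥0∞) * c :=
    (((measurable_pairRate hb).comp (f := fun p : E d × (E d × E d) => (x, p.1) + p.2)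
      (by fun_prop)).coe_nnreal_ennreal).mul_const _
  have hm : ∀ h, Measurable fun y => (pairRate b ((x, y) + h) : ℝ≥0∞) := fun h =>
    ((measurable_pairRate hb).comp (f := fun y : E d => (x, y) + h)
      (by fun_prop)).coe_nnreal_ennreal
  calc ∫⁻ y, jumpPost (α.prod α) b v (x, y)
      ≤ ∫⁻ y, ∫⁻ h, pairRate b ((x, y) + h) * c ∂(α.prod α) := by
        refine lintegral_mono fun y => lintegral_mono fun h => ?_
        exact mul_le_mul_right (hc _ _) _
    _ = ∫⁻ h, ∫⁻ y, pairRate b ((x, y) + h) * c ∂volume ∂(α.prod α) :=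
        lintegral_lintegral_swap (f := fun y h => (pairRate b ((x, y) + h) : ℝ≥0∞) * c)
          hm2.aemeasurable
    _ = _ := by
        have e : ∀ h, ∫⁻ y, (pairRate b ((x, y) + h) : ℝ≥0∞) * c = (∫⁻ x, (b x : ℝ≥0∞)) * c :=
          fun h => by rw [lintegral_mul_const _ (hm h), lintegral_pairRate_right_shift]
        simp only [e]
        rw [lintegral_const, prod_univ_eq]
        ring

lemma jumpPre_le {M : ℝ≥0} (hM : ∀ x, b x ≤ M) {v : E d × E d → E d × E d → ℝ≥0∞}
    {c : ℝ≥0∞} (hc : ∀ x y, v x y ≤ c) (x : E d × E d) :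
    jumpPre (α.prod α) b v x ≤ M * c * α Set.univ ^ 2 := by
  refine (lintegral_mono fun h => mul_le_mul' (ENNReal.coe_le_coe.2 (hM _)) (hc _ _)).trans_eq ?_
  rw [lintegral_const, prod_univ_eq]

lemma jumpPost_le {M : ℝ≥0} (hM : ∀ x, b x ≤ M) {v : E d × E d → E d × E d → ℝ≥0∞}
    {c : ℝ≥0∞} (hc : ∀ x y, v x y ≤ c) (x : E d × E d) :
    jumpPost (α.prod α) b v x ≤ M * c * α Set.univ ^ 2 := by
  refine (lintegral_mono fun h => mul_le_mul' (ENNReal.coe_le_coe.2 (hM _)) (hc _ _)).trans_eq ?_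
  rw [lintegral_const, prod_univ_eq]

/-! #### Bounds for the births -/

/-- The majorant `k(y₁) + k(y₂)`. -/
def majBirth (k : E d → ℝ≥0∞) (_ y : E d × E d) : ℝ≥0∞ := sum2 k y

lemma measurable_majBirth (hk : Measurable k) : Measurable (Function.uncurry (majBirth k)) :=
  (measurable_sum2 hk).comp measurable_snd

lemma lintegral_majBirth_le (hk : Measurable k) {s : ℝ≥0∞} (hsk : ∀ x, smear α k x ≤ s)
    (x : E d × E d) : ∫⁻ h, majBirth k x (x + h) ∂(α.prod α) ≤ 2 * α Set.univ * s := by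
  simp only [majBirth]
  rw [lintegral_sum2_shift hk, sum2]
  calc _ ≤ α Set.univ * (s + s) := by gcongr <;> exact hsk _
    _ = _ := by ring

lemma jumpPre_majBirth_le (hk : Measurable k) {s : ℝ≥0∞} (hsk : ∀ x, smear α k x ≤ s)
    (x : E d × E d) :
    jumpPre (α.prod α) b (majBirth k) x ≤ pairRate b x * (2 * α Set.univ * s) := by
  rw [jumpPre_eq (measurable_majBirth hk)]
  gcongr
  exact lintegral_majBirth_le hk hsk x

lemma jumpPost_majBirth_le {M : ℝ≥0} (hM : ∀ x, b x ≤ M) (hk : Measurable k) {s : ℝ≥0∞}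
    (hsk : ∀ x, smear α k x ≤ s) (x : E d × E d) :
    jumpPost (α.prod α) b (majBirth k) x ≤ M * (2 * α Set.univ * s) := by
  have hm : Measurable fun h => majBirth k x (x + h) :=
    (measurable_shift (measurable_majBirth hk)).comp measurable_prodMk_left
  refine (lintegral_mono fun h => mul_le_mul_left (ENNReal.coe_le_coe.2 (hM _)) _).trans ?_
  rw [lintegral_const_mul _ hm]
  gcongr
  exact lintegral_majBirth_le hk hsk x

lemma lintegral_jumpPre_majBirth_right_le (hb : Measurable b) (hk : Measurable k) {s : ℝ≥0∞}
    (hsk : ∀ x, smear α k x ≤ s) (x : E d) :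
    ∫⁻ y, jumpPre (α.prod α) b (majBirth k) (x, y) ≤ 2 * α Set.univ * s * ∫⁻ x, b x := by
  have hm : Measurable fun y => (pairRate b (x, y) : ℝ≥0∞) :=
    ((measurable_pairRate hb).comp measurable_prodMk_left).coe_nnreal_ennreal
  refine (lintegral_mono fun y => jumpPre_majBirth_le hk hsk (x, y)).trans_eq ?_
  rw [lintegral_mul_const _ hm, lintegral_pairRate_right, mul_comm]

/-- For fixed `h` the integral over `y` is translated by `h₂`. A birth at the first particle leaves
`k(x + h₁)` times `∫ b`, small by smearing of `k`. A birth at the second leaves `b(y - x - h₁)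
k(y)`, where the integral over `h₁` smears `b`, with evenness reversing the sign of its argument. -/
lemma lintegral_jumpPost_majBirth_right_le (hb : Measurable b) (hbe : ∀ x, b (-x) = b x)
    (hk : Measurable k) {s : ℝ≥0∞} (hsk : ∀ x, smear α k x ≤ s)
    (hsb : ∀ x, smear α (fun y => b y) x ≤ s) (x : E d) :
    ∫⁻ y, jumpPost (α.prod α) b (majBirth k) (x, y)
      ≤ α Set.univ * s * ((∫⁻ x, b x) + ∫⁻ x, k x) := by
  have hm : Measurable fun p : E d × (E d × E d) =>
      (pairRate b ((x, p.1) + p.2) : ℝ≥0∞) * majBirth k (x, p.1) ((x, p.1) + p.2) :=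
    (measurable_post hb (measurable_majBirth hk)).comp
      (f := fun p : E d × (E d × E d) => ((x, p.1), p.2)) (by fun_prop)
  have hk1 : Measurable fun h : E d => k (x + h) := hk.comp (by fun_prop)
  have hb1 : ∀ h : E d × E d, Measurable fun y => (pairRate b ((x, y) + h) : ℝ≥0∞) := fun h =>
    ((measurable_pairRate hb).comp (f := fun y : E d => (x, y) + h)
      (by fun_prop)).coe_nnreal_ennreal
  have hbk : Measurable fun p : E d × E d => (b (p.2 - (x + p.1)) : ℝ≥0∞) * k p.2 :=
    ((hb.comp (f := fun p : E d × E d => p.2 - (x + p.1)) (by fun_prop)).coe_nnreal_ennreal).mul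
      (hk.comp measurable_snd)
  have e : ∀ h : E d × E d, ∫⁻ y, (pairRate b ((x, y) + h) : ℝ≥0∞)
      * majBirth k (x, y) ((x, y) + h)
      = (∫⁻ x, (b x : ℝ≥0∞)) * k (x + h.1) + ∫⁻ y, b (y - (x + h.1)) * k y := by
    intro h
    simp only [majBirth, sum2, mul_add, Prod.fst_add, Prod.snd_add]
    rw [lintegral_add_left ((hb1 h).mul_const _), lintegral_mul_const _ (hb1 h),
      lintegral_pairRate_right_shift]
    congr 1
    exact lintegral_add_right_eq_self (fun y => (b (y - (x + h.1)) : ℝ≥0∞) * k y) h.2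
  calc ∫⁻ y, jumpPost (α.prod α) b (majBirth k) (x, y)
      = ∫⁻ h, ∫⁻ y, (pairRate b ((x, y) + h) : ℝ≥0∞) * majBirth k (x, y) ((x, y) + h)
          ∂volume ∂(α.prod α) :=
        lintegral_lintegral_swap (f := fun y h => (pairRate b ((x, y) + h) : ℝ≥0∞)
          * majBirth k (x, y) ((x, y) + h)) hm.aemeasurable
    _ = ∫⁻ h : E d × E d, ((∫⁻ x, (b x : ℝ≥0∞)) * k (x + h.1)
          + ∫⁻ y, b (y - (x + h.1)) * k y) ∂(α.prod α) := by simp only [e]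
    _ = α Set.univ * ((∫⁻ x, (b x : ℝ≥0∞)) * smear α k x)
          + α Set.univ * ∫⁻ h, ∫⁻ y, b (y - (x + h)) * k y ∂volume ∂α := by
        have hk2 : Measurable fun h : E d × E d => (∫⁻ x, (b x : ℝ≥0∞)) * k (x + h.1) :=
          (hk1.comp measurable_fst).const_mul _
        rw [lintegral_add_left hk2,
          lintegral_prod_fst' (f := fun h => (∫⁻ x, (b x : ℝ≥0∞)) * k (x + h)) (hk1.const_mul _),
          lintegral_const_mul _ hk1,
          lintegral_prod_fst' (f := fun h => ∫⁻ y, b (y - (x + h)) * k y)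
            hbk.lintegral_prod_right']
        rfl
    _ ≤ α Set.univ * ((∫⁻ x, (b x : ℝ≥0∞)) * s) + α Set.univ * (s * ∫⁻ x, k x) := by
        gcongr
        · exact hsk x
        · rw [lintegral_lintegral_swap (f := fun h y => (b (y - (x + h)) : ℝ≥0∞) * k y)
            hbk.aemeasurable, ← lintegral_const_mul _ hk]
          refine lintegral_mono fun y => ?_
          have hbm : Measurable fun h => (b (y - (x + h)) : ℝ≥0∞) :=
            (hb.comp (f := fun h : E d => y - (x + h)) (by fun_prop)).coe_nnreal_ennreal
          rw [lintegral_mul_const _ hbm]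
          gcongr
          refine le_trans (le_of_eq ?_) (hsb (x - y))
          refine lintegral_congr fun h => ?_
          rw [← hbe]; congr 2; abel
    _ = _ := by ring

/-! #### Bounds for the mixed terms -/

/-- The majorant of the terms in which both a point before and a point after the jump, or both
points after the jump, are in the support of the test function. -/
def majMixed (k : E d → ℝ≥0∞) (x y : E d × E d) : ℝ≥0∞ := sum2 k x * sum2 k y + k y.1 * k y.2

lemma measurable_majMixed (hk : Measurable k) : Measurable (Function.uncurry (majMixed k)) :=
  (((measurable_sum2 hk).comp measurable_fst).mul ((measurable_sum2 hk).comp measurable_snd)).add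
    ((hk.comp measurable_snd.fst).mul (hk.comp measurable_snd.snd))

/-- Each mixed term has a factor that forces a jump into the support of `φ` and is at most of order
`s` after integrating that jump, and a second localising factor that keeps the integral finite. The
constant is `5 = 2·2 + 1`, from the two summands of `majMixed`. -/
lemma lintegral_jumpPre_majMixed_le (hb : Measurable b) (hbe : ∀ x, b (-x) = b x)
    (hk : Measurable k) {s : ℝ≥0∞} (hsk : ∀ x, smear α k x ≤ s) :
    ∫⁻ x, jumpPre (α.prod α) b (majMixed k) x
      ≤ s * (5 * α Set.univ * (∫⁻ x, b x) * ∫⁻ x, k x) := by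
  have hm1 : Measurable fun x => (pairRate b x : ℝ≥0∞) * sum2 k x :=
    (measurable_pairRate hb).coe_nnreal_ennreal.mul (measurable_sum2 hk)
  have hm2 : Measurable fun x : E d × E d => (pairRate b x : ℝ≥0∞) * smear α k x.1 :=
    (measurable_pairRate hb).coe_nnreal_ennreal.mul ((measurable_smear hk).comp measurable_fst)
  have hle : ∀ x, jumpPre (α.prod α) b (majMixed k) x
      ≤ 2 * α Set.univ * s * (pairRate b x * sum2 k x) + s * (pairRate b x * smear α k x.1) := by
    intro x
    have hmx : Measurable fun h => sum2 k (x + h) := (measurable_sum2 hk).comp (by fun_prop)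
    rw [jumpPre_eq (measurable_majMixed hk)]
    simp only [majMixed, Prod.fst_add, Prod.snd_add]
    rw [lintegral_add_left (hmx.const_mul _), lintegral_const_mul _ hmx, lintegral_mul_shift hk]
    calc _ ≤ pairRate b x * (sum2 k x * (2 * α Set.univ * s) + smear α k x.1 * s) := by
          gcongr
          · exact lintegral_majBirth_le hk hsk x
          · exact hsk _
      _ = _ := by ring
  refine (lintegral_mono hle).trans_eq ?_
  rw [lintegral_add_left (hm1.const_mul _), lintegral_const_mul _ hm1, lintegral_const_mul _ hm2,
    lintegral_pairRate_sum2 hb hbe hk, lintegral_pairRate_fst hb (measurable_smear hk),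
    lintegral_smear hk]
  ring

/-! #### The smeared rate -/

/-- The rate after the jump, integrated over the jumps. -/
def smearRate (α : Measure (E d)) (b : E d → ℝ≥0) (x : E d × E d) : ℝ≥0∞ :=
  ∫⁻ h, pairRate b (x + h) ∂(α.prod α)

lemma measurable_smearRate (hb : Measurable b) : Measurable (smearRate α b) :=
  Measurable.lintegral_prod_right' (f := fun p : (E d × E d) × (E d × E d) =>
    (pairRate b (p.1 + p.2) : ℝ≥0∞))
    ((measurable_pairRate hb).comp (measurable_fst.add measurable_snd)).coe_nnreal_ennreal

/-- For fixed `h₁` the integral over `h₂` alone already smears the rate; the integral over `h₁` then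
costs the mass of `α`. -/
lemma smearRate_le (hb : Measurable b) {s : ℝ≥0∞} (hsb : ∀ x, smear α (fun y => b y) x ≤ s)
    (x : E d × E d) : smearRate α b x ≤ α Set.univ * s := by
  have hm : Measurable fun h : E d × E d => (pairRate b (x + h) : ℝ≥0∞) :=
    ((measurable_pairRate hb).comp (f := fun h : E d × E d => x + h)
      (by fun_prop)).coe_nnreal_ennreal
  rw [smearRate, lintegral_prod _ hm.aemeasurable]
  refine (lintegral_mono fun h => ?_).trans_eq (by rw [lintegral_const, mul_comm])
  refine le_trans (le_of_eq ?_) (hsb (x.2 - (x.1 + h)))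
  refine lintegral_congr fun h' => ?_
  simp only [pairRate, Prod.fst_add, Prod.snd_add]
  congr 2; abel

lemma lintegral_smearRate_right (hb : Measurable b) (x : E d) :
    ∫⁻ y, smearRate α b (x, y) = α Set.univ ^ 2 * ∫⁻ x, b x := by
  have hm : Measurable fun p : E d × (E d × E d) => (pairRate b ((x, p.1) + p.2) : ℝ≥0∞) :=
    ((measurable_pairRate hb).comp (f := fun p : E d × (E d × E d) => (x, p.1) + p.2)
      (by fun_prop)).coe_nnreal_ennreal
  simp only [smearRate]
  rw [lintegral_lintegral_swap (f := fun y h => (pairRate b ((x, y) + h) : ℝ≥0∞)) hm.aemeasurable]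
  simp only [lintegral_pairRate_right_shift]
  rw [lintegral_const, prod_univ_eq, mul_comm]

lemma smearRate_swap (hbe : ∀ x, b (-x) = b x) (x : E d × E d) :
    smearRate α b x.swap = smearRate α b x := by
  have h := jumpPost_swap (μ := α.prod α) (v := fun _ _ => 1) Measure.prod_swap hbe
    (fun _ _ => rfl) x
  simpa [jumpPost, smearRate] using h

end

end
end BinaryJumps

namespace BinaryJumps

noncomputable section

variable {d : ℕ}

/-! ### The scaled jump measure -/

/-- The measure `εᵈ a(εh) dh`. -/
def scaledMeasure (a : E d → ℝ≥0∞) (ε : ℝ) : Measure (E d) :=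
  volume.withDensity fun h => ENNReal.ofReal ε ^ d * a (ε • h)

section

variable {a : E d → ℝ≥0∞} {ε : ℝ}

lemma lintegral_comp_smul (hε : 0 < ε) {f : E d → ℝ≥0∞} (hf : Measurable f) :
    ∫⁻ h, ENNReal.ofReal ε ^ d * f (ε • h) = ∫⁻ h, f h := by
  have hm : Measurable fun h : E d => f (ε • h) := hf.comp (measurable_const_smul ε)
  have h1 : ∫⁻ h, f (ε • h) = ∫⁻ h, f h ∂(Measure.map (ε • ·) (volume : Measure (E d))) :=
    (lintegral_map hf (measurable_const_smul ε)).symm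
  rw [lintegral_const_mul _ hm, h1, Measure.map_addHaar_smul _ hε.ne', lintegral_smul_measure,
    finrank_euclideanSpace_fin, smul_eq_mul, ← mul_assoc,
    abs_of_pos (by positivity), ENNReal.ofReal_inv_of_pos (by positivity),
    ENNReal.ofReal_pow hε.le, ENNReal.mul_inv_cancel, one_mul]
  · exact pow_ne_zero _ (ENNReal.ofReal_pos.2 hε).ne'
  · exact ENNReal.pow_ne_top ENNReal.ofReal_ne_top

lemma measurable_scaledDensity (ha : Measurable a) (ε : ℝ) :
    Measurable fun h : E d => ENNReal.ofReal ε ^ d * a (ε • h) :=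
  (ha.comp (measurable_const_smul ε)).const_mul _

lemma scaledMeasure_univ (ha : Measurable a) (hε : 0 < ε) :
    scaledMeasure a ε Set.univ = ∫⁻ x, a x := by
  rw [scaledMeasure, withDensity_apply _ MeasurableSet.univ, Measure.restrict_univ,
    lintegral_comp_smul hε ha]

lemma isFiniteMeasure_scaledMeasure (ha : Measurable a) (hε : 0 < ε) (hfin : ∫⁻ x, a x ≠ ∞) :
    IsFiniteMeasure (scaledMeasure a ε) := ⟨by rw [scaledMeasure_univ ha hε]; exact hfin.lt_top⟩

lemma scaledMeasure_absolutelyContinuous (a : E d → ℝ≥0∞) (ε : ℝ) :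
    scaledMeasure a ε ≪ volume := withDensity_absolutelyContinuous _ _

lemma map_neg_scaledMeasure (ha : Measurable a) (hae : ∀ x, a (-x) = a x) (ε : ℝ) :
    (scaledMeasure a ε).map Neg.neg = scaledMeasure a ε := by
  ext s hs
  have hm := measurable_scaledDensity ha ε
  rw [Measure.map_apply measurable_neg hs, scaledMeasure, withDensity_apply _ (measurable_neg hs),
    withDensity_apply _ hs, ← lintegral_indicator (measurable_neg hs), ← lintegral_indicator hs,
    ← lintegral_neg_eq_self]
  congr 1; ext x
  have e : -x ∈ Neg.neg ⁻¹' s ↔ x ∈ s := by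
    show - -x ∈ s ↔ _
    rw [neg_neg]
  by_cases hx : x ∈ s
  · rw [Set.indicator_of_mem (e.2 hx), Set.indicator_of_mem hx, smul_neg, hae]
  · rw [Set.indicator_of_notMem (fun h => hx (e.1 h)), Set.indicator_of_notMem hx]

lemma map_neg_prod {α : Measure (E d)} [SFinite α] (hα : α.map Neg.neg = α) :
    (α.prod α).map Neg.neg = α.prod α := by
  conv_rhs => rw [← hα, Measure.map_prod_map _ _ measurable_neg measurable_neg]
  rfl

/-- A smeared integrable bounded function tends to zero uniformly. -/
lemma tendsto_iSup_smear (hd : d ≠ 0) (ha : Measurable a) (hfin : ∫⁻ x, a x ≠ ∞)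
    {g : E d → ℝ≥0∞} (hg : Measurable g) (hgi : ∫⁻ x, g x ≠ ∞) {M : ℝ≥0∞} (hM : M ≠ ∞)
    (hgM : ∀ x, g x ≤ M) :
    Tendsto (fun ε => ⨆ x, smear (scaledMeasure a ε) g x) (𝓝[>] 0) (𝓝 0) := by
  -- Truncate `a` at height `n`. The bounded part of `α` has density at most `n εᵈ` and contributes
  -- at most `n εᵈ ∫ g`; the rest has mass `∫ (a - n)⁺`, independent of `ε` by scaling, and is
  -- integrated against `g ≤ M`.
  have h1 : ∀ n : ℕ, ∀ ε : ℝ, 0 < ε → ⨆ x, smear (scaledMeasure a ε) g x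
      ≤ n * (∫⁻ x, g x) * ENNReal.ofReal ε ^ d + M * ∫⁻ x, (a x - n) := by
    intro n ε hε
    refine iSup_le fun x => ?_
    have hgx : Measurable fun h => g (x + h) := hg.comp (by fun_prop)
    have ham : Measurable fun h => a h - n := ha.sub measurable_const
    have ham' := measurable_scaledDensity ham ε
    rw [smear, scaledMeasure,
      lintegral_withDensity_eq_lintegral_mul _ (measurable_scaledDensity ha ε) hgx]
    calc ∫⁻ h, ENNReal.ofReal ε ^ d * a (ε • h) * g (x + h)
        ≤ ∫⁻ h, (n * ENNReal.ofReal ε ^ d * g (x + h)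
            + M * (ENNReal.ofReal ε ^ d * (a (ε • h) - n))) := by
          refine lintegral_mono fun h => ?_
          calc _ ≤ ENNReal.ofReal ε ^ d * (n + (a (ε • h) - n)) * g (x + h) := by
                gcongr; exact le_add_tsub
            _ = n * ENNReal.ofReal ε ^ d * g (x + h)
                + g (x + h) * (ENNReal.ofReal ε ^ d * (a (ε • h) - n)) := by ring
            _ ≤ _ := by gcongr; exact hgM _
      _ = _ := by
          rw [lintegral_add_left (hgx.const_mul _), lintegral_const_mul _ hgx,
            lintegral_const_mul _ ham', lintegral_comp_smul hε ham, lintegral_add_left_eq_self]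
          ring
  have h2 : Tendsto (fun n : ℕ => M * ∫⁻ x, (a x - n)) atTop (𝓝 0) := by
    have h3 : Tendsto (fun n : ℕ => ∫⁻ x, (a x - n)) atTop (𝓝 (∫⁻ _ : E d, 0)) := by
      refine tendsto_lintegral_of_dominated_convergence a (fun n => ha.sub measurable_const)
        (fun n => ae_of_all _ fun x => tsub_le_self) hfin ?_
      filter_upwards [ae_lt_top ha hfin] with x hx
      obtain ⟨N, hN⟩ := ENNReal.exists_nat_gt hx.ne
      refine tendsto_const_nhds.congr' ?_
      filter_upwards [eventually_ge_atTop N] with n hn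
      exact (tsub_eq_zero_of_le (hN.le.trans (by exact_mod_cast hn))).symm
    rw [lintegral_zero] at h3
    simpa using ENNReal.Tendsto.const_mul h3 (Or.inr hM)
  rw [ENNReal.tendsto_nhds_zero]
  intro δ hδ
  have hδ2 : 0 < δ / 2 := ENNReal.half_pos hδ.ne'
  -- The truncation level is fixed first, uniformly in `ε`; only then is `ε` made small, where `d ≠
  -- 0` gives `εᵈ → 0`.
  obtain ⟨n, hn⟩ := (ENNReal.tendsto_nhds_zero.1 h2 _ hδ2).exists
  have h4 : Tendsto (fun ε : ℝ => n * (∫⁻ x, g x) * ENNReal.ofReal ε ^ d) (𝓝[>] 0) (𝓝 0) := by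
    have h5 : Tendsto (fun ε : ℝ => ENNReal.ofReal ε) (𝓝[>] 0) (𝓝 0) := by
      have := ENNReal.tendsto_ofReal (tendsto_id (α := ℝ) (x := 𝓝 0))
      rw [ENNReal.ofReal_zero] at this
      exact this.mono_left nhdsWithin_le_nhds
    have h6 := ENNReal.Tendsto.pow (n := d) h5
    rw [zero_pow hd] at h6
    have := ENNReal.Tendsto.const_mul (a := n * (∫⁻ x, g x)) h6
      (Or.inr (ENNReal.mul_ne_top (ENNReal.natCast_ne_top n) hgi))
    simpa using this
  filter_upwards [ENNReal.tendsto_nhds_zero.1 h4 _ hδ2, self_mem_nhdsWithin] with ε h5 hε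
  calc _ ≤ _ := h1 n ε hε
    _ ≤ δ / 2 + δ / 2 := add_le_add h5 hn
    _ = δ := ENNReal.add_halves δ

end

/-! ### The bounded version of the rate -/

/-- A bounded version of an essentially bounded function. -/
def boundedRate (b : E d → ℝ≥0∞) (x : E d) : ℝ≥0 := (min (b x) (essSup b volume)).toNNReal

section

variable {b : E d → ℝ≥0∞}

lemma measurable_boundedRate (hb : Measurable b) : Measurable (boundedRate b) :=
  (hb.min measurable_const).ennreal_toNNReal

lemma boundedRate_neg (hbe : ∀ x, b (-x) = b x) (x : E d) :
    boundedRate b (-x) = boundedRate b x := by rw [boundedRate, boundedRate, hbe]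

lemma boundedRate_le (hbb : essSup b volume ≠ ∞) (x : E d) :
    boundedRate b x ≤ (essSup b volume).toNNReal :=
  ENNReal.toNNReal_mono hbb (min_le_right _ _)

lemma coe_boundedRate_ae (hbb : essSup b volume ≠ ∞) :
    ∀ᵐ x, b x = boundedRate b x := by
  filter_upwards [ae_le_essSup (f := b) (μ := volume)] with x hx
  rw [boundedRate, min_eq_left hx, ENNReal.coe_toNNReal (ne_top_of_le_ne_top hbb hx)]

lemma lintegral_boundedRate (hbb : essSup b volume ≠ ∞) :
    ∫⁻ x, (boundedRate b x : ℝ≥0∞) = ∫⁻ x, b x :=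
  (lintegral_congr_ae (coe_boundedRate_ae hbb)).symm

end

/-! ### The scaled kernel -/

section

variable {a b : E d → ℝ≥0∞} {ε : ℝ}

lemma scaledKernel_eq (ha : Measurable a) (hb : Measurable b) (hε : 0 < ε)
    (hfin : ∫⁻ x, a x ≠ ∞) (x : E d × E d) :
    scaledKernel a b ε x.1 x.2 = ((scaledMeasure a ε).prod (scaledMeasure a ε)).withDensity
      fun h => b (x.2 - x.1) + b ((x + h).2 - (x + h).1) := by
  have hm := measurable_scaledDensity ha ε
  have := isFiniteMeasure_scaledMeasure ha hε hfin
  have h2 : Measurable fun h : E d × E d => b (x.2 - x.1) + b ((x + h).2 - (x + h).1) :=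
    measurable_const.add (hb.comp (f := fun h : E d × E d => (x + h).2 - (x + h).1) (by fun_prop))
  have h1 : Measurable fun h : E d × E d => ENNReal.ofReal ε ^ d * a (ε • h.1)
      * (ENNReal.ofReal ε ^ d * a (ε • h.2)) :=
    (hm.comp measurable_fst).mul (hm.comp measurable_snd)
  rw [scaledMeasure, prod_withDensity hm hm, ← Measure.volume_eq_prod, ← withDensity_mul _ h1 h2,
    scaledKernel]
  congr 1; ext h
  simp only [scaledRate, Pi.mul_apply, Prod.fst_add, Prod.snd_add]
  have e : x.2 - x.1 + h.2 - h.1 = x.2 + h.2 - (x.1 + h.1) := by abel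
  rw [e]; ring

/-- For fixed `h₁` the argument of `b` is a translate of `h₂`, so the null set where `b` differs
from its bounded version is avoided for almost every `h₂`. -/
lemma ae_coe_boundedRate_shift (hb : Measurable b) (hbb : essSup b volume ≠ ∞) (x : E d × E d) {α : Measure (E d)}
    [SFinite α] (hα : α ≪ volume) :
    ∀ᵐ h ∂(α.prod α), b ((x + h).2 - (x + h).1) = pairRate (boundedRate b) (x + h) := by
  have hm : MeasurableSet {h : E d × E d | b ((x + h).2 - (x + h).1) = pairRate (boundedRate b) (x + h)} :=
    measurableSet_eq_fun (hb.comp (f := fun h : E d × E d => (x + h).2 - (x + h).1) (by fun_prop))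
      (((measurable_pairRate (measurable_boundedRate hb)).comp
        (f := fun h : E d × E d => x + h) (by fun_prop)).coe_nnreal_ennreal)
  rw [Measure.ae_prod_iff_ae_ae hm]
  refine ae_of_all _ fun h => hα.ae_le ?_
  have := (measurePreserving_add_right volume (x.2 - (x.1 + h))).quasiMeasurePreserving.ae
    (coe_boundedRate_ae hbb)
  filter_upwards [this] with y hy
  have e : y + (x.2 - (x.1 + h)) = (x + (h, y)).2 - (x + (h, y)).1 := by
    simp only [Prod.snd_add, Prod.fst_add]; abel
  rw [e] at hy
  exact hy

/-- Almost surely the jumps land at distinct points outside of the configuration. -/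
lemma ae_jump_disjoint [Nonempty (Fin d)] (γ : Config d) (x : E d × E d) {α : Measure (E d)}
    [SFinite α] (hα : α ≪ volume) :
    ∀ᵐ h ∂(α.prod α), x.1 + h.1 ∉ γ.1 ∧ x.2 + h.2 ∉ γ.1 ∧ x.1 + h.1 ≠ x.2 + h.2 := by
  have hc : ∀ (S : Set (E d)) (y : E d), S.Countable → ∀ᵐ h ∂α, y + h ∉ S := by
    intro S y hS
    refine hα.ae_le ?_
    exact (measurePreserving_add_left volume y).quasiMeasurePreserving.ae (hS.ae_notMem volume)
  refine Filter.Eventually.and ?_ (Filter.Eventually.and ?_ ?_)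
  · exact Measure.quasiMeasurePreserving_fst.ae (hc _ x.1 γ.countable)
  · exact Measure.quasiMeasurePreserving_snd.ae (hc _ x.2 γ.countable)
  · have hm : MeasurableSet {h : E d × E d | x.1 + h.1 ≠ x.2 + h.2} :=
      (measurableSet_eq_fun (by fun_prop) (by fun_prop)).compl
    rw [Measure.ae_prod_iff_ae_ae hm]
    refine ae_of_all _ fun h => ?_
    filter_upwards [hc {x.1 + h} x.2 (Set.countable_singleton _)] with y hy
    exact fun h => hy h.symm

end

end
end BinaryJumps

namespace BinaryJumps

noncomputable section

variable {d : ℕ}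

open Config

/-! ### Exponential increments -/

/-- The indicator of the support of `φ`. -/
def suppInd (φ : E d → ℝ) (x : E d) : ℝ≥0∞ := open Classical in if φ x = 0 then 0 else 1

/-- `φ(x₁) + φ(x₂)`. -/
def pairVal (φ : E d → ℝ) (x : E d × E d) : ℝ := φ x.1 + φ x.2

section

variable {φ : E d → ℝ}

lemma measurable_suppInd (hφ : Continuous φ) : Measurable (suppInd φ) := by
  classical
  exact Measurable.ite (measurableSet_eq_fun hφ.measurable measurable_const) measurable_const
    measurable_const

lemma suppInd_le_one (φ : E d → ℝ) (x : E d) : suppInd φ x ≤ 1 := by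
  rw [suppInd]; split_ifs <;> simp

lemma lintegral_suppInd_ne_top (hs : HasCompactSupport φ) :
    ∫⁻ x, suppInd φ x ≠ ∞ := by
  have h : ∫⁻ x, suppInd φ x ≤ ∫⁻ x, (tsupport φ).indicator 1 x := by
    refine lintegral_mono fun x => ?_
    rw [suppInd]
    split_ifs with h
    · exact zero_le
    · rw [Set.indicator_of_mem (subset_tsupport φ h)]; rfl
  refine ne_top_of_le_ne_top ?_ h
  rw [lintegral_indicator_one (isClosed_tsupport φ).measurableSet]
  exact hs.measure_lt_top.ne

/-- The value `e^t - 1` lies between `-1` and `e^T - 1` and vanishes at `t = 0`. Any `K` that is at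
least `1` off zero can therefore record the localisation to the support of `φ`. -/
lemma enorm_exp_sub_one_le {t T : ℝ} (hT : |t| ≤ T) {K : ℝ≥0∞} (hK : t ≠ 0 → 1 ≤ K) :
    ‖Real.exp t - 1‖ₑ ≤ ENNReal.ofReal (Real.exp T) * K := by
  by_cases h : t = 0
  · simp [h]
  · refine le_trans ?_ (le_mul_of_one_le_right' (hK h))
    rw [Real.enorm_eq_ofReal_abs]
    refine ENNReal.ofReal_le_ofReal (abs_le.2 ⟨?_, ?_⟩)
    · have h1 := Real.exp_pos t
      have h2 := Real.one_le_exp (le_trans (abs_nonneg t) hT)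
      linarith
    · have := Real.exp_le_exp.2 (le_trans (le_abs_self t) hT)
      linarith

lemma one_le_suppInd {x : E d} (h : φ x ≠ 0) : 1 ≤ suppInd φ x := by simp [suppInd, h]

lemma one_le_sum2 {x : E d × E d} (h : pairVal φ x ≠ 0) : 1 ≤ sum2 (suppInd φ) x := by
  by_cases h1 : φ x.1 = 0
  · have h2 : φ x.2 ≠ 0 := fun h2 => h (by simp [pairVal, h1, h2])
    exact (one_le_suppInd h2).trans le_add_self
  · exact (one_le_suppInd h1).trans le_self_add

lemma one_le_majTotal {x y : E d × E d} (h : pairVal φ y - pairVal φ x ≠ 0) :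
    1 ≤ majTotal (suppInd φ) x y := by
  by_cases h1 : pairVal φ x = 0
  · have h2 : pairVal φ y ≠ 0 := fun h2 => h (by simp [h1, h2])
    exact (one_le_sum2 h2).trans le_add_self
  · exact (one_le_sum2 h1).trans le_self_add

variable {L : ℝ} (hL : ∀ x, |φ x| ≤ L)

include hL in
lemma abs_pairVal_le (x : E d × E d) : |pairVal φ x| ≤ 2 * L := by
  have := abs_add_le (φ x.1) (φ x.2)
  have h1 := hL x.1
  have h2 := hL x.2
  rw [pairVal]; linarith

include hL in
lemma abs_pairVal_sub_le (x y : E d × E d) : |pairVal φ y - pairVal φ x| ≤ 4 * L := by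
  have := abs_sub (pairVal φ y) (pairVal φ x)
  have h1 := abs_pairVal_le hL x
  have h2 := abs_pairVal_le hL y
  linarith

include hL in
lemma enorm_increment_le (x y : E d × E d) :
    ‖Real.exp (pairVal φ y - pairVal φ x) - 1‖ₑ
      ≤ ENNReal.ofReal (Real.exp (4 * L)) * majTotal (suppInd φ) x y :=
  enorm_exp_sub_one_le (abs_pairVal_sub_le hL x y) one_le_majTotal

end

/-! ### Signed sums over pairs -/

lemma summable_of_enorm_ne_top {ι : Type*} {f : ι → ℝ} (h : ∑' i, ‖f i‖ₑ ≠ ∞) : Summable f := by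
  rw [summable_iff_tsum_ofReal_abs]
  simpa only [Real.enorm_eq_ofReal_abs] using h

section

variable {μ : Measure (E d × E d)} {b : E d → ℝ≥0} {q : E d × E d → E d × E d → ℝ}
  {v : E d × E d → E d × E d → ℝ≥0∞}

/-- The signed integral over the jumps from `x`, weighted with the sum of the rates before and
after the jump. -/
def jumpInt (μ : Measure (E d × E d)) (b : E d → ℝ≥0) (q : E d × E d → E d × E d → ℝ)
    (x : E d × E d) : ℝ := ∫ h, ((pairRate b x + pairRate b (x + h) : ℝ≥0) : ℝ) * q x (x + h) ∂μ

/-- The majorant of `jumpInt` for an integrand bounded by `v`. -/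
def jumpAbs (μ : Measure (E d × E d)) (b : E d → ℝ≥0) (v : E d × E d → E d × E d → ℝ≥0∞)
    (x : E d × E d) : ℝ≥0∞ := jumpPre μ b v x + jumpPost μ b v x

lemma measurable_jumpAbs [SFinite μ] (hb : Measurable b) (hv : Measurable (Function.uncurry v)) :
    Measurable (jumpAbs μ b v) := (measurable_jumpPre hb hv).add (measurable_jumpPost hb hv)

lemma lintegral_enorm_jump_le (hb : Measurable b) (hv : Measurable (Function.uncurry v))
    {x : E d × E d} (hq : ∀ y, ‖q x y‖ₑ ≤ v x y) :
    ∫⁻ h, ‖((pairRate b x + pairRate b (x + h) : ℝ≥0) : ℝ) * q x (x + h)‖ₑ ∂μ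
      ≤ jumpAbs μ b v x := by
  have hm : Measurable fun h => (pairRate b x : ℝ≥0∞) * v x (x + h) :=
    (measurable_pre hb hv).comp measurable_prodMk_left
  rw [jumpAbs, jumpPre, jumpPost, ← lintegral_add_left hm]
  refine lintegral_mono fun h => ?_
  rw [enorm_mul, ← add_mul]
  gcongr
  · rw [Real.enorm_eq_ofReal (NNReal.coe_nonneg _), ENNReal.ofReal_coe_nnreal, ENNReal.coe_add]
  · exact hq _

lemma enorm_jumpInt_le (hb : Measurable b) (hv : Measurable (Function.uncurry v))
    {x : E d × E d} (hq : ∀ y, ‖q x y‖ₑ ≤ v x y) : ‖jumpInt μ b q x‖ₑ ≤ jumpAbs μ b v x :=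
  (enorm_integral_le_lintegral_enorm _).trans (lintegral_enorm_jump_le hb hv hq)

lemma measurable_jumpIntegrand (hb : Measurable b) (hq : Measurable (Function.uncurry q))
    (x : E d × E d) :
    Measurable fun h => ((pairRate b x + pairRate b (x + h) : ℝ≥0) : ℝ) * q x (x + h) :=
  (((measurable_const.add ((measurable_pairRate hb).comp (f := fun h : E d × E d => x + h)
    (by fun_prop)))).coe_nnreal_real).mul
    (hq.comp (f := fun h : E d × E d => (x, x + h)) (by fun_prop))

lemma integrable_jump (hb : Measurable b) (hv : Measurable (Function.uncurry v))
    (hqm : Measurable (Function.uncurry q)) {x : E d × E d} (hq : ∀ y, ‖q x y‖ₑ ≤ v x y)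
    (hfin : jumpAbs μ b v x ≠ ∞) :
    Integrable (fun h => ((pairRate b x + pairRate b (x + h) : ℝ≥0) : ℝ) * q x (x + h)) μ :=
  ⟨(measurable_jumpIntegrand hb hqm x).aestronglyMeasurable,
    (lintegral_enorm_jump_le hb hv hq).trans_lt hfin.lt_top⟩

end

/-! ### The generator on functions of one linear statistic -/

/-- The increment of `g(⟨φ, γ⟩)` under the jump from `x` to `y`, when `⟨φ, γ⟩ = t`. -/
def increment (g : ℝ → ℝ) (φ : E d → ℝ) (t : ℝ) (x y : E d × E d) : ℝ :=
  g (t + (pairVal φ y - pairVal φ x)) - g t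

section

variable {a b : E d → ℝ≥0∞} {ε : ℝ} {φ : E d → ℝ} {g : ℝ → ℝ} {L : ℝ}

lemma measurable_increment (hg : Continuous g) (hφ : Continuous φ) :
    Measurable fun p : ℝ × (E d × E d) × (E d × E d) => increment g φ p.1 p.2.1 p.2.2 := by
  have : Continuous fun p : ℝ × (E d × E d) × (E d × E d) => increment g φ p.1 p.2.1 p.2.2 := by
    unfold increment pairVal
    fun_prop
  exact this.measurable

/-- The condition on `g` holds for the exponential and for its truncations, so the approximants and
the limit share one majorant with the factor `e^t`, where `t = ⟨φ,γ⟩`. -/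
lemma enorm_increment_le_mul (hL : ∀ x, |φ x| ≤ L)
    (hge : ∀ s t, |g s - g t| ≤ |Real.exp s - Real.exp t|) (t : ℝ) (x y : E d × E d) :
    ‖increment g φ t x y‖ₑ ≤ ENNReal.ofReal (Real.exp t)
      * (ENNReal.ofReal (Real.exp (4 * L)) * majTotal (suppInd φ) x y) := by
  calc ‖increment g φ t x y‖ₑ
      ≤ ‖Real.exp t * (Real.exp (pairVal φ y - pairVal φ x) - 1)‖ₑ := by
        rw [Real.enorm_eq_ofReal_abs, Real.enorm_eq_ofReal_abs]
        refine ENNReal.ofReal_le_ofReal ((hge _ _).trans_eq ?_)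
        rw [Real.exp_add]; ring_nf
    _ ≤ _ := by
        rw [enorm_mul, Real.enorm_eq_ofReal (Real.exp_nonneg t)]
        gcongr
        exact enorm_increment_le hL x y

/-- All pairs of points of `γ` have their rate given by the bounded version. -/
def RegularPairs (b : E d → ℝ≥0∞) (γ : Config d) : Prop :=
  ∀ p ∈ γ.orderedPairs, b (p.2 - p.1) = boundedRate b (p.2 - p.1)

lemma jump_increment_ae [Nonempty (Fin d)] (hs : HasCompactSupport φ) {γ : Config d}
    {p : E d × E d} (hp : p ∈ γ.orderedPairs) {α : Measure (E d)} [SFinite α] (hα : α ≪ volume) :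
    ∀ᵐ h ∂(α.prod α), g (pair φ (γ.jump p.1 p.2 h.1 h.2)) - g (pair φ γ)
      = increment g φ (pair φ γ) p (p + h) := by
  filter_upwards [ae_jump_disjoint γ p hα] with h ⟨h1, h2, h3⟩
  rw [pair_jump γ hs hp.1 hp.2.1 hp.2.2 h1 h2 h3, increment, pairVal, pairVal]
  congr 2
  simp only [Prod.fst_add, Prod.snd_add]
  ring

lemma scaledKernel_eq_withDensity (ha : Measurable a) (hb : Measurable b) (hε : 0 < ε)
    (hfin : ∫⁻ x, a x ≠ ∞) (hbb : essSup b volume ≠ ∞) {γ : Config d} (hγ : RegularPairs b γ)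
    {p : E d × E d} (hp : p ∈ γ.orderedPairs) :
    scaledKernel a b ε p.1 p.2 = ((scaledMeasure a ε).prod (scaledMeasure a ε)).withDensity
      fun h => ((pairRate (boundedRate b) p + pairRate (boundedRate b) (p + h) : ℝ≥0) : ℝ≥0∞) := by
  have := isFiniteMeasure_scaledMeasure ha hε hfin
  rw [scaledKernel_eq ha hb hε hfin]
  refine withDensity_congr_ae ?_
  filter_upwards [ae_coe_boundedRate_shift hb hbb p (scaledMeasure_absolutelyContinuous a ε)]
    with h hh
  rw [hh, hγ p hp, ENNReal.coe_add]; rfl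

lemma measurable_rateSum (hb : Measurable b) (p : E d × E d) :
    Measurable fun h => pairRate (boundedRate b) p + pairRate (boundedRate b) (p + h) :=
  measurable_const.add ((measurable_pairRate (measurable_boundedRate hb)).comp
    (f := fun h : E d × E d => p + h) (by fun_prop))

/-- The jump integral of a function of `⟨φ, γ⟩`. -/
lemma integral_scaledKernel [Nonempty (Fin d)] (ha : Measurable a) (hb : Measurable b) (hε : 0 < ε)
    (hfin : ∫⁻ x, a x ≠ ∞) (hbb : essSup b volume ≠ ∞) (hs : HasCompactSupport φ) {γ : Config d}
    (hγ : RegularPairs b γ) {p : E d × E d} (hp : p ∈ γ.orderedPairs) :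
    ∫ h, (g (pair φ (γ.jump p.1 p.2 h.1 h.2)) - g (pair φ γ)) ∂(scaledKernel a b ε p.1 p.2)
      = jumpInt ((scaledMeasure a ε).prod (scaledMeasure a ε)) (boundedRate b)
        (increment g φ (pair φ γ)) p := by
  have := isFiniteMeasure_scaledMeasure ha hε hfin
  rw [scaledKernel_eq_withDensity ha hb hε hfin hbb hγ hp,
    integral_withDensity_eq_integral_smul (measurable_rateSum hb p), jumpInt]
  refine integral_congr_ae ?_
  filter_upwards [jump_increment_ae (g := g) hs hp (scaledMeasure_absolutelyContinuous a ε)]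
    with h hh
  rw [hh]; rfl

lemma integrable_scaledKernel [Nonempty (Fin d)] (ha : Measurable a) (hb : Measurable b) (hε : 0 < ε)
    (hfin : ∫⁻ x, a x ≠ ∞) (hbb : essSup b volume ≠ ∞) (hs : HasCompactSupport φ) {γ : Config d}
    (hγ : RegularPairs b γ) {p : E d × E d} (hp : p ∈ γ.orderedPairs)
    (hint : Integrable (fun h => ((pairRate (boundedRate b) p
      + pairRate (boundedRate b) (p + h) : ℝ≥0) : ℝ) * increment g φ (pair φ γ) p (p + h))
      ((scaledMeasure a ε).prod (scaledMeasure a ε))) :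
    Integrable (fun h : E d × E d => g (pair φ (γ.jump p.1 p.2 h.1 h.2)) - g (pair φ γ))
      (scaledKernel a b ε p.1 p.2) := by
  have := isFiniteMeasure_scaledMeasure ha hε hfin
  rw [scaledKernel_eq_withDensity ha hb hε hfin hbb hγ hp,
    integrable_withDensity_iff_integrable_smul (measurable_rateSum hb p)]
  refine hint.congr ?_
  filter_upwards [jump_increment_ae (g := g) hs hp (scaledMeasure_absolutelyContinuous a ε)]
    with h hh
  rw [hh]; rfl

end

end
end BinaryJumps

namespace BinaryJumps

noncomputable section

variable {d : ℕ}

open Config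

/-! ### Square norms -/

lemma eLpNorm_two_sq {Ω ε : Type*} [MeasurableSpace Ω] [TopologicalSpace ε]
    [ESeminormedAddMonoid ε] (f : Ω → ε) (μ : Measure Ω) :
    eLpNorm f 2 μ ^ 2 = ∫⁻ x, ‖f x‖ₑ ^ 2 ∂μ := by
  rw [eLpNorm_eq_lintegral_rpow_enorm_toReal two_ne_zero ENNReal.ofNat_ne_top,
    ENNReal.toReal_ofNat, ← ENNReal.rpow_natCast, ← ENNReal.rpow_mul]
  norm_num

lemma eLpNorm_two_le_of_sq_le {Ω ε : Type*} [MeasurableSpace Ω] [TopologicalSpace ε]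
    [ESeminormedAddMonoid ε] {f : Ω → ε} {μ : Measure Ω} {D : ℝ≥0∞}
    (h : ∫⁻ x, ‖f x‖ₑ ^ 2 ∂μ ≤ D) : eLpNorm f 2 μ ≤ D ^ (1 / 2 : ℝ) := by
  rw [← eLpNorm_two_sq, ← ENNReal.rpow_natCast] at h
  have := ENNReal.rpow_le_rpow h (show (0 : ℝ) ≤ 1 / 2 by norm_num)
  rwa [← ENNReal.rpow_mul, Nat.cast_ofNat, mul_one_div_cancel two_ne_zero, ENNReal.rpow_one] at this

/-- Dominated convergence for the squares; pointwise the differences are eventually zero. -/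
lemma tendsto_eLpNorm_two_of_eventuallyEq {Ω : Type*} [MeasurableSpace Ω] {μ : Measure Ω}
    {f : ℕ → Ω → ℝ} {f₀ : Ω → ℝ} {H : Ω → ℝ≥0∞} (hf : ∀ n, AEStronglyMeasurable (f n) μ)
    (hf₀ : AEStronglyMeasurable f₀ μ) (hb : ∀ n, ∀ᵐ x ∂μ, ‖f n x - f₀ x‖ₑ ≤ H x)
    (hH : ∫⁻ x, H x ^ 2 ∂μ ≠ ∞) (he : ∀ᵐ x ∂μ, ∀ᶠ n in atTop, f n x = f₀ x) :
    Tendsto (fun n => eLpNorm (f n - f₀) 2 μ) atTop (𝓝 0) := by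
  have h1 : Tendsto (fun n => ∫⁻ x, ‖f n x - f₀ x‖ₑ ^ 2 ∂μ) atTop (𝓝 (∫⁻ _, 0 ∂μ)) := by
    refine tendsto_lintegral_of_dominated_convergence' (fun x => H x ^ 2)
      (fun n => ((hf n).sub hf₀).enorm.pow_const 2) (fun n => ?_) hH ?_
    · filter_upwards [hb n] with x hx
      gcongr
    · filter_upwards [he] with x hx
      refine tendsto_const_nhds.congr' ?_
      filter_upwards [hx] with n hn
      simp [hn]
  rw [lintegral_zero] at h1
  have h2 : Tendsto (fun n => (∫⁻ x, ‖f n x - f₀ x‖ₑ ^ 2 ∂μ) ^ (1 / 2 : ℝ)) atTop (𝓝 0) := by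
    have := (ENNReal.continuous_rpow_const (y := (1 / 2 : ℝ))).tendsto 0 |>.comp h1
    rwa [ENNReal.zero_rpow_of_pos (by norm_num)] at this
  exact tendsto_of_tendsto_of_tendsto_of_le_of_le tendsto_const_nhds h2 (fun n => zero_le)
    (fun n => eLpNorm_two_le_of_sq_le le_rfl)

/-! ### The tilted Poisson measure -/

/-- The Poisson measure with density `e^{2⟨φ, γ⟩}`. -/
def tilted (π : Measure (Config d)) (φ : E d → ℝ) : Measure (Config d) :=
  π.withDensity (expWeight 2 φ)

/-- The intensity measure of the tilted Poisson measure. -/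
def tiltedIntensity (d : ℕ) (z : ℝ≥0) (φ : E d → ℝ) : Measure (E d) :=
  (intensity d z).withDensity fun x => ENNReal.ofReal (Real.exp (2 * φ x))

section

variable {z : ℝ≥0} {π : Measure (Config d)} {φ : E d → ℝ} {L : ℝ}

lemma isFiniteMeasure_tilted (hπ : IsPoisson z π) (hφ : Continuous φ) (hs : HasCompactSupport φ) :
    IsFiniteMeasure (tilted π φ) :=
  isFiniteMeasure_withDensity (lintegral_expWeight_lt_top hπ 2 hφ hs).ne

lemma isMecke_tilted [Nonempty (Fin d)] (hπ : IsPoisson z π) (hφ : Continuous φ)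
    (hs : HasCompactSupport φ) : IsMecke (tilted π φ) (tiltedIntensity d z φ) :=
  hπ.isMecke.tilt 2 hφ hs

instance : SFinite (tiltedIntensity d z φ) := by rw [tiltedIntensity]; infer_instance

instance [Nonempty (Fin d)] : NullSingletonClass (tiltedIntensity d z φ) := by
  rw [tiltedIntensity]; infer_instance

lemma expWeight_one_sq (φ : E d → ℝ) (γ : Config d) : expWeight 1 φ γ ^ 2 = expWeight 2 φ γ := by
  rw [expWeight, expWeight, ← ENNReal.ofReal_pow (Real.exp_nonneg _), ← Real.exp_nat_mul]
  congr 2; push_cast; ring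

lemma lintegral_tilted (hφ : Continuous φ) (hs : HasCompactSupport φ) {H : Config d → ℝ≥0∞}
    (hH : Measurable H) :
    ∫⁻ γ, H γ ^ 2 ∂(tilted π φ) = ∫⁻ γ, (expWeight 1 φ γ * H γ) ^ 2 ∂π := by
  rw [tilted, lintegral_withDensity_eq_lintegral_mul _ (measurable_expWeight 2 hφ hs)
    (hH.pow_const 2)]
  refine lintegral_congr fun γ => ?_
  rw [Pi.mul_apply, mul_pow, expWeight_one_sq]

/-- The square of `e^{⟨φ,γ⟩}` is the density of the tilted measure. After this step only the factor
without the exponential has to be estimated. -/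
lemma eLpNorm_le_tilted (hφ : Continuous φ) (hs : HasCompactSupport φ) {f : Config d → ℝ}
    {H : Config d → ℝ≥0∞} (hH : Measurable H)
    (hf : ∀ᵐ γ ∂π, ‖f γ‖ₑ ≤ expWeight 1 φ γ * H γ) : eLpNorm f 2 π ≤ eLpNorm H 2 (tilted π φ) := by
  rw [← ENNReal.pow_le_pow_left_iff two_ne_zero, eLpNorm_two_sq, eLpNorm_two_sq]
  simp only [enorm_eq_self]
  rw [lintegral_tilted hφ hs hH]
  refine lintegral_mono_ae ?_
  filter_upwards [hf] with γ hγ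
  gcongr

/-- The density bound for the tilted intensity. -/
def tiltBound (z : ℝ≥0) (L : ℝ) : ℝ≥0∞ := z * ENNReal.ofReal (Real.exp (2 * L))

lemma tiltBound_ne_top (z : ℝ≥0) (L : ℝ) : tiltBound z L ≠ ∞ :=
  ENNReal.mul_ne_top ENNReal.coe_ne_top ENNReal.ofReal_ne_top

/-- A bounded `φ` makes the tilted intensity at most a multiple of Lebesgue measure, so all upper
bounds may be computed with translation invariance. -/
lemma tiltedIntensity_le (hL : ∀ x, |φ x| ≤ L) :
    tiltedIntensity d z φ ≤ tiltBound z L • volume := by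
  have h : tiltedIntensity d z φ
      ≤ (intensity d z).withDensity fun _ => ENNReal.ofReal (Real.exp (2 * L)) :=
    withDensity_mono (ae_of_all _ fun x => ENNReal.ofReal_le_ofReal (Real.exp_le_exp.2
      (by linarith [le_abs_self (φ x), hL x])))
  refine h.trans_eq ?_
  rw [withDensity_const, intensity, tiltBound, mul_comm (z : ℝ≥0∞), mul_smul]; rfl

lemma lintegral_tiltedIntensity_le (hL : ∀ x, |φ x| ≤ L) (f : E d → ℝ≥0∞) :
    ∫⁻ x, f x ∂(tiltedIntensity d z φ) ≤ tiltBound z L * ∫⁻ x, f x := by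
  refine (lintegral_mono' (tiltedIntensity_le hL) le_rfl).trans_eq ?_
  rw [lintegral_smul_measure, smul_eq_mul]

lemma lintegral_lintegral_tiltedIntensity_le (hL : ∀ x, |φ x| ≤ L) {K : E d × E d → ℝ≥0∞}
    (hK : Measurable K) :
    ∫⁻ x, ∫⁻ y, K (x, y) ∂(tiltedIntensity d z φ) ∂(tiltedIntensity d z φ)
      ≤ tiltBound z L ^ 2 * ∫⁻ x, K x := by
  calc ∫⁻ x, ∫⁻ y, K (x, y) ∂(tiltedIntensity d z φ) ∂(tiltedIntensity d z φ)
      ≤ ∫⁻ x, tiltBound z L * ∫⁻ y, K (x, y) ∂volume ∂(tiltedIntensity d z φ) :=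
        lintegral_mono fun x => lintegral_tiltedIntensity_le hL _
    _ ≤ tiltBound z L * ∫⁻ x, tiltBound z L * ∫⁻ y, K (x, y) :=
        lintegral_tiltedIntensity_le hL _
    _ = _ := by
        rw [lintegral_const_mul _ hK.lintegral_prod_right', Measure.volume_eq_prod,
          lintegral_prod _ hK.aemeasurable, sq, mul_assoc]

/-- The sum over the ordered pairs, as a function on the product. -/
abbrev sumPairs (K : E d × E d → ℝ≥0∞) (γ : Config d) : ℝ≥0∞ := S2 (Function.curry K) γ

lemma sumPairs_eq (K : E d × E d → ℝ≥0∞) (γ : Config d) :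
    sumPairs K γ = ∑' p : γ.orderedPairs, K p := rfl

lemma measurable_sumPairs {K : E d × E d → ℝ≥0∞} (hK : Measurable K) : Measurable (sumPairs K) :=
  measurable_S2 (by simpa using hK)

variable [Nonempty (Fin d)] {K : E d × E d → ℝ≥0∞} {R S : ℝ≥0∞}

/-- The general second moment bound in terms of Lebesgue integrals. Symmetry gives `K(x,y) + K(y,x)
= 2K(x,y)`, which explains the doubled `R` and `S`. -/
lemma lintegral_sumPairs_sq_le (hπ : IsPoisson z π) (hφ : Continuous φ)
    (hs : HasCompactSupport φ) (hL : ∀ x, |φ x| ≤ L) (hK : Measurable K)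
    (hsym : ∀ x, K x.swap = K x) (hR : ∀ x, ∫⁻ y, K (x, y) ≤ R) (hS : ∀ x, K x ≤ S) :
    ∫⁻ γ, sumPairs K γ ^ 2 ∂(tilted π φ) ≤ tilted π φ Set.univ *
      ((tiltBound z L ^ 2 * ∫⁻ x, K x) ^ 2
        + (tiltBound z L ^ 2 * ∫⁻ x, K x) * (2 * (2 * (tiltBound z L * R)) + 2 * S)) := by
  have := isFiniteMeasure_tilted hπ hφ hs
  refine ((isMecke_tilted hπ hφ hs).lintegral_S2_sq_le (K := Function.curry K)
    (R := 2 * (tiltBound z L * R)) (S := 2 * S) (by simpa using hK) (fun x => ?_)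
    (fun x y => ?_)).trans ?_
  · have e : ∀ y, Function.curry K x y + Function.curry K y x = 2 * K (x, y) := fun y => by
      rw [two_mul]; congr 1; exact hsym (x, y)
    simp only [e]
    have hm : Measurable fun y => K (x, y) := hK.comp measurable_prodMk_left
    rw [lintegral_const_mul _ hm]
    gcongr
    exact (lintegral_tiltedIntensity_le hL _).trans (by gcongr; exact hR x)
  · rw [two_mul]; exact add_le_add (hS _) (hS _)
  · have := lintegral_lintegral_tiltedIntensity_le (z := z) hL hK
    gcongr
    · exact this
    · exact this

lemma lintegral_sumPairs_dev_le (hπ : IsPoisson z π) (hφ : Continuous φ)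
    (hs : HasCompactSupport φ) (hL : ∀ x, |φ x| ≤ L) (hK : Measurable K)
    (hsym : ∀ x, K x.swap = K x) (hR : ∀ x, ∫⁻ y, K (x, y) ≤ R) (hS : ∀ x, K x ≤ S)
    (hT : ∫⁻ x, K x ≠ ∞) :
    ∫⁻ γ, ENNReal.ofReal (((sumPairs K γ).toReal - (∫⁻ x, ∫⁻ y, K (x, y)
      ∂(tiltedIntensity d z φ) ∂(tiltedIntensity d z φ)).toReal) ^ 2) ∂(tilted π φ)
      ≤ tilted π φ Set.univ *
        ((tiltBound z L ^ 2 * ∫⁻ x, K x) * (2 * (2 * (tiltBound z L * R)) + 2 * S)) := by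
  have := isFiniteMeasure_tilted hπ hφ hs
  have hT' := lintegral_lintegral_tiltedIntensity_le (z := z) hL hK
  have hfin : tiltBound z L ^ 2 * ∫⁻ x, K x ≠ ∞ :=
    ENNReal.mul_ne_top (ENNReal.pow_ne_top (tiltBound_ne_top z L)) hT
  refine ((isMecke_tilted hπ hφ hs).lintegral_S2_sub_sq_le (K := Function.curry K)
    (R := 2 * (tiltBound z L * R)) (S := 2 * S) (by simpa using hK) (fun x => ?_)
    (fun x y => ?_) (ne_top_of_le_ne_top hfin hT')).trans ?_
  · have e : ∀ y, Function.curry K x y + Function.curry K y x = 2 * K (x, y) := fun y => by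
      rw [two_mul]; congr 1; exact hsym (x, y)
    simp only [e]
    have hm : Measurable fun y => K (x, y) := hK.comp measurable_prodMk_left
    rw [lintegral_const_mul _ hm]
    gcongr
    exact (lintegral_tiltedIntensity_le hL _).trans (by gcongr; exact hR x)
  · rw [two_mul]; exact add_le_add (hS _) (hS _)
  · gcongr
    exact hT'

end

end
end BinaryJumps

namespace BinaryJumps

noncomputable section

variable {d : ℕ}

open Config

/-- The assumptions on the rates `a` and `b`. -/
structure Admissible (a b : E d → ℝ≥0∞) : Prop where
  meas_a : Measurable a
  meas_b : Measurable b
  even_a : ∀ x, a (-x) = a x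
  even_b : ∀ x, b (-x) = b x
  int_a : ∫⁻ x, a x ≠ ∞
  int_b : ∫⁻ x, b x ≠ ∞
  bdd_b : essSup b volume ≠ ∞

section

variable {z : ℝ≥0} {π : Measure (Config d)} {φ : E d → ℝ} {L : ℝ}

lemma expWeight_ne_zero (c : ℝ) (φ : E d → ℝ) (γ : Config d) : expWeight c φ γ ≠ 0 :=
  (ENNReal.ofReal_pos.2 (Real.exp_pos _)).ne'

/-- The density of the tilted measure is strictly positive, so finiteness almost everywhere carries
back to `π`. -/
lemma ae_ne_top_of_tilted (hφ : Continuous φ) (hs : HasCompactSupport φ)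
    {H : Config d → ℝ≥0∞} (hH : Measurable H) (hfin : ∫⁻ γ, H γ ^ 2 ∂(tilted π φ) ≠ ∞) :
    ∀ᵐ γ ∂π, H γ ≠ ∞ := by
  rw [lintegral_tilted hφ hs hH] at hfin
  filter_upwards [ae_lt_top (((measurable_expWeight 1 hφ hs).mul hH).pow_const 2) hfin] with γ hγ h
  rw [Pi.mul_apply, h, ENNReal.mul_top (expWeight_ne_zero 1 φ γ)] at hγ
  simp at hγ

/-- The expected number of pairs whose difference lies in the null set where `b` is altered is a
double integral over a null set, by the Mecke identity for pairs. -/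
lemma ae_regularPairs [Nonempty (Fin d)] (hπ : IsPoisson z π) {b : E d → ℝ≥0∞}
    (hb : Measurable b) (hbb : essSup b volume ≠ ∞) : ∀ᵐ γ ∂π, RegularPairs b γ := by
  classical
  have := hπ.isProbabilityMeasure
  let K : E d → E d → ℝ≥0∞ := fun x y => if b (y - x) = boundedRate b (y - x) then 0 else 1
  have hK : Measurable (Function.uncurry K) := by
    refine Measurable.ite (measurableSet_eq_fun (hb.comp (measurable_snd.sub measurable_fst))
      (((measurable_boundedRate hb).comp
        (measurable_snd.sub measurable_fst)).coe_nnreal_ennreal)) measurable_const measurable_const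
  have h0 : ∀ x, ∫⁻ y, K x y ∂(intensity d z) = 0 := by
    intro x
    have hx : Measurable (K x) := hK.of_uncurry_left
    rw [lintegral_eq_zero_iff hx]
    have hac : intensity d z ≪ volume := Measure.smul_absolutelyContinuous
    refine hac.ae_le ?_
    have := (measurePreserving_sub_right volume x).quasiMeasurePreserving.ae
      (coe_boundedRate_ae (b := b) hbb)
    filter_upwards [this] with y hy
    simp [K, hy]
  have h1 := hπ.isMecke.lintegral_S2 hK
  simp only [h0, lintegral_zero, mul_zero] at h1
  rw [lintegral_eq_zero_iff (measurable_S2 hK)] at h1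
  filter_upwards [h1] with γ hγ p hp
  have h2 := (ENNReal.tsum_eq_zero.1 hγ) ⟨p, hp⟩
  by_contra h3
  simp [K, h3] at h2

/-! ### The majorant of the jump generator -/

lemma lintegral_mul_const_mul {Ω : Type*} [MeasurableSpace Ω] (μ : Measure Ω) {r w : Ω → ℝ≥0∞}
    (h : Measurable fun x => r x * w x) (c : ℝ≥0∞) :
    ∫⁻ x, r x * (c * w x) ∂μ = c * ∫⁻ x, r x * w x ∂μ := by
  rw [← lintegral_const_mul _ h]
  exact lintegral_congr fun x => mul_left_comm _ _ _

lemma jumpAbs_const_mul {μ : Measure (E d × E d)} {b : E d → ℝ≥0} (hb : Measurable b)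
    {v : E d × E d → E d × E d → ℝ≥0∞} (hv : Measurable (Function.uncurry v)) (c : ℝ≥0∞)
    (x : E d × E d) : jumpAbs μ b (fun x y => c * v x y) x = c * jumpAbs μ b v x := by
  have h1 : Measurable fun h => (pairRate b x : ℝ≥0∞) * v x (x + h) :=
    (measurable_pre hb hv).comp measurable_prodMk_left
  have h2 : Measurable fun h => (pairRate b (x + h) : ℝ≥0∞) * v x (x + h) :=
    (measurable_post hb hv).comp (f := fun h : E d × E d => (x, h)) (by fun_prop)
  have e1 := lintegral_mul_const_mul μ h1 c
  have e2 := lintegral_mul_const_mul μ h2 c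
  exact (congrArg₂ (· + ·) e1 e2).trans (mul_add _ _ _).symm

lemma majTotal_le_four (φ : E d → ℝ) (x y : E d × E d) : majTotal (suppInd φ) x y ≤ 4 := by
  rw [majTotal, sum2, sum2]
  calc _ ≤ (1 + 1 + (1 + 1) : ℝ≥0∞) := by gcongr <;> exact suppInd_le_one _ _
    _ = 4 := by norm_num

/-- The majorant of the summands in the jump generator. -/
def jumpMajorant (a b : E d → ℝ≥0∞) (ε : ℝ) (φ : E d → ℝ) : E d × E d → ℝ≥0∞ :=
  jumpAbs ((scaledMeasure a ε).prod (scaledMeasure a ε)) (boundedRate b) (majTotal (suppInd φ))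

variable {a b : E d → ℝ≥0∞} {ε : ℝ}

lemma measurable_jumpMajorant (hab : Admissible a b) (hε : 0 < ε) (hφ : Continuous φ) :
    Measurable (jumpMajorant a b ε φ) := by
  have := isFiniteMeasure_scaledMeasure hab.meas_a hε hab.int_a
  exact measurable_jumpAbs (measurable_boundedRate hab.meas_b)
    (measurable_majTotal (measurable_suppInd hφ))

/-- Total integral, row integrals and supremum of the majorant are finite for every fixed `ε`,
without any smallness. Reversal of the jumps reduces the total of the part with the rate after the
jump to that with the rate before, the majorant being symmetric in start and end. -/
lemma lintegral_sumPairs_jumpMajorant_ne_top [Nonempty (Fin d)] (hπ : IsPoisson z π)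
    (hab : Admissible a b) (hε : 0 < ε) (hφ : Continuous φ) (hs : HasCompactSupport φ)
    (hL : ∀ x, |φ x| ≤ L) :
    ∫⁻ γ, sumPairs (jumpMajorant a b ε φ) γ ^ 2 ∂(tilted π φ) ≠ ∞ := by
  have hfin := isFiniteMeasure_scaledMeasure hab.meas_a hε hab.int_a
  have hfin' := isFiniteMeasure_tilted hπ hφ hs
  have hk := measurable_suppInd hφ
  have hbm := measurable_boundedRate hab.meas_b
  have hbe := boundedRate_neg hab.even_b
  have hvm := measurable_majTotal hk
  have hμ : ((scaledMeasure a ε).prod (scaledMeasure a ε)).map Neg.neg = _ :=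
    map_neg_prod (map_neg_scaledMeasure hab.meas_a hab.even_a ε)
  have hA : scaledMeasure a ε Set.univ ≠ ∞ := measure_ne_top _ _
  have hβ : ∫⁻ x, (boundedRate b x : ℝ≥0∞) ≠ ∞ := by
    rw [lintegral_boundedRate hab.bdd_b]; exact hab.int_b
  have hκ := lintegral_suppInd_ne_top hs
  have hvs : ∀ x y : E d × E d,
      majTotal (suppInd φ) x.swap y.swap = majTotal (suppInd φ) x y := fun x y => by
    simp only [majTotal, sum2_swap]
  have hR : ∀ x, ∫⁻ y, jumpMajorant a b ε φ (x, y)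
      ≤ 4 * scaledMeasure a ε Set.univ ^ 2 * (∫⁻ x, (boundedRate b x : ℝ≥0∞))
        + 4 * scaledMeasure a ε Set.univ ^ 2 * ∫⁻ x, (boundedRate b x : ℝ≥0∞) := by
    intro x
    have h1 : Measurable fun y => jumpPre ((scaledMeasure a ε).prod (scaledMeasure a ε))
        (boundedRate b) (majTotal (suppInd φ)) (x, y) :=
      (measurable_jumpPre hbm hvm).comp measurable_prodMk_left
    simp only [jumpMajorant, jumpAbs]
    rw [lintegral_add_left h1]
    exact add_le_add (lintegral_jumpPre_right_le hbm (majTotal_le_four φ) x)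
      (lintegral_jumpPost_right_le hbm (majTotal_le_four φ) x)
  have hS : ∀ x, jumpMajorant a b ε φ x
      ≤ (essSup b volume).toNNReal * 4 * scaledMeasure a ε Set.univ ^ 2
        + (essSup b volume).toNNReal * 4 * scaledMeasure a ε Set.univ ^ 2 := fun x =>
    add_le_add (jumpPre_le (boundedRate_le hab.bdd_b) (majTotal_le_four φ) x)
      (jumpPost_le (boundedRate_le hab.bdd_b) (majTotal_le_four φ) x)
  have hT : ∫⁻ x, jumpMajorant a b ε φ x ≠ ∞ := by
    have h1 : Measurable (jumpPre ((scaledMeasure a ε).prod (scaledMeasure a ε))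
        (boundedRate b) (majTotal (suppInd φ))) := measurable_jumpPre hbm hvm
    simp only [jumpMajorant, jumpAbs]
    have e : (fun x y : E d × E d => majTotal (suppInd φ) y x) = majTotal (suppInd φ) := by
      ext x y; exact add_comm _ _
    rw [lintegral_add_left h1, lintegral_jumpPost hμ hbm hvm, e,
      lintegral_jumpPre_majTotal hbm hbe hk]
    finiteness
  have hsym : ∀ x, jumpMajorant a b ε φ x.swap = jumpMajorant a b ε φ x := fun x => by
    simp only [jumpMajorant, jumpAbs]
    rw [jumpPre_swap Measure.prod_swap hbe hvs, jumpPost_swap Measure.prod_swap hbe hvs]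
  refine ne_top_of_le_ne_top ?_ (lintegral_sumPairs_sq_le hπ hφ hs hL
    (measurable_jumpMajorant hab hε hφ) hsym hR hS)
  have := tiltBound_ne_top z L
  finiteness

/-! ### The generator on functions of one linear statistic -/

section

variable {g : ℝ → ℝ}

lemma jumpMajorant_bound (hab : Admissible a b) (hε : 0 < ε) (hφ : Continuous φ) (L t : ℝ)
    (x : E d × E d) :
    jumpAbs ((scaledMeasure a ε).prod (scaledMeasure a ε)) (boundedRate b)
      (fun x y => ENNReal.ofReal (Real.exp t) * ENNReal.ofReal (Real.exp (4 * L))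
        * majTotal (suppInd φ) x y) x
      = ENNReal.ofReal (Real.exp t) * ENNReal.ofReal (Real.exp (4 * L))
        * jumpMajorant a b ε φ x := by
  have := isFiniteMeasure_scaledMeasure hab.meas_a hε hab.int_a
  exact jumpAbs_const_mul (measurable_boundedRate hab.meas_b)
    (measurable_majTotal (measurable_suppInd hφ)) _ _

lemma enorm_jumpInt_increment_le (hab : Admissible a b) (hε : 0 < ε) (hφ : Continuous φ)
    (hL : ∀ x, |φ x| ≤ L) (hge : ∀ s t, |g s - g t| ≤ |Real.exp s - Real.exp t|) (t : ℝ)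
    (x : E d × E d) :
    ‖jumpInt ((scaledMeasure a ε).prod (scaledMeasure a ε)) (boundedRate b)
      (increment g φ t) x‖ₑ ≤ ENNReal.ofReal (Real.exp t) * ENNReal.ofReal (Real.exp (4 * L))
        * jumpMajorant a b ε φ x := by
  rw [← jumpMajorant_bound hab hε hφ]
  refine enorm_jumpInt_le (measurable_boundedRate hab.meas_b)
    ((measurable_majTotal (measurable_suppInd hφ)).const_mul _) fun y => ?_
  rw [mul_assoc]
  exact enorm_increment_le_mul hL hge t x y

lemma tsum_enorm_jumpInt_le (hab : Admissible a b) (hε : 0 < ε) (hφ : Continuous φ)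
    (hL : ∀ x, |φ x| ≤ L) (hge : ∀ s t, |g s - g t| ≤ |Real.exp s - Real.exp t|) (t : ℝ)
    (γ : Config d) :
    ∑' p : γ.orderedPairs, ‖jumpInt ((scaledMeasure a ε).prod (scaledMeasure a ε)) (boundedRate b)
      (increment g φ t) p‖ₑ ≤ ENNReal.ofReal (Real.exp t) * ENNReal.ofReal (Real.exp (4 * L))
        * sumPairs (jumpMajorant a b ε φ) γ := by
  rw [sumPairs_eq, ← ENNReal.tsum_mul_left]
  exact ENNReal.tsum_le_tsum fun p => enorm_jumpInt_increment_le hab hε hφ hL hge t p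

lemma jumpGen_eq [Nonempty (Fin d)] (hab : Admissible a b) (hε : 0 < ε) (hs : HasCompactSupport φ) {γ : Config d}
    (hγ : RegularPairs b γ) :
    jumpGen (scaledKernel a b ε) (fun γ => g (pair φ γ)) γ
      = 1 / 2 * ∑' p : γ.orderedPairs,
        jumpInt ((scaledMeasure a ε).prod (scaledMeasure a ε)) (boundedRate b)
          (increment g φ (pair φ γ)) p := by
  rw [jumpGen, pairSum]
  congr 1
  exact tsum_congr fun p => integral_scaledKernel hab.meas_a hab.meas_b hε hab.int_a hab.bdd_b hs
    hγ p.2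

lemma jumpGenConverges [Nonempty (Fin d)] (hab : Admissible a b) (hε : 0 < ε) (hφ : Continuous φ)
    (hs : HasCompactSupport φ) (hL : ∀ x, |φ x| ≤ L) (hg : Continuous g)
    (hge : ∀ s t, |g s - g t| ≤ |Real.exp s - Real.exp t|) {γ : Config d} (hγ : RegularPairs b γ)
    (hfin : sumPairs (jumpMajorant a b ε φ) γ ≠ ∞) :
    JumpGenConverges (scaledKernel a b ε) (fun γ => g (pair φ γ)) γ := by
  have hc : ENNReal.ofReal (Real.exp (pair φ γ)) * ENNReal.ofReal (Real.exp (4 * L)) ≠ ∞ := by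
    finiteness
  constructor
  · intro p hp
    refine integrable_scaledKernel hab.meas_a hab.meas_b hε hab.int_a hab.bdd_b hs hγ hp ?_
    refine integrable_jump (v := fun x y => ENNReal.ofReal (Real.exp (pair φ γ))
      * ENNReal.ofReal (Real.exp (4 * L)) * majTotal (suppInd φ) x y)
      (measurable_boundedRate hab.meas_b)
      ((measurable_majTotal (measurable_suppInd hφ)).const_mul _)
      (q := increment g φ (pair φ γ)) ((measurable_increment hg hφ).comp measurable_prodMk_left)
      (fun y => ?_) ?_
    · rw [mul_assoc]; exact enorm_increment_le_mul hL hge _ p y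
    · rw [jumpMajorant_bound hab hε hφ]
      exact ENNReal.mul_ne_top hc (ENNReal.ne_top_of_tsum_ne_top hfin ⟨p, hp⟩)
  · have h := tsum_enorm_jumpInt_le hab hε hφ hL hge (pair φ γ) γ
    refine (summable_of_enorm_ne_top
      (ne_top_of_le_ne_top (ENNReal.mul_ne_top hc hfin) h)).congr fun p => ?_
    exact (integral_scaledKernel hab.meas_a hab.meas_b hε hab.int_a hab.bdd_b hs hγ p.2).symm

lemma enorm_jumpGen_le [Nonempty (Fin d)] (hab : Admissible a b) (hε : 0 < ε) (hφ : Continuous φ)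
    (hs : HasCompactSupport φ) (hL : ∀ x, |φ x| ≤ L)
    (hge : ∀ s t, |g s - g t| ≤ |Real.exp s - Real.exp t|) {γ : Config d}
    (hγ : RegularPairs b γ) :
    ‖jumpGen (scaledKernel a b ε) (fun γ => g (pair φ γ)) γ‖ₑ
      ≤ expWeight 1 φ γ * (ENNReal.ofReal (Real.exp (4 * L))
        * sumPairs (jumpMajorant a b ε φ) γ) := by
  rw [jumpGen_eq hab hε hs hγ, enorm_mul]
  calc _ ≤ 1 * ∑' p : γ.orderedPairs,
        ‖jumpInt ((scaledMeasure a ε).prod (scaledMeasure a ε)) (boundedRate b)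
          (increment g φ (pair φ γ)) p‖ₑ := by
        gcongr
        · rw [Real.enorm_eq_ofReal (by norm_num)]
          exact ENNReal.ofReal_le_one.2 (by norm_num)
        · exact enorm_tsum_le_tsum_enorm
    _ ≤ _ := by
        rw [one_mul, expWeight, one_mul, ← mul_assoc]
        exact tsum_enorm_jumpInt_le hab hε hφ hL hge _ γ

lemma measurable_jumpInt_increment (hab : Admissible a b) (hε : 0 < ε) (hφ : Continuous φ)
    (hg : Continuous g) :
    Measurable fun p : ℝ × (E d × E d) =>
      jumpInt ((scaledMeasure a ε).prod (scaledMeasure a ε)) (boundedRate b)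
        (increment g φ p.1) p.2 := by
  have := isFiniteMeasure_scaledMeasure hab.meas_a hε hab.int_a
  have hr := measurable_pairRate (measurable_boundedRate hab.meas_b)
  have h1 : Measurable fun q : (ℝ × (E d × E d)) × (E d × E d) =>
      ((pairRate (boundedRate b) q.1.2 + pairRate (boundedRate b) (q.1.2 + q.2) : ℝ≥0) : ℝ) :=
    ((hr.comp (f := fun q : (ℝ × (E d × E d)) × (E d × E d) => q.1.2) (by fun_prop)).add
      (hr.comp (f := fun q : (ℝ × (E d × E d)) × (E d × E d) => q.1.2 + q.2)
        (by fun_prop))).coe_nnreal_real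
  have h2 : Measurable fun q : (ℝ × (E d × E d)) × (E d × E d) =>
      increment g φ q.1.1 q.1.2 (q.1.2 + q.2) :=
    (measurable_increment hg hφ).comp
      (f := fun q : (ℝ × (E d × E d)) × (E d × E d) => (q.1.1, q.1.2, q.1.2 + q.2)) (by fun_prop)
  exact (StronglyMeasurable.integral_prod_right' (h1.mul h2).stronglyMeasurable).measurable

/-- The index set varies with `γ`, so the signed sum is written as the difference of the sums of
positive and negative parts, which are kernel integrals. The formula needs summability, hence
measurability only up to null sets. -/
lemma aestronglyMeasurable_tsum {P : Measure (Config d)} {f : Config d → E d × E d → ℝ}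
    (hf : Measurable (Function.uncurry f))
    (hs : ∀ᵐ γ ∂P, Summable fun p : γ.orderedPairs => f γ p) :
    AEStronglyMeasurable (fun γ : Config d => ∑' p : γ.orderedPairs, f γ p) P := by
  have hm : ∀ {f' : Config d → E d × E d → ℝ≥0∞}, Measurable (Function.uncurry f') →
      Measurable fun γ : Config d => ∑' p : γ.orderedPairs, f' γ p := fun {f'} hf' =>
    measurable_tsum_orderedPairs (T := fun γ => γ) measurable_id
      (G := fun γ x y => f' γ (x, y)) hf'
  have h1 := hm (f' := fun γ p => ENNReal.ofReal (f γ p)) hf.ennreal_ofReal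
  have h2 := hm (f' := fun γ p => ENNReal.ofReal (-f γ p)) hf.neg.ennreal_ofReal
  refine (h1.ennreal_toReal.sub h2.ennreal_toReal).aestronglyMeasurable.congr ?_
  filter_upwards [hs] with γ hγ
  exact (tsum_eq_toReal_sub hγ).symm

lemma aestronglyMeasurable_jumpGen [Nonempty (Fin d)] (hπ : IsPoisson z π) (hab : Admissible a b) (hε : 0 < ε)
    (hφ : Continuous φ) (hs : HasCompactSupport φ) (hL : ∀ x, |φ x| ≤ L) (hg : Continuous g)
    (hge : ∀ s t, |g s - g t| ≤ |Real.exp s - Real.exp t|) :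
    AEStronglyMeasurable (jumpGen (scaledKernel a b ε) (fun γ => g (pair φ γ))) π := by
  have hfin := ae_ne_top_of_tilted hφ hs
    (measurable_sumPairs (measurable_jumpMajorant hab hε hφ))
    (lintegral_sumPairs_jumpMajorant_ne_top hπ hab hε hφ hs hL)
  have hm : Measurable fun p : Config d × (E d × E d) =>
      jumpInt ((scaledMeasure a ε).prod (scaledMeasure a ε)) (boundedRate b)
        (increment g φ (pair φ p.1)) p.2 :=
    (measurable_jumpInt_increment hab hε hφ hg).comp
      (f := fun p : Config d × (E d × E d) => (pair φ p.1, p.2))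
      (((measurable_pair hφ hs).comp measurable_fst).prodMk measurable_snd)
  refine ((aestronglyMeasurable_tsum (P := π) (f := fun γ p =>
      jumpInt ((scaledMeasure a ε).prod (scaledMeasure a ε)) (boundedRate b)
        (increment g φ (pair φ γ)) p) hm ?_).const_mul (1 / 2)).congr ?_
  · filter_upwards [hfin] with γ hγ
    refine summable_of_enorm_ne_top (ne_top_of_le_ne_top (ENNReal.mul_ne_top ?_ hγ)
      (tsum_enorm_jumpInt_le hab hε hφ hL hge (pair φ γ) γ))
    finiteness
  · filter_upwards [ae_regularPairs hπ hab.meas_b hab.bdd_b] with γ hγ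
    exact (jumpGen_eq hab hε hs hγ).symm

end

end

end
end BinaryJumps

namespace BinaryJumps

noncomputable section

variable {d : ℕ}

open Config

/-! ### The exponential function in the domain of the closed generator -/

section

variable {z : ℝ≥0} {π : Measure (Config d)} {φ : E d → ℝ} {L : ℝ} {a b : E d → ℝ≥0∞} {ε : ℝ}

lemma memLp_of_tilted (hφ : Continuous φ) (hs : HasCompactSupport φ) {f : Config d → ℝ}
    (hfm : AEStronglyMeasurable f π) {H : Config d → ℝ≥0∞} (hH : Measurable H)
    (hf : ∀ᵐ γ ∂π, ‖f γ‖ₑ ≤ expWeight 1 φ γ * H γ) (hfin : ∫⁻ γ, H γ ^ 2 ∂(tilted π φ) ≠ ∞) :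
    MemLp f 2 π := by
  refine ⟨hfm, (eLpNorm_le_tilted hφ hs hH hf).trans_lt ?_⟩
  refine (eLpNorm_two_le_of_sq_le (D := ∫⁻ γ, H γ ^ 2 ∂(tilted π φ)) le_rfl).trans_lt ?_
  exact ENNReal.rpow_lt_top_of_nonneg (by norm_num) hfin

lemma lintegral_one_sq_tilted_ne_top (hπ : IsPoisson z π) (hφ : Continuous φ)
    (hs : HasCompactSupport φ) : ∫⁻ _, (1 : ℝ≥0∞) ^ 2 ∂(tilted π φ) ≠ ∞ := by
  have := isFiniteMeasure_tilted hπ hφ hs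
  simp

/-- The bounded version of the exponential. -/
def truncExp (n : ℕ) (t : ℝ) : ℝ := min (Real.exp t) n

lemma continuous_truncExp (n : ℕ) : Continuous (truncExp n) :=
  Real.continuous_exp.min continuous_const

lemma abs_truncExp_sub_le (n : ℕ) (s t : ℝ) :
    |truncExp n s - truncExp n t| ≤ |Real.exp s - Real.exp t| := by
  refine (abs_min_sub_min_le_max _ _ _ _).trans_eq ?_
  rw [sub_self, abs_zero, max_eq_left (abs_nonneg _)]

lemma truncExp_nonneg (n : ℕ) (t : ℝ) : 0 ≤ truncExp n t :=
  le_min (Real.exp_nonneg t) (Nat.cast_nonneg n)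

lemma truncExp_le_exp (n : ℕ) (t : ℝ) : truncExp n t ≤ Real.exp t := min_le_left _ _

lemma truncExp_eq {n : ℕ} {t : ℝ} (h : Real.exp t ≤ n) : truncExp n t = Real.exp t := min_eq_left h

lemma isCylinder_truncExp (hφ : Continuous φ) (hs : HasCompactSupport φ) (n : ℕ) :
    IsCylinder fun γ => truncExp n (pair φ γ) := by
  refine ⟨1, fun _ => φ, fun t => truncExp n (t 0), le_rfl, fun _ => ⟨hφ, hs⟩,
    (continuous_truncExp n).comp (continuous_apply 0), ⟨n, fun t => ?_⟩, fun γ => rfl⟩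
  rw [abs_of_nonneg (truncExp_nonneg _ _)]
  exact min_le_right _ _

lemma enorm_truncExp_le (n : ℕ) (t : ℝ) : ‖truncExp n t‖ₑ ≤ ENNReal.ofReal (Real.exp t) := by
  rw [Real.enorm_eq_ofReal (truncExp_nonneg _ _)]
  exact ENNReal.ofReal_le_ofReal (truncExp_le_exp n t)

lemma eventually_exp_le (t : ℝ) : ∀ᶠ n : ℕ in atTop, Real.exp t ≤ n :=
  tendsto_natCast_atTop_atTop.eventually_ge_atTop _

variable [Nonempty (Fin d)]

lemma memLp_jumpGen (hπ : IsPoisson z π) (hab : Admissible a b) (hε : 0 < ε)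
    (hφ : Continuous φ) (hs : HasCompactSupport φ) (hL : ∀ x, |φ x| ≤ L) {g : ℝ → ℝ}
    (hg : Continuous g) (hge : ∀ s t, |g s - g t| ≤ |Real.exp s - Real.exp t|) :
    MemLp (jumpGen (scaledKernel a b ε) (fun γ => g (pair φ γ))) 2 π := by
  have hm := measurable_sumPairs (measurable_jumpMajorant hab hε hφ)
  refine memLp_of_tilted hφ hs (aestronglyMeasurable_jumpGen hπ hab hε hφ hs hL hg hge)
    (hm.const_mul (ENNReal.ofReal (Real.exp (4 * L)))) ?_ ?_
  · filter_upwards [ae_regularPairs hπ hab.meas_b hab.bdd_b] with γ hγ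
    exact enorm_jumpGen_le hab hε hφ hs hL hge hγ
  · simp only [mul_pow]
    rw [lintegral_const_mul _ (hm.pow_const 2)]
    exact ENNReal.mul_ne_top (by finiteness)
      (lintegral_sumPairs_jumpMajorant_ne_top hπ hab hε hφ hs hL)

lemma ae_jumpGenConverges (hπ : IsPoisson z π) (hab : Admissible a b) (hε : 0 < ε)
    (hφ : Continuous φ) (hs : HasCompactSupport φ) (hL : ∀ x, |φ x| ≤ L) {g : ℝ → ℝ}
    (hg : Continuous g) (hge : ∀ s t, |g s - g t| ≤ |Real.exp s - Real.exp t|) :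
    ∀ᵐ γ ∂π, JumpGenConverges (scaledKernel a b ε) (fun γ => g (pair φ γ)) γ := by
  filter_upwards [ae_regularPairs hπ hab.meas_b hab.bdd_b, ae_ne_top_of_tilted hφ hs
    (measurable_sumPairs (measurable_jumpMajorant hab hε hφ))
    (lintegral_sumPairs_jumpMajorant_ne_top hπ hab hε hφ hs hL)] with γ h1 h2
  exact jumpGenConverges hab hε hφ hs hL hg hge h1 h2

/-- A jump moves two particles and changes `⟨φ,γ⟩` by at most `4L`. Once `n` exceeds `e^{⟨φ,γ⟩ +
4L}` the truncation is inactive before and after every jump. -/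
lemma jumpGen_truncExp_eq (hab : Admissible a b) (hε : 0 < ε) (hs : HasCompactSupport φ)
    (hL : ∀ x, |φ x| ≤ L) {γ : Config d} (hγ : RegularPairs b γ) {n : ℕ}
    (hn : Real.exp (pair φ γ + 4 * L) ≤ n) :
    jumpGen (scaledKernel a b ε) (fun γ => truncExp n (pair φ γ)) γ
      = jumpGen (scaledKernel a b ε) (expFun φ) γ := by
  have e : increment (truncExp n) φ (pair φ γ) = increment Real.exp φ (pair φ γ) := by
    ext x y
    have h := le_trans (le_abs_self _) (abs_pairVal_sub_le hL x y)
    have h0 := le_trans (abs_nonneg _) (abs_pairVal_sub_le hL x y)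
    rw [increment, increment, truncExp_eq, truncExp_eq]
    · exact le_trans (Real.exp_le_exp.2 (by linarith)) hn
    · exact le_trans (Real.exp_le_exp.2 (by linarith)) hn
  rw [jumpGen_eq hab hε hs hγ, e]
  exact (jumpGen_eq (g := Real.exp) hab hε hs hγ).symm

/-- The truncated exponentials are cylinder functions. They and their images are dominated by
`e^{⟨φ,γ⟩}` times functions that are square integrable for the tilted measure, and for almost every
`γ` they coincide with the limits from some `n` on. -/
lemma inGenerator_expFun (hπ : IsPoisson z π) (hab : Admissible a b) (hε : 0 < ε)
    (hφ : Continuous φ) (hs : HasCompactSupport φ) (hL : ∀ x, |φ x| ≤ L) :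
    InGenerator (scaledKernel a b ε) π (expFun φ) (jumpGen (scaledKernel a b ε) (expFun φ)) := by
  have hge : ∀ s t, |Real.exp s - Real.exp t| ≤ |Real.exp s - Real.exp t| := fun _ _ => le_rfl
  have hpair := measurable_pair hφ hs
  have hX : ∀ γ, expWeight 1 φ γ = ENNReal.ofReal (Real.exp (pair φ γ)) := fun γ => by
    rw [expWeight, one_mul]
  have hF : MemLp (expFun φ) 2 π := by
    refine memLp_of_tilted hφ hs (H := fun _ => 1)
      (Real.measurable_exp.comp hpair).aestronglyMeasurable
      measurable_const (ae_of_all _ fun γ => ?_) (lintegral_one_sq_tilted_ne_top hπ hφ hs)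
    rw [mul_one, hX, expFun, Real.enorm_eq_ofReal (Real.exp_nonneg _)]
  have hG : ∀ n, MemLp (fun γ => truncExp n (pair φ γ)) 2 π := fun n => by
    refine memLp_of_tilted hφ hs (H := fun _ => 1)
      ((continuous_truncExp n).measurable.comp hpair).aestronglyMeasurable
      measurable_const (ae_of_all _ fun γ => ?_) (lintegral_one_sq_tilted_ne_top hπ hφ hs)
    rw [mul_one, hX]
    exact enorm_truncExp_le n _
  have hJ := memLp_jumpGen hπ hab hε hφ hs hL Real.continuous_exp hge
  have hm := measurable_sumPairs (measurable_jumpMajorant hab hε hφ)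
  have hreg := ae_regularPairs hπ hab.meas_b hab.bdd_b
  refine ⟨hF, hJ, fun n γ => truncExp n (pair φ γ), fun n => ⟨isCylinder_truncExp hφ hs n,
    ae_jumpGenConverges hπ hab hε hφ hs hL (continuous_truncExp n) (abs_truncExp_sub_le n), hG n,
    memLp_jumpGen hπ hab hε hφ hs hL (continuous_truncExp n) (abs_truncExp_sub_le n)⟩, ?_, ?_⟩
  · refine tendsto_eLpNorm_two_of_eventuallyEq (H := fun γ => expWeight 1 φ γ * 1)
      (fun n => (hG n).1) hF.1 (fun n => ae_of_all _ fun γ => ?_) ?_ (ae_of_all _ fun γ => ?_)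
    · rw [mul_one, hX, expFun, Real.enorm_eq_ofReal_abs]
      refine ENNReal.ofReal_le_ofReal (abs_le.2 ⟨?_, ?_⟩)
      · linarith [truncExp_nonneg n (pair φ γ)]
      · linarith [truncExp_le_exp n (pair φ γ), Real.exp_nonneg (pair φ γ)]
    · rw [← lintegral_tilted hφ hs (H := fun _ => 1) measurable_const]
      exact lintegral_one_sq_tilted_ne_top hπ hφ hs
    · filter_upwards [eventually_exp_le (pair φ γ)] with n hn
      exact truncExp_eq hn
  · refine tendsto_eLpNorm_two_of_eventuallyEq (H := fun γ => expWeight 1 φ γ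
      * (2 * ENNReal.ofReal (Real.exp (4 * L)) * sumPairs (jumpMajorant a b ε φ) γ))
      (fun n => aestronglyMeasurable_jumpGen hπ hab hε hφ hs hL (continuous_truncExp n)
        (abs_truncExp_sub_le n)) hJ.1 (fun n => ?_) ?_ ?_
    · filter_upwards [hreg] with γ hγ
      have h1 := enorm_jumpGen_le hab hε hφ hs hL (abs_truncExp_sub_le n) hγ
      have h2 := enorm_jumpGen_le hab hε hφ hs hL hge hγ
      refine (enorm_sub_le).trans ((add_le_add h1 h2).trans_eq ?_)
      ring
    · rw [← lintegral_tilted hφ hs (hm.const_mul _)]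
      simp only [mul_pow _ (sumPairs _ _)]
      rw [lintegral_const_mul _ (hm.pow_const 2)]
      exact ENNReal.mul_ne_top (by finiteness)
        (lintegral_sumPairs_jumpMajorant_ne_top hπ hab hε hφ hs hL)
    · filter_upwards [hreg] with γ hγ
      filter_upwards [eventually_exp_le (pair φ γ + 4 * L)] with n hn
      exact jumpGen_truncExp_eq hab hε hs hL hγ hn

end

end
end BinaryJumps

namespace BinaryJumps

noncomputable section

variable {d : ℕ}

open Config

/-! ### Decomposition of the jump integral -/

lemma integral_eq_toReal_sub {Ω : Type*} [MeasurableSpace Ω] {μ : Measure Ω} {f : Ω → ℝ}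
    {u w : Ω → ℝ≥0∞} (hu : Measurable u) (hw : Measurable w) (hui : ∫⁻ x, u x ∂μ ≠ ∞)
    (hwi : ∫⁻ x, w x ∂μ ≠ ∞) (h : ∀ x, f x = (u x).toReal - (w x).toReal) :
    Integrable f μ ∧ ∫ x, f x ∂μ = (∫⁻ x, u x ∂μ).toReal - (∫⁻ x, w x ∂μ).toReal := by
  have e : f = fun x => (u x).toReal - (w x).toReal := funext h
  have h1 := integrable_toReal_of_lintegral_ne_top hu.aemeasurable hui
  have h2 := integrable_toReal_of_lintegral_ne_top hw.aemeasurable hwi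
  rw [e]
  refine ⟨h1.sub h2, ?_⟩
  rw [integral_sub h1 h2, integral_toReal hu.aemeasurable (ae_lt_top hu hui),
    integral_toReal hw.aemeasurable (ae_lt_top hw hwi)]

/-- `e^{φ(x)} - 1`. -/
def expInc (φ : E d → ℝ) (x : E d) : ℝ := Real.exp (φ x) - 1

/-- `e^{φ(x₁) + φ(x₂)} - 1`. -/
def expInc2 (φ : E d → ℝ) (x : E d × E d) : ℝ := Real.exp (pairVal φ x) - 1

/-- `e^{φ(y₁) + φ(y₂) - φ(x₁) - φ(x₂)} - 1`. -/
def expJump (φ : E d → ℝ) (x y : E d × E d) : ℝ := Real.exp (pairVal φ y - pairVal φ x) - 1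

/-- The part of `expJump φ x y` beyond the deaths of `x₁` and `x₂` and the single births of `y₁`
and `y₂`. -/
def mixedTerm (φ : E d → ℝ) (x y : E d × E d) : ℝ :=
  expInc2 (-φ) x * expInc2 φ y + expInc φ y.1 * expInc φ y.2

/-- The contribution of births at `y₁` and `y₂`, counted separately. -/
def singleBirth (f : E d → ℝ) (_ y : E d × E d) : ℝ≥0∞ := sum2 (fun u => ENNReal.ofReal (f u)) y

/-- The contribution of births at `y₁` and `y₂`, counted jointly. -/
def jointBirth (f : E d × E d → ℝ) (_ y : E d × E d) : ℝ≥0∞ := ENNReal.ofReal (f y)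

section

variable {φ : E d → ℝ} {L : ℝ}

lemma pairVal_neg (φ : E d → ℝ) (x : E d × E d) : pairVal (-φ) x = -pairVal φ x := by
  simp [pairVal]; ring

lemma suppInd_neg (φ : E d → ℝ) : suppInd (-φ) = suppInd φ := by
  ext x; simp [suppInd]

lemma expInc2_eq (φ : E d → ℝ) (x : E d × E d) :
    expInc2 φ x = expInc φ x.1 + expInc φ x.2 + expInc φ x.1 * expInc φ x.2 := by
  simp only [expInc2, expInc, pairVal, Real.exp_add]; ring

/-- With `A = e^{-φ(x₁)-φ(x₂)} - 1` and `B = e^{φ(y₁)+φ(y₂)} - 1` the increment is `(1+A)(1+B) - 1 =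
A + B + AB`, and `B = p + q + pq` for the increments `p`, `q` at `y₁`, `y₂`. The mixed term collects
`AB + pq`. -/
lemma expJump_eq (φ : E d → ℝ) (x y : E d × E d) :
    expJump φ x y = expInc2 (-φ) x + (expInc φ y.1 + expInc φ y.2) + mixedTerm φ x y := by
  have h1 : Real.exp (pairVal φ y - pairVal φ x)
      = (expInc2 (-φ) x + 1) * (expInc2 φ y + 1) := by
    rw [expInc2, expInc2, pairVal_neg, sub_add_cancel, sub_add_cancel, ← Real.exp_add]
    congr 1; ring
  have h2 := expInc2_eq φ y
  rw [expJump, h1, mixedTerm]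
  linear_combination h2

/-- The increment is invariant under exchanging `x` with `y` and `φ` with `-φ`. The exchanged
expansion goes with the rate after the jump: the pair that the rate couples then stays joint, and
the other two points appear separately. -/
lemma expJump_eq_reverse (φ : E d → ℝ) (x y : E d × E d) :
    expJump φ x y = expInc2 φ y + (expInc (-φ) x.1 + expInc (-φ) x.2) + mixedTerm (-φ) y x := by
  have h := expJump_eq (-φ) y x
  rw [neg_neg] at h
  rw [← h, expJump, expJump, pairVal_neg, pairVal_neg]
  congr 2; ring

lemma continuous_expInc (hφ : Continuous φ) : Continuous (expInc φ) := by
  unfold expInc; fun_prop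

lemma continuous_expInc2 (hφ : Continuous φ) : Continuous (expInc2 φ) := by
  unfold expInc2 pairVal; fun_prop

lemma measurable_mixedTerm (hφ : Continuous φ) :
    Measurable (Function.uncurry (mixedTerm φ)) := by
  have h1 := continuous_expInc2 hφ
  have h2 := continuous_expInc2 hφ.neg
  have h3 := continuous_expInc hφ
  have : Continuous (Function.uncurry (mixedTerm φ)) := by
    unfold mixedTerm Function.uncurry
    fun_prop
  exact this.measurable

lemma measurable_singleBirth {f : E d → ℝ} (hf : Measurable f) :
    Measurable (Function.uncurry (singleBirth f)) :=
  (measurable_sum2 hf.ennreal_ofReal).comp measurable_snd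

lemma measurable_jointBirth {f : E d × E d → ℝ} (hf : Measurable f) :
    Measurable (Function.uncurry (jointBirth f)) := (hf.comp measurable_snd).ennreal_ofReal

/-- The bound for the exponential increments. -/
def incBound (L : ℝ) : ℝ≥0∞ := ENNReal.ofReal (Real.exp (4 * L))

lemma incBound_ne_top (L : ℝ) : incBound L ≠ ∞ := ENNReal.ofReal_ne_top

lemma le_incBound {T : ℝ} (h : T ≤ 4 * L) : ENNReal.ofReal (Real.exp T) ≤ incBound L :=
  ENNReal.ofReal_le_ofReal (Real.exp_le_exp.2 h)

variable (hL : ∀ x, |φ x| ≤ L)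

include hL in
lemma enorm_expInc_le (x : E d) : ‖expInc φ x‖ₑ ≤ incBound L * suppInd φ x := by
  have h0 := (abs_nonneg _).trans (hL x)
  refine (enorm_exp_sub_one_le (hL x) one_le_suppInd).trans ?_
  gcongr
  exact le_incBound (by linarith)

include hL in
lemma enorm_expInc2_le (x : E d × E d) : ‖expInc2 φ x‖ₑ ≤ incBound L * sum2 (suppInd φ) x := by
  have h0 := (abs_nonneg _).trans (hL x.1)
  refine (enorm_exp_sub_one_le (abs_pairVal_le hL x) one_le_sum2).trans ?_
  gcongr
  exact le_incBound (by linarith)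

lemma abs_neg_le {L : ℝ} (hL : ∀ x, |φ x| ≤ L) (x : E d) : |(-φ) x| ≤ L := by simpa using hL x

include hL in
lemma enorm_mixedTerm_le (x y : E d × E d) :
    ‖mixedTerm φ x y‖ₑ ≤ incBound L ^ 2 * majMixed (suppInd φ) x y := by
  have h1 := enorm_expInc2_le (abs_neg_le hL) x
  rw [suppInd_neg] at h1
  calc ‖mixedTerm φ x y‖ₑ ≤ ‖expInc2 (-φ) x‖ₑ * ‖expInc2 φ y‖ₑ
        + ‖expInc φ y.1‖ₑ * ‖expInc φ y.2‖ₑ := by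
        rw [← enorm_mul, ← enorm_mul]; exact enorm_add_le _ _
    _ ≤ incBound L * sum2 (suppInd φ) x * (incBound L * sum2 (suppInd φ) y)
        + incBound L * suppInd φ y.1 * (incBound L * suppInd φ y.2) := by
        gcongr
        · exact enorm_expInc2_le hL y
        · exact enorm_expInc_le hL y.1
        · exact enorm_expInc_le hL y.2
    _ = _ := by rw [majMixed]; ring

lemma ofReal_le_enorm (t : ℝ) : ENNReal.ofReal t ≤ ‖t‖ₑ := by
  rw [Real.enorm_eq_ofReal_abs]; exact ENNReal.ofReal_le_ofReal (le_abs_self t)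

lemma singleBirth_le {f : E d → ℝ} {k : E d → ℝ≥0∞} {c : ℝ≥0∞} (h : ∀ x, ‖f x‖ₑ ≤ c * k x)
    (x y : E d × E d) : singleBirth f x y ≤ c * majBirth k x y := by
  rw [singleBirth, majBirth, sum2, sum2, mul_add]
  exact add_le_add ((ofReal_le_enorm _).trans (h _)) ((ofReal_le_enorm _).trans (h _))

lemma jointBirth_le {f : E d × E d → ℝ} {k : E d → ℝ≥0∞} {c : ℝ≥0∞}
    (h : ∀ x, ‖f x‖ₑ ≤ c * sum2 k x) (x y : E d × E d) :
    jointBirth f x y ≤ c * majBirth k x y := (ofReal_le_enorm _).trans (h _)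

lemma majBirth_le_two (φ : E d → ℝ) (x y : E d × E d) : majBirth (suppInd φ) x y ≤ 2 := by
  rw [majBirth, sum2, ← one_add_one_eq_two]
  gcongr <;> exact suppInd_le_one _ _

lemma majMixed_le_five (φ : E d → ℝ) (x y : E d × E d) : majMixed (suppInd φ) x y ≤ 5 := by
  rw [majMixed, sum2, sum2]
  calc _ ≤ ((1 + 1) * (1 + 1) + 1 * 1 : ℝ≥0∞) := by gcongr <;> exact suppInd_le_one _ _
    _ = 5 := by norm_num

variable {α : Measure (E d)} [IsFiniteMeasure α] {b : E d → ℝ≥0} {M : ℝ≥0}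

/-- The contribution of the mixed terms. -/
def mixedInt (μ : Measure (E d × E d)) (b : E d → ℝ≥0) (φ : E d → ℝ) (x : E d × E d) : ℝ :=
  ∫ h, (pairRate b x * mixedTerm φ x (x + h) + pairRate b (x + h) * mixedTerm (-φ) (x + h) x) ∂μ

lemma toReal_mul_ofReal_sub (r : ℝ≥0) (t : ℝ) :
    (r : ℝ) * t = ((r : ℝ≥0∞) * ENNReal.ofReal t).toReal
      - ((r : ℝ≥0∞) * ENNReal.ofReal (-t)).toReal := by
  rw [ENNReal.toReal_mul, ENNReal.toReal_mul, ENNReal.coe_toReal, ENNReal.toReal_ofReal',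
    ENNReal.toReal_ofReal', ← mul_sub, max_zero_sub_max_neg_zero_eq_self]

lemma jumpPre_ne_top (hbM : ∀ x, b x ≤ M) {v : E d × E d → E d × E d → ℝ≥0∞} {c : ℝ≥0∞}
    (hc : c ≠ ∞) (hv : ∀ x y, v x y ≤ c) (x : E d × E d) : jumpPre (α.prod α) b v x ≠ ∞ :=
  ne_top_of_le_ne_top (by finiteness) (jumpPre_le hbM hv x)

lemma jumpPost_ne_top (hbM : ∀ x, b x ≤ M) {v : E d × E d → E d × E d → ℝ≥0∞} {c : ℝ≥0∞}
    (hc : c ≠ ∞) (hv : ∀ x y, v x y ≤ c) (x : E d × E d) : jumpPost (α.prod α) b v x ≠ ∞ :=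
  ne_top_of_le_ne_top (by finiteness) (jumpPost_le hbM hv x)

/-- The majorant of the contribution of the mixed terms. -/
def mixedMajorant (μ : Measure (E d × E d)) (b : E d → ℝ≥0) (φ : E d → ℝ) (x : E d × E d) : ℝ≥0∞ :=
  jumpPre μ b (majMixed (suppInd φ)) x + jumpPost μ b (fun x y => majMixed (suppInd φ) y x) x

include hL in
lemma lintegral_enorm_mixed_le {μ : Measure (E d × E d)} (hb : Measurable b) (hφ : Continuous φ)
    (x : E d × E d) :
    ∫⁻ h, ‖pairRate b x * mixedTerm φ x (x + h)
      + pairRate b (x + h) * mixedTerm (-φ) (x + h) x‖ₑ ∂μ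
      ≤ incBound L ^ 2 * mixedMajorant μ b φ x := by
  have hmm := measurable_majMixed (measurable_suppInd hφ)
  have hmm' : Measurable (Function.uncurry fun x y => majMixed (suppInd φ) y x) :=
    hmm.comp measurable_swap
  have h1 : Measurable fun h => (pairRate b x : ℝ≥0∞) * majMixed (suppInd φ) x (x + h) :=
    (measurable_pre hb hmm).comp (f := fun h : E d × E d => (x, h)) (by fun_prop)
  have h2 : Measurable fun h => (pairRate b (x + h) : ℝ≥0∞) * majMixed (suppInd φ) (x + h) x :=
    (measurable_post hb hmm').comp (f := fun h : E d × E d => (x, h)) (by fun_prop)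
  have h12 : Measurable fun h => (pairRate b x : ℝ≥0∞) * majMixed (suppInd φ) x (x + h)
      + pairRate b (x + h) * majMixed (suppInd φ) (x + h) x := h1.add h2
  rw [mixedMajorant, jumpPre, jumpPost, ← lintegral_add_left h1, ← lintegral_const_mul _ h12]
  refine lintegral_mono fun h => (enorm_add_le _ _).trans ?_
  have e : ∀ r : ℝ≥0, ‖(r : ℝ)‖ₑ = r := fun r => by
    rw [Real.enorm_eq_ofReal (NNReal.coe_nonneg _), ENNReal.ofReal_coe_nnreal]
  rw [enorm_mul, enorm_mul, e, e, mul_add, mul_left_comm, mul_left_comm (incBound L ^ 2)]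
  have h3 := enorm_mixedTerm_le hL x (x + h)
  have h4 := enorm_mixedTerm_le (abs_neg_le hL) (x + h) x
  rw [suppInd_neg] at h4
  gcongr

include hL in
lemma enorm_mixedInt_le {μ : Measure (E d × E d)} (hb : Measurable b) (hφ : Continuous φ)
    (x : E d × E d) : ‖mixedInt μ b φ x‖ₑ ≤ incBound L ^ 2 * mixedMajorant μ b φ x :=
  (enorm_integral_le_lintegral_enorm _).trans (lintegral_enorm_mixed_le hL hb hφ x)

include hL in
lemma integrable_mixed (hb : Measurable b) (hbM : ∀ x, b x ≤ M) (hφ : Continuous φ)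
    (x : E d × E d) : Integrable (fun h => pairRate b x * mixedTerm φ x (x + h)
      + pairRate b (x + h) * mixedTerm (-φ) (x + h) x) (α.prod α) := by
  refine ⟨Measurable.aestronglyMeasurable ?_, (lintegral_enorm_mixed_le hL hb hφ x).trans_lt ?_⟩
  · refine Measurable.add (measurable_const.mul ?_) (Measurable.mul ?_ ?_)
    · exact (measurable_mixedTerm hφ).comp (f := fun h : E d × E d => (x, x + h)) (by fun_prop)
    · exact ((measurable_pairRate hb).comp (f := fun h : E d × E d => x + h)
        (by fun_prop)).coe_nnreal_real
    · exact (measurable_mixedTerm hφ.neg).comp (f := fun h : E d × E d => (x + h, x)) (by fun_prop)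
  · have h1 := jumpPre_ne_top (α := α) (c := 5) hbM (by finiteness) (majMixed_le_five φ) x
    have h2 := jumpPost_ne_top (α := α) (c := 5) hbM (by finiteness)
      (fun x y => majMixed_le_five φ y x) x
    exact ENNReal.mul_lt_top (ENNReal.pow_lt_top (incBound_ne_top L).lt_top)
      (ENNReal.add_lt_top.2 ⟨h1.lt_top, h2.lt_top⟩)

include hL in
lemma integral_singleBirth (hb : Measurable b) (hbM : ∀ x, b x ≤ M) (hφ : Continuous φ)
    (x : E d × E d) :
    Integrable (fun h => pairRate b x * (expInc φ (x + h).1 + expInc φ (x + h).2)) (α.prod α) ∧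
    ∫ h, pairRate b x * (expInc φ (x + h).1 + expInc φ (x + h).2) ∂(α.prod α)
      = (jumpPre (α.prod α) b (singleBirth (expInc φ)) x).toReal
        - (jumpPre (α.prod α) b (singleBirth fun u => -expInc φ u) x).toReal := by
  have hf := (continuous_expInc hφ).measurable
  have hbd : ∀ x y : E d × E d, incBound L * majBirth (suppInd φ) x y ≤ incBound L * 2 :=
    fun x y => by gcongr; exact majBirth_le_two φ x y
  have hb1 : ∀ x y, singleBirth (expInc φ) x y ≤ incBound L * 2 := fun x y =>
    (singleBirth_le (enorm_expInc_le hL) x y).trans (hbd x y)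
  have hb2 : ∀ x y, singleBirth (fun u => -expInc φ u) x y ≤ incBound L * 2 := fun x y =>
    (singleBirth_le (fun x => (enorm_neg _).trans_le (enorm_expInc_le hL x)) x y).trans (hbd x y)
  have hc : incBound L * 2 ≠ ∞ := ENNReal.mul_ne_top (incBound_ne_top L) (by finiteness)
  have hm : ∀ {f : E d → ℝ}, Measurable f → Measurable fun h =>
      (pairRate b x : ℝ≥0∞) * singleBirth f x (x + h) := fun hf =>
    (measurable_pre hb (measurable_singleBirth hf)).comp
      (f := fun h : E d × E d => (x, h)) (by fun_prop)
  refine integral_eq_toReal_sub (hm hf) (hm hf.neg) (jumpPre_ne_top hbM hc hb1 x)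
    (jumpPre_ne_top hbM hc hb2 x) fun h => ?_
  rw [mul_add, toReal_mul_ofReal_sub _ (expInc φ (x + h).1),
    toReal_mul_ofReal_sub _ (expInc φ (x + h).2), singleBirth, singleBirth, sum2, sum2, mul_add,
    mul_add, ENNReal.toReal_add (by finiteness) (by finiteness),
    ENNReal.toReal_add (by finiteness) (by finiteness)]
  ring

include hL in
lemma integral_jointBirth (hb : Measurable b) (hbM : ∀ x, b x ≤ M) (hφ : Continuous φ)
    (x : E d × E d) :
    Integrable (fun h => pairRate b (x + h) * expInc2 φ (x + h)) (α.prod α) ∧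
    ∫ h, pairRate b (x + h) * expInc2 φ (x + h) ∂(α.prod α)
      = (jumpPost (α.prod α) b (jointBirth (expInc2 φ)) x).toReal
        - (jumpPost (α.prod α) b (jointBirth fun u => -expInc2 φ u) x).toReal := by
  have hf := (continuous_expInc2 hφ).measurable
  have hbd : ∀ x y : E d × E d, incBound L * majBirth (suppInd φ) x y ≤ incBound L * 2 :=
    fun x y => by gcongr; exact majBirth_le_two φ x y
  have hb1 : ∀ x y, jointBirth (expInc2 φ) x y ≤ incBound L * 2 := fun x y =>
    (jointBirth_le (enorm_expInc2_le hL) x y).trans (hbd x y)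
  have hb2 : ∀ x y, jointBirth (fun u => -expInc2 φ u) x y ≤ incBound L * 2 := fun x y =>
    (jointBirth_le (fun x => (enorm_neg _).trans_le (enorm_expInc2_le hL x)) x y).trans (hbd x y)
  have hc : incBound L * 2 ≠ ∞ := ENNReal.mul_ne_top (incBound_ne_top L) (by finiteness)
  have hm : ∀ {f : E d × E d → ℝ}, Measurable f → Measurable fun h =>
      (pairRate b (x + h) : ℝ≥0∞) * jointBirth f x (x + h) := fun hf =>
    (measurable_post hb (measurable_jointBirth hf)).comp
      (f := fun h : E d × E d => (x, h)) (by fun_prop)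
  exact integral_eq_toReal_sub (hm hf) (hm hf.neg) (jumpPost_ne_top hbM hc hb1 x)
    (jumpPost_ne_top hbM hc hb2 x) fun h => toReal_mul_ofReal_sub _ _

lemma integral_smearRate (hb : Measurable b) (hbM : ∀ x, b x ≤ M) (x : E d × E d) :
    Integrable (fun h => (pairRate b (x + h) : ℝ)) (α.prod α) ∧
    ∫ h, (pairRate b (x + h) : ℝ) ∂(α.prod α) = (smearRate α b x).toReal := by
  have hm : Measurable fun h => (pairRate b (x + h) : ℝ≥0∞) :=
    ((measurable_pairRate hb).comp (f := fun h : E d × E d => x + h)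
      (by fun_prop)).coe_nnreal_ennreal
  have hfin : ∫⁻ h, (pairRate b (x + h) : ℝ≥0∞) ∂(α.prod α) ≠ ∞ := by
    have := jumpPost_ne_top (α := α) (v := fun _ _ => 1) (c := 1) hbM (by finiteness)
      (fun _ _ => le_rfl) x
    simpa only [jumpPost, mul_one] using this
  have h := integral_eq_toReal_sub (f := fun h => (pairRate b (x + h) : ℝ)) hm
    (w := fun _ => 0) measurable_const hfin (by simp) (fun h => by simp)
  refine ⟨h.1, h.2.trans ?_⟩
  simp [smearRate]

include hL in
/-- The jump integral splits into the deaths and births of pairs and single particles, with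
smeared rates, and mixed terms. -/
lemma jumpInt_expJump (hb : Measurable b) (hbM : ∀ x, b x ≤ M) (hφ : Continuous φ)
    (x : E d × E d) :
    jumpInt (α.prod α) b (expJump φ) x
      = α.real Set.univ ^ 2 * (pairRate b x * expInc2 (-φ) x)
        + ((jumpPre (α.prod α) b (singleBirth (expInc φ)) x).toReal
          - (jumpPre (α.prod α) b (singleBirth fun u => -expInc φ u) x).toReal)
        + ((jumpPost (α.prod α) b (jointBirth (expInc2 φ)) x).toReal
          - (jumpPost (α.prod α) b (jointBirth fun u => -expInc2 φ u) x).toReal)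
        + (expInc (-φ) x.1 + expInc (-φ) x.2) * (smearRate α b x).toReal
        + mixedInt (α.prod α) b φ x := by
  obtain ⟨i1, e1⟩ := integral_singleBirth (α := α) hL hb hbM hφ x
  obtain ⟨i2, e2⟩ := integral_jointBirth (α := α) hL hb hbM hφ x
  obtain ⟨i3, e3⟩ := integral_smearRate (α := α) hb hbM x
  have i4 := integrable_mixed (α := α) hL hb hbM hφ x
  have i0 : Integrable (fun _ : E d × E d => pairRate b x * expInc2 (-φ) x) (α.prod α) :=
    integrable_const _
  have i3' := i3.const_mul (expInc (-φ) x.1 + expInc (-φ) x.2)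
  rw [← e1, ← e2, ← e3, ← integral_const_mul, mixedInt]
  have e0 : α.real Set.univ ^ 2 * (pairRate b x * expInc2 (-φ) x)
      = ∫ _, (pairRate b x * expInc2 (-φ) x : ℝ) ∂(α.prod α) := by
    rw [integral_const, smul_eq_mul, Measure.real, Measure.real, prod_univ_eq, ENNReal.toReal_pow]
  rw [e0, ← integral_add' i0 i1, ← integral_add' (i0.add i1) i2,
    ← integral_add' ((i0.add i1).add i2) i3', ← integral_add' (((i0.add i1).add i2).add i3') i4,
    jumpInt]
  refine integral_congr_ae (ae_of_all _ fun h => ?_)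
  -- The direct expansion is multiplied by the rate before the jump, the reversed one by the rate
  -- after it.
  have h1 := expJump_eq φ x (x + h)
  have h2 := expJump_eq_reverse φ x (x + h)
  simp only [Pi.add_apply, NNReal.coe_add]
  linear_combination (pairRate b x : ℝ) * h1 + (pairRate b (x + h) : ℝ) * h2

end

end
end BinaryJumps

namespace BinaryJumps

noncomputable section

variable {d : ℕ}

open Config

/-! ### Law of large numbers for the births -/

section

variable {z : ℝ≥0} {π : Measure (Config d)} {φ : E d → ℝ} {L : ℝ} {K : E d × E d → ℝ≥0∞}

lemma lintegral_intensity (z : ℝ≥0) (f : E d → ℝ≥0∞) :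
    ∫⁻ x, f x ∂(intensity d z) = z * ∫⁻ x, f x := by
  have h : intensity d z = (z : ℝ≥0∞) • volume := rfl
  rw [h, lintegral_smul_measure, smul_eq_mul]

lemma lintegral_tiltedIntensity_eq (z : ℝ≥0) (hφ : Continuous φ) {f : E d → ℝ≥0∞}
    (hf : Measurable f) : ∫⁻ x, f x ∂(tiltedIntensity d z φ)
      = z * ∫⁻ x, ENNReal.ofReal (Real.exp (2 * φ x)) * f x := by
  have hm : Measurable fun x => ENNReal.ofReal (Real.exp (2 * φ x)) :=
    (by fun_prop : Continuous fun x => Real.exp (2 * φ x)).measurable.ennreal_ofReal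
  rw [tiltedIntensity, lintegral_withDensity_eq_lintegral_mul _ hm hf, lintegral_intensity]
  rfl

lemma lintegral_lintegral_tiltedIntensity_eq (z : ℝ≥0) (hφ : Continuous φ) (hK : Measurable K) :
    ∫⁻ x, ∫⁻ y, K (x, y) ∂(tiltedIntensity d z φ) ∂(tiltedIntensity d z φ)
      = z ^ 2 * ∫⁻ x, ENNReal.ofReal (Real.exp (2 * pairVal φ x)) * K x := by
  have hm : Measurable fun x => ENNReal.ofReal (Real.exp (2 * φ x)) :=
    (by fun_prop : Continuous fun x => Real.exp (2 * φ x)).measurable.ennreal_ofReal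
  have hm2 : Measurable fun x : E d × E d => ENNReal.ofReal (Real.exp (2 * φ x.1))
      * (ENNReal.ofReal (Real.exp (2 * φ x.2)) * K x) :=
    (hm.comp measurable_fst).mul ((hm.comp measurable_snd).mul hK)
  have hm3 : Measurable fun x : E d × E d => ENNReal.ofReal (Real.exp (2 * φ x.2)) * K x :=
    (hm.comp measurable_snd).mul hK
  have hKx : ∀ x, Measurable fun y => K (x, y) := fun x => hK.comp measurable_prodMk_left
  have h1 : ∀ x, ∫⁻ y, K (x, y) ∂(tiltedIntensity d z φ)
      = z * ∫⁻ y, ENNReal.ofReal (Real.exp (2 * φ y)) * K (x, y) := fun x =>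
    lintegral_tiltedIntensity_eq z hφ (hKx x)
  have h3 : Measurable fun x => ∫⁻ y, ENNReal.ofReal (Real.exp (2 * φ y)) * K (x, y) :=
    hm3.lintegral_prod_right'
  have e : ∀ x : E d × E d, ENNReal.ofReal (Real.exp (2 * pairVal φ x)) * K x
      = ENNReal.ofReal (Real.exp (2 * φ x.1))
        * (ENNReal.ofReal (Real.exp (2 * φ x.2)) * K x) := fun x => by
    rw [pairVal, mul_add, Real.exp_add, ENNReal.ofReal_mul (Real.exp_nonneg _), mul_assoc]
  simp only [h1, e]
  rw [lintegral_tiltedIntensity_eq z hφ (h3.const_mul _), Measure.volume_eq_prod,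
    lintegral_prod _ hm2.aemeasurable, sq, mul_assoc, ← lintegral_const_mul _ hm2.lintegral_prod_right']
  congr 2
  ext x
  have h4 : Measurable fun y => ENNReal.ofReal (Real.exp (2 * φ y)) * K (x, y) :=
    hm.mul (hKx x)
  have h5 := lintegral_const_mul (μ := (volume : Measure (E d)))
    (ENNReal.ofReal (Real.exp (2 * φ x))) h4
  rw [mul_left_comm, ← h5]

lemma le_add_of_enorm_sub_one_le {r : ℝ} (hr : 0 ≤ r) {B : ℝ≥0∞} (h : ‖r - 1‖ₑ ≤ B) :
    ENNReal.ofReal r ≤ 1 + B ∧ 1 ≤ ENNReal.ofReal r + B := by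
  rw [Real.enorm_eq_ofReal_abs] at h
  constructor
  · refine le_trans ?_ (add_le_add le_rfl h)
    rw [← ENNReal.ofReal_one, ← ENNReal.ofReal_add zero_le_one (abs_nonneg _)]
    exact ENNReal.ofReal_le_ofReal (by linarith [le_abs_self (r - 1)])
  · refine le_trans ?_ (add_le_add le_rfl h)
    rw [← ENNReal.ofReal_one, ← ENNReal.ofReal_add hr (abs_nonneg _)]
    exact ENNReal.ofReal_le_ofReal (by linarith [neg_abs_le (r - 1)])

lemma enorm_toReal_sub_le {u w D : ℝ≥0∞} (hu : u ≠ ∞) (hw : w ≠ ∞) (h1 : u ≤ w + D)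
    (h2 : w ≤ u + D) : ‖u.toReal - w.toReal‖ₑ ≤ D := by
  rcases eq_or_ne D ∞ with rfl | hD
  · exact le_top
  rw [Real.enorm_eq_ofReal_abs]
  refine ENNReal.ofReal_le_of_le_toReal (abs_le.2 ⟨?_, ?_⟩)
  · have := ENNReal.toReal_mono (ENNReal.add_ne_top.2 ⟨hu, hD⟩) h2
    rw [ENNReal.toReal_add hu hD] at this
    linarith
  · have := ENNReal.toReal_mono (ENNReal.add_ne_top.2 ⟨hw, hD⟩) h1
    rw [ENNReal.toReal_add hw hD] at this
    linarith

lemma lintegral_mul_sum2_le {k : E d → ℝ≥0∞} (hk : Measurable k) (hK : Measurable K)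
    (hsym : ∀ x, K x.swap = K x) {R : ℝ≥0∞} (hR : ∀ x, ∫⁻ y, K (x, y) ≤ R) :
    ∫⁻ x, sum2 k x * K x ≤ 2 * (∫⁻ x, k x) * R := by
  have h1 : Measurable fun x : E d × E d => k x.1 * K x := (hk.comp measurable_fst).mul hK
  have e1 : ∫⁻ x : E d × E d, k x.1 * K x ≤ (∫⁻ x, k x) * R := by
    rw [Measure.volume_eq_prod, lintegral_prod _ h1.aemeasurable, ← lintegral_mul_const _ hk]
    refine lintegral_mono fun x => ?_
    have hKx : Measurable fun y => K (x, y) := hK.comp measurable_prodMk_left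
    simp only
    rw [lintegral_const_mul _ hKx]
    gcongr
    exact hR x
  have e2 : ∫⁻ x : E d × E d, k x.2 * K x = ∫⁻ x : E d × E d, k x.1 * K x := by
    have := (Measure.measurePreserving_swap (μ := (volume : Measure (E d)))
      (ν := (volume : Measure (E d)))).lintegral_comp h1
    simp only [hsym] at this
    exact this
  simp only [sum2, add_mul]
  rw [lintegral_add_left h1, e2]
  calc _ ≤ (∫⁻ x, k x) * R + (∫⁻ x, k x) * R := add_le_add e1 e1
    _ = _ := by ring

variable (hL : ∀ x, |φ x| ≤ L)

include hL in
-- The tilting factor `e^{2(φ(x₁)+φ(x₂))}` differs from `1` only when one of the two points lies in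
-- the support of `φ`. Integrating the other point first gives a row integral, so the change is
-- `O(R)`. The exponent is at most `4L`, as in `incBound`.
lemma enorm_tilted_total_sub_le (z : ℝ≥0) (hφ : Continuous φ) (hK : Measurable K)
    (hsym : ∀ x, K x.swap = K x) {R : ℝ≥0∞} (hR : ∀ x, ∫⁻ y, K (x, y) ≤ R)
    (hT : ∫⁻ x, K x ≠ ∞) :
    ‖(∫⁻ x, ∫⁻ y, K (x, y) ∂(tiltedIntensity d z φ) ∂(tiltedIntensity d z φ)).toReal
      - z ^ 2 * (∫⁻ x, K x).toReal‖ₑ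
      ≤ z ^ 2 * (incBound L * (2 * (∫⁻ x, suppInd φ x) * R)) := by
  have hk := measurable_suppInd hφ
  have hsk : Measurable fun x => sum2 (suppInd φ) x * K x := (measurable_sum2 hk).mul hK
  have hexp : ∀ x, ‖Real.exp (2 * pairVal φ x) - 1‖ₑ ≤ incBound L * sum2 (suppInd φ) x := fun x =>
    enorm_exp_sub_one_le (T := 4 * L)
      (by rw [abs_mul, abs_two]; linarith [abs_pairVal_le hL x])
      fun h => one_le_sum2 fun h0 => h (by rw [h0, mul_zero])
  have hcmp := fun x => le_add_of_enorm_sub_one_le (Real.exp_nonneg (2 * pairVal φ x)) (hexp x)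
  have hD : ∫⁻ x, incBound L * (sum2 (suppInd φ) x * K x)
      ≤ incBound L * (2 * (∫⁻ x, suppInd φ x) * R) := by
    rw [lintegral_const_mul _ hsk]
    gcongr
    exact lintegral_mul_sum2_le hk hK hsym hR
  have hfin := ne_top_of_le_ne_top (ENNReal.mul_ne_top (ENNReal.pow_ne_top
    (tiltBound_ne_top z L)) hT) (lintegral_lintegral_tiltedIntensity_le (z := z) hL hK)
  have e : (z : ℝ) ^ 2 * (∫⁻ x, K x).toReal = ((z : ℝ≥0∞) ^ 2 * ∫⁻ x, K x).toReal := by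
    rw [ENNReal.toReal_mul, ENNReal.toReal_pow, ENNReal.coe_toReal]
  rw [e]
  refine enorm_toReal_sub_le hfin (ENNReal.mul_ne_top (by finiteness) hT) ?_ ?_
  · rw [lintegral_lintegral_tiltedIntensity_eq z hφ hK, ← mul_add]
    gcongr
    refine le_trans ?_ (add_le_add le_rfl hD)
    rw [← lintegral_add_left hK]
    refine lintegral_mono fun x => ?_
    calc _ ≤ (1 + incBound L * sum2 (suppInd φ) x) * K x := by gcongr; exact (hcmp x).1
      _ = _ := by ring
  · rw [lintegral_lintegral_tiltedIntensity_eq z hφ hK, ← mul_add]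
    gcongr
    refine le_trans ?_ (add_le_add le_rfl hD)
    rw [← lintegral_add_right _ (hsk.const_mul _)]
    refine lintegral_mono fun x => ?_
    calc K x = 1 * K x := (one_mul _).symm
      _ ≤ (ENNReal.ofReal (Real.exp (2 * pairVal φ x)) + incBound L * sum2 (suppInd φ) x) * K x := by
          gcongr; exact (hcmp x).2
      _ = _ := by ring

/-- The deviation of a sum over pairs from its Poisson mean. -/
def deviation (z : ℝ≥0) (K : E d × E d → ℝ≥0∞) (γ : Config d) : ℝ≥0∞ :=
  ‖(sumPairs K γ).toReal - z ^ 2 * (∫⁻ x, K x).toReal‖ₑ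

lemma measurable_deviation (z : ℝ≥0) (hK : Measurable K) : Measurable (deviation z K) :=
  ((measurable_sumPairs hK).ennreal_toReal.sub_const _).enorm

lemma enorm_sq_eq (t : ℝ) : ‖t‖ₑ ^ 2 = ENNReal.ofReal (t ^ 2) := by
  rw [Real.enorm_eq_ofReal_abs, ← ENNReal.ofReal_pow (abs_nonneg _), sq_abs]

/-- The constant in the variance bound for the sums over pairs. -/
def deviationConst (π : Measure (Config d)) (z : ℝ≥0) (φ : E d → ℝ) (L : ℝ) (T c : ℝ≥0∞) : ℝ≥0∞ :=
  tilted π φ Set.univ * (2 * ((tiltBound z L ^ 2 * T) * (2 * (2 * (tiltBound z L * c)) + 2 * c))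
    + 2 * (z ^ 2 * (incBound L * (2 * (∫⁻ x, suppInd φ x) * c))) ^ 2)

lemma deviationConst_ne_top (hπ : IsPoisson z π) (hφ : Continuous φ) (hs : HasCompactSupport φ)
    (L : ℝ) {T c : ℝ≥0∞} (hT : T ≠ ∞) (hc : c ≠ ∞) : deviationConst π z φ L T c ≠ ∞ := by
  have := isFiniteMeasure_tilted hπ hφ hs
  have h1 := tiltBound_ne_top z L
  have h2 := incBound_ne_top L
  have h3 := lintegral_suppInd_ne_top hs
  unfold deviationConst
  finiteness

include hL in
-- Law of large numbers: rows and supremum of order `s` make the variance under the tilted measure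
-- of order `s`, although the total does not shrink. Comparing the tilted mean with the Lebesgue
-- mean adds a bias of order `s`, whose square is absorbed by `s ≤ 1`.
lemma lintegral_deviation_sq_le [Nonempty (Fin d)] (hπ : IsPoisson z π) (hφ : Continuous φ)
    (hs : HasCompactSupport φ) (hK : Measurable K) (hsym : ∀ x, K x.swap = K x) {T c s : ℝ≥0∞}
    (hR : ∀ x, ∫⁻ y, K (x, y) ≤ c * s) (hS : ∀ x, K x ≤ c * s) (hT : ∫⁻ x, K x ≤ T)
    (hT' : T ≠ ∞) (hs1 : s ≤ 1) :
    ∫⁻ γ, deviation z K γ ^ 2 ∂(tilted π φ) ≤ deviationConst π z φ L T c * s := by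
  have hfin := ne_top_of_le_ne_top hT' hT
  have := isFiniteMeasure_tilted hπ hφ hs
  set w : ℝ := (∫⁻ x, ∫⁻ y, K (x, y) ∂(tiltedIntensity d z φ) ∂(tiltedIntensity d z φ)).toReal
    with hw
  have h1 := lintegral_sumPairs_dev_le hπ hφ hs hL hK hsym hR hS hfin
  have h2 := enorm_tilted_total_sub_le hL z hφ hK hsym hR hfin
  rw [← hw] at h1 h2
  have hm : Measurable fun γ => ENNReal.ofReal (((sumPairs K γ).toReal - w) ^ 2) :=
    (((measurable_sumPairs hK).ennreal_toReal.sub_const _).pow_const 2).ennreal_ofReal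
  calc ∫⁻ γ, deviation z K γ ^ 2 ∂(tilted π φ)
      ≤ ∫⁻ γ, (2 * ENNReal.ofReal (((sumPairs K γ).toReal - w) ^ 2)
        + 2 * ‖w - z ^ 2 * (∫⁻ x, K x).toReal‖ₑ ^ 2) ∂(tilted π φ) := by
        refine lintegral_mono fun γ => ?_
        rw [deviation, enorm_sq_eq, enorm_sq_eq]
        exact ofReal_sub_sq_le _ _ _
    _ = 2 * ∫⁻ γ, ENNReal.ofReal (((sumPairs K γ).toReal - w) ^ 2) ∂(tilted π φ)
        + 2 * ‖w - z ^ 2 * (∫⁻ x, K x).toReal‖ₑ ^ 2 * tilted π φ Set.univ := by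
        rw [lintegral_add_left (hm.const_mul _), lintegral_const_mul _ hm, lintegral_const]
    _ ≤ 2 * (tilted π φ Set.univ * ((tiltBound z L ^ 2 * T)
          * (2 * (2 * (tiltBound z L * (c * s))) + 2 * (c * s))))
        + 2 * ((z ^ 2 * (incBound L * (2 * (∫⁻ x, suppInd φ x) * c))) ^ 2 * s)
          * tilted π φ Set.univ := by
        gcongr
        · refine h1.trans ?_
          gcongr
        · calc _ ≤ (z ^ 2 * (incBound L * (2 * (∫⁻ x, suppInd φ x) * (c * s)))) ^ 2 := by gcongr
            _ = (z ^ 2 * (incBound L * (2 * (∫⁻ x, suppInd φ x) * c))) ^ 2 * (s * s) := by ring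
            _ ≤ (z ^ 2 * (incBound L * (2 * (∫⁻ x, suppInd φ x) * c))) ^ 2 * (s * 1) := by gcongr
            _ = _ := by rw [mul_one]
    _ = _ := by rw [deviationConst]; ring

/-- The first moment under `π` is `z² ∫ K`. -/
lemma ae_sumPairs_ne_top [Nonempty (Fin d)] (hπ : IsPoisson z π) (hK : Measurable K)
    (hT : ∫⁻ x, K x ≠ ∞) : ∀ᵐ γ ∂π, sumPairs K γ ≠ ∞ := by
  have := hπ.isProbabilityMeasure
  have h := hπ.isMecke.lintegral_S2 (K := Function.curry K) (by simpa using hK)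
  have hm : Measurable fun x => ∫⁻ y, K (x, y) := hK.lintegral_prod_right'
  have h2 : ∫⁻ x, ∫⁻ y, Function.curry K x y ∂(intensity d z) ∂(intensity d z)
      = z * (z * ∫⁻ x, K x) := by
    simp only [lintegral_intensity, Function.curry_apply]
    rw [lintegral_const_mul _ hm, Measure.volume_eq_prod, lintegral_prod _ hK.aemeasurable]
  rw [h2] at h
  filter_upwards [ae_lt_top (measurable_sumPairs hK) (h.trans_ne (by finiteness))] with γ hγ
  exact hγ.ne

end

end
end BinaryJumps

namespace BinaryJumps

noncomputable section

variable {d : ℕ}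

open Config

/-! ### Bounds in terms of the smearing -/

/-- A symmetric jump measure `α` of mass `A` and a bounded even rate `b`, such that the indicator of
the support of `φ` and the rate are at most `s` when smeared with `α`. -/
structure SmearBound (α : Measure (E d)) (b : E d → ℝ≥0) (M : ℝ≥0) (φ : E d → ℝ) (A s : ℝ≥0∞) :
    Prop where
  finite : IsFiniteMeasure α
  map_neg : (α.prod α).map Neg.neg = α.prod α
  univ : α Set.univ = A
  meas : Measurable b
  even : ∀ x, b (-x) = b x
  le : ∀ x, b x ≤ M
  int : ∫⁻ x, (b x : ℝ≥0∞) ≠ ∞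
  supp : ∀ x, smear α (suppInd φ) x ≤ s
  rate : ∀ x, smear α (fun y => b y) x ≤ s
  le_one : s ≤ 1

section

variable {μ : Measure (E d × E d)} {b : E d → ℝ≥0} {v v' : E d × E d → E d × E d → ℝ≥0∞}

lemma jumpPre_le_mul (hb : Measurable b) (hv : Measurable (Function.uncurry v)) {c : ℝ≥0∞}
    (h : ∀ x y, v' x y ≤ c * v x y) (x : E d × E d) :
    jumpPre μ b v' x ≤ c * jumpPre μ b v x := by
  have h1 : Measurable fun h => (pairRate b x : ℝ≥0∞) * v x (x + h) :=
    (measurable_pre hb hv).comp (f := fun h : E d × E d => (x, h)) (by fun_prop)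
  rw [jumpPre, jumpPre, ← lintegral_mul_const_mul μ h1 c]
  exact lintegral_mono fun y => mul_le_mul_right (h _ _) _

lemma jumpPost_le_mul (hb : Measurable b) (hv : Measurable (Function.uncurry v)) {c : ℝ≥0∞}
    (h : ∀ x y, v' x y ≤ c * v x y) (x : E d × E d) :
    jumpPost μ b v' x ≤ c * jumpPost μ b v x := by
  have h1 : Measurable fun h => (pairRate b (x + h) : ℝ≥0∞) * v x (x + h) :=
    (measurable_post hb hv).comp (f := fun h : E d × E d => (x, h)) (by fun_prop)
  rw [jumpPost, jumpPost, ← lintegral_mul_const_mul μ h1 c]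
  exact lintegral_mono fun y => mul_le_mul_right (h _ _) _

end

section

variable {z : ℝ≥0} {π : Measure (Config d)} {φ : E d → ℝ} {L : ℝ} {α : Measure (E d)}
  {b : E d → ℝ≥0} {M : ℝ≥0} {A s : ℝ≥0∞} {v : E d × E d → E d × E d → ℝ≥0∞}

lemma SmearBound.ne_top (h : SmearBound α b M φ A s) : A ≠ ∞ ∧ s ≠ ∞ := by
  have := h.finite
  exact ⟨by rw [← h.univ]; exact measure_ne_top _ _, ne_top_of_le_ne_top ENNReal.one_ne_top h.le_one⟩

/-- The constant in the bounds for the births. -/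
def birthConst (b : E d → ℝ≥0) (M : ℝ≥0) (φ : E d → ℝ) (L : ℝ) (A : ℝ≥0∞) : ℝ≥0∞ :=
  incBound L * (2 * A * ((∫⁻ x, (b x : ℝ≥0∞)) + (∫⁻ x, suppInd φ x) + M))

/-- The bound for the total rate of the births. -/
def birthTotal (b : E d → ℝ≥0) (φ : E d → ℝ) (L : ℝ) (A : ℝ≥0∞) : ℝ≥0∞ :=
  incBound L * (4 * (∫⁻ x, (b x : ℝ≥0∞)) * A ^ 2 * ∫⁻ x, suppInd φ x)

/-- The constant in the bound for the fluctuations of the births. -/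
def birthDeviation (π : Measure (Config d)) (z : ℝ≥0) (b : E d → ℝ≥0) (M : ℝ≥0) (φ : E d → ℝ)
    (L : ℝ) (A : ℝ≥0∞) : ℝ≥0∞ :=
  deviationConst π z φ L (birthTotal b φ L A) (birthConst b M φ L A)

lemma birthTotal_ne_top (hs : HasCompactSupport φ) (hb : ∫⁻ x, (b x : ℝ≥0∞) ≠ ∞) (L : ℝ)
    (hA : A ≠ ∞) : birthTotal b φ L A ≠ ∞ := by
  have h2 := incBound_ne_top L
  have h3 := lintegral_suppInd_ne_top hs
  unfold birthTotal
  finiteness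

lemma birthConst_ne_top (hs : HasCompactSupport φ) (hb : ∫⁻ x, (b x : ℝ≥0∞) ≠ ∞) (M : ℝ≥0) (L : ℝ)
    (hA : A ≠ ∞) : birthConst b M φ L A ≠ ∞ := by
  have h2 := incBound_ne_top L
  have h3 := lintegral_suppInd_ne_top hs
  unfold birthConst
  finiteness

lemma SmearBound.lintegral_jumpPre_le (h : SmearBound α b M φ A s) (hφ : Continuous φ)
    (hv : ∀ x y, v x y ≤ incBound L * majBirth (suppInd φ) x y) :
    ∫⁻ x, jumpPre (α.prod α) b v x ≤ birthTotal b φ L A := by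
  have := h.finite
  have hk := measurable_suppInd hφ
  have hm := measurable_jumpPre (μ := α.prod α) h.meas (measurable_majTotal hk)
  rw [birthTotal, ← h.univ, ← lintegral_jumpPre_majTotal h.meas h.even hk,
    ← lintegral_const_mul _ hm]
  refine lintegral_mono (jumpPre_le_mul h.meas (measurable_majTotal hk) fun x y => ?_)
  exact (hv x y).trans (mul_le_mul_right le_add_self _)

lemma SmearBound.lintegral_jumpPost_le (h : SmearBound α b M φ A s) (hφ : Continuous φ)
    (hv : ∀ x y, v x y ≤ incBound L * majBirth (suppInd φ) x y) :
    ∫⁻ x, jumpPost (α.prod α) b v x ≤ birthTotal b φ L A := by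
  have := h.finite
  have hk := measurable_suppInd hφ
  have hvm := measurable_majTotal hk
  have hm := measurable_jumpPost (μ := α.prod α) h.meas hvm
  -- The larger majorant `majTotal` is used because it is symmetric in start and end, so that
  -- reversal of the jumps reproduces it.
  have e : (fun x y : E d × E d => majTotal (suppInd φ) y x) = majTotal (suppInd φ) := by
    ext x y; exact add_comm _ _
  have e2 := lintegral_jumpPost h.map_neg h.meas hvm
  rw [e] at e2
  rw [birthTotal, ← h.univ, ← lintegral_jumpPre_majTotal h.meas h.even hk, ← e2,
    ← lintegral_const_mul _ hm]
  refine lintegral_mono (jumpPost_le_mul h.meas hvm fun x y => ?_)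
  exact (hv x y).trans (mul_le_mul_right le_add_self _)

/-- A birth seen in the support of `φ` needs a jump from a given position into this support, which
has weight `O(s)`; so rows and supremum are `O(s)`, while the total over all pairs is bounded
uniformly. -/
lemma SmearBound.lintegral_deviation_pre_le [Nonempty (Fin d)] (h : SmearBound α b M φ A s)
    (hπ : IsPoisson z π) (hφ : Continuous φ) (hs : HasCompactSupport φ) (hL : ∀ x, |φ x| ≤ L)
    (hvm : Measurable (Function.uncurry v))
    (hv : ∀ x y, v x y ≤ incBound L * majBirth (suppInd φ) x y)
    (hvs : ∀ x y, v x.swap y.swap = v x y) :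
    ∫⁻ γ, deviation z (jumpPre (α.prod α) b v) γ ^ 2 ∂(tilted π φ)
      ≤ birthDeviation π z b M φ L A * s := by
  have := h.finite
  have hk := measurable_suppInd hφ
  have hle := jumpPre_le_mul (μ := α.prod α) h.meas (measurable_majBirth hk) hv
  refine lintegral_deviation_sq_le hL hπ hφ hs (measurable_jumpPre h.meas hvm)
    (jumpPre_swap Measure.prod_swap h.even hvs) (fun x => ?_) (fun x => ?_)
    (h.lintegral_jumpPre_le hφ hv) (birthTotal_ne_top hs h.int L h.ne_top.1) h.le_one
  · have hm : Measurable fun y => jumpPre (α.prod α) b (majBirth (suppInd φ)) (x, y) :=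
      (measurable_jumpPre h.meas (measurable_majBirth hk)).comp measurable_prodMk_left
    calc _ ≤ ∫⁻ y, incBound L * jumpPre (α.prod α) b (majBirth (suppInd φ)) (x, y) :=
          lintegral_mono fun y => hle (x, y)
      _ ≤ incBound L * (2 * α Set.univ * s * ∫⁻ x, b x) := by
          rw [lintegral_const_mul _ hm]
          gcongr
          exact lintegral_jumpPre_majBirth_right_le h.meas hk h.supp x
      _ = incBound L * (2 * A * (∫⁻ x, b x)) * s := by rw [h.univ]; ring
      _ ≤ _ := by
          rw [birthConst]
          gcongr
          rw [add_assoc]; exact le_self_add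
  · calc _ ≤ incBound L * (pairRate b x * (2 * α Set.univ * s)) :=
          (hle x).trans (mul_le_mul_right (jumpPre_majBirth_le hk h.supp x) _)
      _ ≤ incBound L * (M * (2 * α Set.univ * s)) := by
          gcongr
          exact h.le _
      _ = incBound L * (2 * A * M) * s := by rw [h.univ]; ring
      _ ≤ _ := by
          rw [birthConst]
          gcongr
          exact le_add_self

/-- As for the rate before the jump, except that the row integrals also need the smeared rate to be
small: the rate now depends on the endpoint, which may itself be pinned to the support of `φ`. -/
lemma SmearBound.lintegral_deviation_post_le [Nonempty (Fin d)] (h : SmearBound α b M φ A s)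
    (hπ : IsPoisson z π) (hφ : Continuous φ) (hs : HasCompactSupport φ) (hL : ∀ x, |φ x| ≤ L)
    (hvm : Measurable (Function.uncurry v))
    (hv : ∀ x y, v x y ≤ incBound L * majBirth (suppInd φ) x y)
    (hvs : ∀ x y, v x.swap y.swap = v x y) :
    ∫⁻ γ, deviation z (jumpPost (α.prod α) b v) γ ^ 2 ∂(tilted π φ)
      ≤ birthDeviation π z b M φ L A * s := by
  have := h.finite
  have hk := measurable_suppInd hφ
  have hle := jumpPost_le_mul (μ := α.prod α) h.meas (measurable_majBirth hk) hv
  refine lintegral_deviation_sq_le hL hπ hφ hs (measurable_jumpPost h.meas hvm)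
    (jumpPost_swap Measure.prod_swap h.even hvs) (fun x => ?_) (fun x => ?_)
    (h.lintegral_jumpPost_le hφ hv) (birthTotal_ne_top hs h.int L h.ne_top.1) h.le_one
  · have hm : Measurable fun y => jumpPost (α.prod α) b (majBirth (suppInd φ)) (x, y) :=
      (measurable_jumpPost h.meas (measurable_majBirth hk)).comp measurable_prodMk_left
    calc _ ≤ ∫⁻ y, incBound L * jumpPost (α.prod α) b (majBirth (suppInd φ)) (x, y) :=
          lintegral_mono fun y => hle (x, y)
      _ ≤ incBound L * (α Set.univ * s * ((∫⁻ x, b x) + ∫⁻ x, suppInd φ x)) := by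
          rw [lintegral_const_mul _ hm]
          gcongr
          exact lintegral_jumpPost_majBirth_right_le h.meas h.even hk h.supp h.rate x
      _ = incBound L * (1 * A * ((∫⁻ x, b x) + ∫⁻ x, suppInd φ x)) * s := by rw [h.univ]; ring
      _ ≤ _ := by
          rw [birthConst]
          exact mul_le_mul_left (mul_le_mul_right (mul_le_mul' (mul_le_mul_left one_le_two A)
            le_self_add) _) s
  · calc _ ≤ incBound L * (M * (2 * α Set.univ * s)) :=
          (hle x).trans (mul_le_mul_right (jumpPost_majBirth_le h.le hk h.supp x) _)
      _ = incBound L * (2 * A * M) * s := by rw [h.univ]; ring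
      _ ≤ _ := by
          rw [birthConst]
          gcongr
          exact le_add_self

/-! ### The mixed terms -/

lemma majMixed_swap (k : E d → ℝ≥0∞) (x y : E d × E d) :
    majMixed k x.swap y.swap = majMixed k x y := by
  simp only [majMixed, sum2_swap, Prod.fst_swap, Prod.snd_swap, mul_comm (k y.2)]

lemma measurable_mixedMajorant {μ : Measure (E d × E d)} [SFinite μ] (hb : Measurable b)
    (hφ : Continuous φ) : Measurable (mixedMajorant μ b φ) := by
  have hmm := measurable_majMixed (measurable_suppInd hφ)
  exact (measurable_jumpPre hb hmm).add (measurable_jumpPost hb (hmm.comp measurable_swap))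

/-- Reversal of the jumps turns the second half of the majorant into the first, so the constant `5`
doubles. -/
lemma SmearBound.lintegral_mixedMajorant_le (h : SmearBound α b M φ A s) (hφ : Continuous φ) :
    ∫⁻ x, mixedMajorant (α.prod α) b φ x
      ≤ 10 * A * (∫⁻ x, b x) * (∫⁻ x, suppInd φ x) * s := by
  have := h.finite
  have hk := measurable_suppInd hφ
  have hmm := measurable_majMixed hk
  have hmm' : Measurable (Function.uncurry fun x y => majMixed (suppInd φ) y x) :=
    hmm.comp measurable_swap
  have h1 := lintegral_jumpPre_majMixed_le (α := α) h.meas h.even hk h.supp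
  simp only [mixedMajorant]
  rw [lintegral_add_left (measurable_jumpPre h.meas hmm), lintegral_jumpPost h.map_neg h.meas hmm']
  refine (add_le_add h1 h1).trans_eq ?_
  rw [h.univ]; ring

/-- The constant in the bound for the mixed terms. -/
def mixedConst (π : Measure (Config d)) (z : ℝ≥0) (b : E d → ℝ≥0) (M : ℝ≥0) (φ : E d → ℝ)
    (L : ℝ) (A : ℝ≥0∞) : ℝ≥0∞ :=
  tilted π φ Set.univ * ((tiltBound z L ^ 2 * (10 * A * (∫⁻ x, b x) * ∫⁻ x, suppInd φ x)) ^ 2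
    + (tiltBound z L ^ 2 * (10 * A * (∫⁻ x, b x) * ∫⁻ x, suppInd φ x))
      * (2 * (2 * (tiltBound z L * (10 * A ^ 2 * ∫⁻ x, b x))) + 2 * (M * 10 * A ^ 2)))

lemma mixedConst_ne_top (hπ : IsPoisson z π) (hφ : Continuous φ) (hs : HasCompactSupport φ)
    (hb : ∫⁻ x, (b x : ℝ≥0∞) ≠ ∞) (M : ℝ≥0) (L : ℝ) (hA : A ≠ ∞) :
    mixedConst π z b M φ L A ≠ ∞ := by
  have := isFiniteMeasure_tilted hπ hφ hs
  have h1 := tiltBound_ne_top z L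
  have h3 := lintegral_suppInd_ne_top hs
  unfold mixedConst
  finiteness

/-- In contrast to the births, smallness comes from the total integral: it is `O(s)`, while rows and
supremum need only be bounded. -/
lemma SmearBound.lintegral_mixedMajorant_sq_le [Nonempty (Fin d)] (h : SmearBound α b M φ A s)
    (hπ : IsPoisson z π) (hφ : Continuous φ) (hs : HasCompactSupport φ) (hL : ∀ x, |φ x| ≤ L) :
    ∫⁻ γ, sumPairs (mixedMajorant (α.prod α) b φ) γ ^ 2 ∂(tilted π φ)
      ≤ mixedConst π z b M φ L A * s := by
  have := h.finite
  have hmm := measurable_majMixed (measurable_suppInd hφ)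
  have hle := majMixed_le_five φ
  have hle' : ∀ x y : E d × E d, majMixed (suppInd φ) y x ≤ 5 := fun x y => hle y x
  have hsw := majMixed_swap (suppInd φ)
  have hT := h.lintegral_mixedMajorant_le hφ
  refine (lintegral_sumPairs_sq_le (R := 10 * A ^ 2 * ∫⁻ x, b x) (S := M * 10 * A ^ 2)
    hπ hφ hs hL (measurable_mixedMajorant h.meas hφ) (fun x => ?_) (fun x => ?_)
    (fun x => ?_)).trans ?_
  · simp only [mixedMajorant]
    rw [jumpPre_swap Measure.prod_swap h.even hsw,
      jumpPost_swap Measure.prod_swap h.even (fun x y => hsw y x)]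
  · have hm : Measurable fun y => jumpPre (α.prod α) b (majMixed (suppInd φ)) (x, y) :=
      (measurable_jumpPre h.meas hmm).comp measurable_prodMk_left
    simp only [mixedMajorant]
    rw [lintegral_add_left hm]
    refine (add_le_add (lintegral_jumpPre_right_le h.meas hle x)
      (lintegral_jumpPost_right_le h.meas hle' x)).trans_eq ?_
    rw [h.univ]; ring
  · refine (add_le_add (jumpPre_le h.le hle x) (jumpPost_le h.le hle' x)).trans_eq ?_
    rw [h.univ]; ring
  · calc _ ≤ tilted π φ Set.univ *
          ((tiltBound z L ^ 2 * (10 * A * (∫⁻ x, b x) * (∫⁻ x, suppInd φ x) * s)) ^ 2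
          + (tiltBound z L ^ 2 * (10 * A * (∫⁻ x, b x) * (∫⁻ x, suppInd φ x) * s))
            * (2 * (2 * (tiltBound z L * (10 * A ^ 2 * ∫⁻ x, b x))) + 2 * (M * 10 * A ^ 2))) := by
          gcongr
      _ = tilted π φ Set.univ *
          ((tiltBound z L ^ 2 * (10 * A * (∫⁻ x, b x) * (∫⁻ x, suppInd φ x))) ^ 2 * (s * s)
          + (tiltBound z L ^ 2 * (10 * A * (∫⁻ x, b x) * (∫⁻ x, suppInd φ x)))
            * (2 * (2 * (tiltBound z L * (10 * A ^ 2 * ∫⁻ x, b x))) + 2 * (M * 10 * A ^ 2)) * s) := by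
          ring
      _ ≤ tilted π φ Set.univ *
          ((tiltBound z L ^ 2 * (10 * A * (∫⁻ x, b x) * (∫⁻ x, suppInd φ x))) ^ 2 * (1 * s)
          + (tiltBound z L ^ 2 * (10 * A * (∫⁻ x, b x) * (∫⁻ x, suppInd φ x)))
            * (2 * (2 * (tiltBound z L * (10 * A ^ 2 * ∫⁻ x, b x))) + 2 * (M * 10 * A ^ 2)) * s) := by
          gcongr; exact h.le_one
      _ = _ := by rw [mixedConst]; ring

/-! ### The smeared deaths -/

/-- The error made when the smeared death rate is replaced by its mean. -/
def deathError (α : Measure (E d)) (b : E d → ℝ≥0) (φ : E d → ℝ) (β : ℝ) (γ : Config d) : ℝ≥0∞ :=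
  ∫⁻ x, ‖expInc (-φ) x‖ₑ * sqDev (Function.curry (smearRate α b)) β γ x ^ (1 / 2 : ℝ) ∂γ.toMeasure

/-- The constant in the bound for the fluctuations of the smeared rate. -/
def rateConst (z : ℝ≥0) (b : E d → ℝ≥0) (φ : E d → ℝ) (L : ℝ) (A : ℝ≥0∞) : ℝ≥0∞ :=
  2 * (A * (tiltBound z L * (A ^ 2 * ∫⁻ x, b x))
    + (z * (incBound L * (A * ∫⁻ x, suppInd φ x))) ^ 2)

/-- The constant in the bound for the smeared deaths. -/
def deathConst (π : Measure (Config d)) (z : ℝ≥0) (b : E d → ℝ≥0) (φ : E d → ℝ) (L : ℝ)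
    (A : ℝ≥0∞) : ℝ≥0∞ :=
  tilted π φ Set.univ * (tiltBound z L * (incBound L * ∫⁻ x, suppInd φ x))
    * (2 * (tiltBound z L * (incBound L * ∫⁻ x, suppInd φ x)) * (rateConst z b φ L A + A ^ 2)
      + incBound L * rateConst z b φ L A)

lemma deathConst_ne_top (hπ : IsPoisson z π) (hφ : Continuous φ) (hs : HasCompactSupport φ)
    (hb : ∫⁻ x, (b x : ℝ≥0∞) ≠ ∞) (L : ℝ) (hA : A ≠ ∞) : deathConst π z b φ L A ≠ ∞ := by
  have := isFiniteMeasure_tilted hπ hφ hs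
  have h1 := tiltBound_ne_top z L
  have h2 := incBound_ne_top L
  have h3 := lintegral_suppInd_ne_top hs
  unfold deathConst rateConst
  finiteness

lemma measurable_enorm_expInc (hφ : Continuous φ) : Measurable fun x => ‖expInc φ x‖ₑ :=
  (continuous_expInc hφ).measurable.enorm

lemma measurable_deathError (hb : Measurable b) [IsFiniteMeasure α] (hφ : Continuous φ) (β : ℝ) :
    Measurable (deathError α b φ β) := by
  have hB : Measurable (Function.uncurry (Function.curry (smearRate α b))) := by
    simpa using measurable_smearRate hb
  exact measurable_lintegral_toMeasure measurable_id
    (f := fun γ x => ‖expInc (-φ) x‖ₑ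
      * sqDev (Function.curry (smearRate α b)) β γ x ^ (1 / 2 : ℝ))
    (((measurable_enorm_expInc hφ.neg).comp measurable_snd).mul
      ((measurable_sqDev hB β).pow_const _))

/-- Tilting alters the intensity only on the support of `φ`, and there the smeared rate is at most
`A s`. The comparison value follows from translation invariance and does not depend on `x` or `ε`.
-/
lemma SmearBound.enorm_rate_sub_le (h : SmearBound α b M φ A s) (z : ℝ≥0) (hφ : Continuous φ)
    (hL : ∀ x, |φ x| ≤ L) (x : E d) :
    ‖(∫⁻ y, smearRate α b (x, y) ∂(tiltedIntensity d z φ)).toReal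
      - (z * (A ^ 2 * ∫⁻ x, (b x : ℝ≥0∞))).toReal‖ₑ
      ≤ z * (incBound L * (A * s * ∫⁻ x, suppInd φ x)) := by
  have := h.finite
  have hk := measurable_suppInd hφ
  have hB : Measurable fun y => smearRate α b (x, y) :=
    (measurable_smearRate h.meas).comp measurable_prodMk_left
  have hkB : Measurable fun y => suppInd φ y * smearRate α b (x, y) := hk.mul hB
  have hint : ∫⁻ y, smearRate α b (x, y) = A ^ 2 * ∫⁻ x, (b x : ℝ≥0∞) := by
    rw [lintegral_smearRate_right h.meas, h.univ]
  have hA := h.ne_top.1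
  have hb := h.int
  have hexp : ∀ y, ‖Real.exp (2 * φ y) - 1‖ₑ ≤ incBound L * suppInd φ y := fun y =>
    (enorm_exp_sub_one_le (T := 4 * L)
      (by rw [abs_mul, abs_two]; linarith [hL y, (abs_nonneg (φ y)).trans (hL y)])
      fun h => one_le_suppInd fun h0 => h (by rw [h0, mul_zero]))
  have hcmp := fun y => le_add_of_enorm_sub_one_le (Real.exp_nonneg (2 * φ y)) (hexp y)
  have hD : ∫⁻ y, incBound L * (suppInd φ y * smearRate α b (x, y))
      ≤ incBound L * (A * s * ∫⁻ x, suppInd φ x) := by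
    rw [lintegral_const_mul _ hkB]
    gcongr
    rw [← lintegral_const_mul _ hk]
    refine lintegral_mono fun y => ?_
    rw [mul_comm, ← h.univ]
    exact mul_le_mul_left (smearRate_le h.meas h.rate _) _
  have hfin : ∫⁻ y, smearRate α b (x, y) ∂(tiltedIntensity d z φ) ≠ ∞ := by
    refine ne_top_of_le_ne_top ?_ (lintegral_tiltedIntensity_le (z := z) hL _)
    rw [hint]
    exact ENNReal.mul_ne_top (tiltBound_ne_top z L) (by finiteness)
  refine enorm_toReal_sub_le hfin (by finiteness) ?_ ?_
  · rw [lintegral_tiltedIntensity_eq z hφ hB, ← mul_add, ← hint]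
    gcongr
    refine le_trans ?_ (add_le_add le_rfl hD)
    rw [← lintegral_add_left hB]
    refine lintegral_mono fun y => ?_
    calc _ ≤ (1 + incBound L * suppInd φ y) * smearRate α b (x, y) := by
          gcongr; exact (hcmp y).1
      _ = _ := by ring
  · rw [lintegral_tiltedIntensity_eq z hφ hB, ← mul_add, ← hint]
    gcongr
    refine le_trans ?_ (add_le_add le_rfl hD)
    rw [← lintegral_add_right _ (hkB.const_mul _)]
    refine lintegral_mono fun y => ?_
    calc smearRate α b (x, y) = 1 * smearRate α b (x, y) := (one_mul _).symm
      _ ≤ (ENNReal.ofReal (Real.exp (2 * φ y)) + incBound L * suppInd φ y)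
          * smearRate α b (x, y) := by gcongr; exact (hcmp y).2
      _ = _ := by ring

/-- The smeared rate is at most `A s` with bounded row integral, so its sum over the other particles
has variance `O(s)` about its mean, and the bias is `O(s)` by `enorm_rate_sub_le`. The outer sum
over dying particles has an integrable weight and is handled by `lintegral_weighted_sqDev_le`. -/
lemma SmearBound.lintegral_deathError_sq_le [Nonempty (Fin d)] (h : SmearBound α b M φ A s)
    (hπ : IsPoisson z π) (hφ : Continuous φ) (hs : HasCompactSupport φ) (hL : ∀ x, |φ x| ≤ L) :
    ∫⁻ γ, deathError α b φ (z * (A ^ 2 * ∫⁻ x, (b x : ℝ≥0∞))).toReal γ ^ 2 ∂(tilted π φ)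
      ≤ deathConst π z b φ L A * s := by
  have := h.finite
  have := isFiniteMeasure_tilted hπ hφ hs
  have hA := h.ne_top.1
  have hs' := h.ne_top.2
  have hb := h.int
  have hk := measurable_suppInd hφ
  have hB : Measurable (Function.uncurry (Function.curry (smearRate α b))) := by
    simpa using measurable_smearRate h.meas
  have hBs : ∀ x y, Function.curry (smearRate α b) x y ≤ A * s := fun x y => by
    rw [← h.univ]; exact smearRate_le h.meas h.rate _
  have hss : s ^ 2 ≤ s := by
    rw [sq]; exact (mul_le_mul_left h.le_one s).trans_eq (one_mul s)
  have hχ : ∀ x, ‖expInc (-φ) x‖ₑ ≤ incBound L * suppInd φ x := fun x => by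
    have := enorm_expInc_le (abs_neg_le hL) x
    rwa [suppInd_neg] at this
  have hΔ : ∀ x, ∫⁻ γ, sqDev (Function.curry (smearRate α b))
      (z * (A ^ 2 * ∫⁻ x, (b x : ℝ≥0∞))).toReal γ x ∂(tilted π φ)
      ≤ tilted π φ Set.univ * (rateConst z b φ L A * s) := by
    intro x
    refine ((isMecke_tilted hπ hφ hs).lintegral_sqDev_le hB _
      (R := tiltBound z L * (A ^ 2 * ∫⁻ x, b x))
      (δ := (z * (incBound L * (A * s * ∫⁻ x, suppInd φ x))) ^ 2) hBs (fun x => ?_) ?_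
      (fun x => ?_) x).trans ?_
    · refine (lintegral_tiltedIntensity_le hL _).trans_eq ?_
      rw [← h.univ, ← lintegral_smearRate_right h.meas x]; rfl
    · exact ENNReal.mul_ne_top (tiltBound_ne_top z L) (by finiteness)
    · rw [← enorm_sq_eq]
      gcongr
      exact h.enorm_rate_sub_le z hφ hL x
    · refine mul_le_mul_right ?_ _
      calc _ = 2 * (A * (tiltBound z L * (A ^ 2 * ∫⁻ x, b x)) * s
            + (z * (incBound L * (A * ∫⁻ x, suppInd φ x))) ^ 2 * s ^ 2) := by ring
        _ ≤ 2 * (A * (tiltBound z L * (A ^ 2 * ∫⁻ x, b x)) * s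
            + (z * (incBound L * (A * ∫⁻ x, suppInd φ x))) ^ 2 * s) := by gcongr
        _ = _ := by rw [rateConst]; ring
  have hint : ∫⁻ x, ‖expInc (-φ) x‖ₑ ∂(tiltedIntensity d z φ)
      ≤ tiltBound z L * (incBound L * ∫⁻ x, suppInd φ x) := by
    refine (lintegral_tiltedIntensity_le hL _).trans ?_
    gcongr
    rw [← lintegral_const_mul _ hk]
    exact lintegral_mono hχ
  refine ((isMecke_tilted hπ hφ hs).lintegral_weighted_sqDev_le hB _ hBs (by finiteness) hΔ
    (measurable_enorm_expInc hφ.neg) (κ := incBound L) fun x => ?_).trans ?_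
  · refine (hχ x).trans ?_
    calc _ ≤ incBound L * 1 := by gcongr; exact suppInd_le_one _ _
      _ = _ := mul_one _
  · calc _ ≤ tilted π φ Set.univ * (tiltBound z L * (incBound L * ∫⁻ x, suppInd φ x))
        * (2 * (tiltBound z L * (incBound L * ∫⁻ x, suppInd φ x))
          * (rateConst z b φ L A * s + A ^ 2 * s ^ 2)
        + incBound L * (rateConst z b φ L A * s)) := by
          rw [← mul_pow]
          gcongr
      _ ≤ tilted π φ Set.univ * (tiltBound z L * (incBound L * ∫⁻ x, suppInd φ x))
        * (2 * (tiltBound z L * (incBound L * ∫⁻ x, suppInd φ x))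
          * (rateConst z b φ L A * s + A ^ 2 * s)
        + incBound L * (rateConst z b φ L A * s)) := by gcongr
      _ = _ := by rw [deathConst]; ring

end

end
end BinaryJumps

namespace BinaryJumps

noncomputable section

variable {d : ℕ}

open Config

/-! ### Total rates of the births -/

section

variable {α : Measure (E d)} [IsFiniteMeasure α] {b : E d → ℝ≥0}

/-- Integrated over the starting pair, smearing only multiplies by the mass of `α`. The total
depends on `α` through its mass alone, which makes the limit explicit. -/
lemma lintegral_jumpPre_singleBirth (hb : Measurable b) (hbe : ∀ x, b (-x) = b x) {f : E d → ℝ}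
    (hf : Measurable f) :
    ∫⁻ x, jumpPre (α.prod α) b (singleBirth f) x
      = 2 * α Set.univ ^ 2 * (∫⁻ x, b x) * ∫⁻ x, ENNReal.ofReal (f x) := by
  have hk := hf.ennreal_ofReal
  have hm2 : Measurable fun x => (pairRate b x : ℝ≥0∞)
      * sum2 (smear α fun u => ENNReal.ofReal (f u)) x :=
    (measurable_pairRate hb).coe_nnreal_ennreal.mul (measurable_sum2 (measurable_smear hk))
  have e : ∀ x, jumpPre (α.prod α) b (singleBirth f) x
      = α Set.univ * (pairRate b x * sum2 (smear α fun u => ENNReal.ofReal (f u)) x) := by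
    intro x
    rw [jumpPre_eq (measurable_singleBirth hf)]
    simp only [singleBirth]
    rw [lintegral_sum2_shift hk]
    ring
  simp only [e]
  rw [lintegral_const_mul _ hm2, lintegral_pairRate_sum2 hb hbe (measurable_smear hk),
    lintegral_smear hk]
  ring

/-- After reversing the jumps, rate and function are both evaluated at the starting pair, and the
jumps integrate out. -/
lemma lintegral_jumpPost_jointBirth (hμ : (α.prod α).map Neg.neg = α.prod α) (hb : Measurable b)
    {f : E d × E d → ℝ} (hf : Measurable f) :
    ∫⁻ x, jumpPost (α.prod α) b (jointBirth f) x
      = α Set.univ ^ 2 * ∫⁻ x, pairRate b x * ENNReal.ofReal (f x) := by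
  have hm : Measurable fun x => (pairRate b x : ℝ≥0∞) * ENNReal.ofReal (f x) :=
    (measurable_pairRate hb).coe_nnreal_ennreal.mul hf.ennreal_ofReal
  rw [lintegral_jumpPost hμ hb (measurable_jointBirth hf), ← lintegral_const_mul _ hm]
  refine lintegral_congr fun x => ?_
  simp only [jumpPre, jointBirth]
  rw [lintegral_const, prod_univ_eq, mul_comm]

end

/-! ### The limiting generator on exponential functions -/

section

variable {z : ℝ≥0} {φ : E d → ℝ} {L : ℝ} {a b : E d → ℝ≥0∞}

lemma hasCompactSupport_expInc (hs : HasCompactSupport φ) : HasCompactSupport (expInc φ) :=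
  hs.comp_left (g := fun t => Real.exp t - 1) (by simp)

lemma expFun_remove (hs : HasCompactSupport φ) {γ : Config d} {x : E d} (hx : x ∈ γ.1) :
    expFun φ (γ.remove x) - expFun φ γ = expFun φ γ * expInc (-φ) x := by
  rw [expFun, expFun, pair_remove γ hs hx, expInc, Pi.neg_apply, sub_eq_add_neg (pair φ γ),
    Real.exp_add]
  ring

lemma expFun_remove_remove (hs : HasCompactSupport φ) {γ : Config d} {p : E d × E d}
    (hp : p ∈ γ.orderedPairs) :
    expFun φ ((γ.remove p.1).remove p.2) - expFun φ γ = expFun φ γ * expInc2 (-φ) p := by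
  rw [expFun, expFun, pair_remove_remove γ hs hp.1 hp.2.1 hp.2.2, expInc2, pairVal_neg, pairVal,
    sub_sub, sub_eq_add_neg (pair φ γ), Real.exp_add]
  ring

lemma expFun_add (hs : HasCompactSupport φ) {γ : Config d} {x : E d} (hx : x ∉ γ.1) :
    expFun φ (γ.add x) - expFun φ γ = expFun φ γ * expInc φ x := by
  rw [expFun, expFun, pair_add γ hs hx, expInc, Real.exp_add]
  ring

lemma expFun_add_add (hs : HasCompactSupport φ) {γ : Config d} {p : E d × E d}
    (h1 : p.1 ∉ γ.1) (h2 : p.2 ∉ γ.1) (h12 : p.1 ≠ p.2) :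
    expFun φ ((γ.add p.1).add p.2) - expFun φ γ = expFun φ γ * expInc2 φ p := by
  have h3 : p.2 ∉ (γ.add p.1).1 := fun h => (mem_add.1 h).elim (fun h => h12 h.symm) h2
  rw [expFun, expFun, pair_add _ hs h3, pair_add γ hs h1, expInc2, pairVal, add_assoc, Real.exp_add]
  ring

lemma intensity_absolutelyContinuous (d : ℕ) (z : ℝ≥0) : intensity d z ≪ volume :=
  Measure.smul_absolutelyContinuous

lemma ae_expFun_add_add [Nonempty (Fin d)] (hb : Measurable b) (hbb : essSup b volume ≠ ∞)
    (hs : HasCompactSupport φ) (γ : Config d) :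
    ∀ᵐ p ∂((intensity d z).prod (intensity d z)),
      (b (p.2 - p.1)).toReal * (expFun φ ((γ.add p.1).add p.2) - expFun φ γ)
        = expFun φ γ * (pairRate (boundedRate b) p * expInc2 φ p) := by
  -- Jumps from the origin: with `x = 0` the landing points are the coordinates of `p` themselves.
  filter_upwards [ae_jump_disjoint γ 0 (intensity_absolutelyContinuous d z),
    ae_coe_boundedRate_shift hb hbb 0 (intensity_absolutelyContinuous d z)] with p ⟨h1, h2, h3⟩ h4
  simp only [Prod.fst_zero, Prod.snd_zero, zero_add] at h1 h2 h3 h4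
  rw [expFun_add_add hs h1 h2 h3, h4, ENNReal.coe_toReal]
  ring

lemma ae_expFun_add [Nonempty (Fin d)] (hs : HasCompactSupport φ) (γ : Config d) :
    ∀ᵐ x ∂(intensity d z), expFun φ (γ.add x) - expFun φ γ = expFun φ γ * expInc φ x := by
  filter_upwards [ae_notMem γ (intensity d z)] with x hx
  exact expFun_add hs hx

lemma lintegral_intensity_prod (z : ℝ≥0) {K : E d × E d → ℝ≥0∞} (hK : Measurable K) :
    ∫⁻ x, K x ∂((intensity d z).prod (intensity d z)) = z ^ 2 * ∫⁻ x, K x := by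
  have hm : Measurable fun x => ∫⁻ y, K (x, y) := hK.lintegral_prod_right'
  rw [lintegral_prod _ hK.aemeasurable]
  simp only [lintegral_intensity]
  rw [lintegral_const_mul _ hm, Measure.volume_eq_prod, lintegral_prod _ hK.aemeasurable, sq,
    mul_assoc]

/-- The total rate of joint births, weighted with the positive part of `f`. -/
def jointTotal (b : E d → ℝ≥0) (f : E d × E d → ℝ) : ℝ≥0∞ :=
  ∫⁻ x, pairRate b x * ENNReal.ofReal (f x)

variable (hL : ∀ x, |φ x| ≤ L)

include hL in
lemma jointTotal_ne_top {b : E d → ℝ≥0} (hb : Measurable b) (hbe : ∀ x, b (-x) = b x)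
    (hbi : ∫⁻ x, (b x : ℝ≥0∞) ≠ ∞) (hφ : Continuous φ) (hs : HasCompactSupport φ)
    {f : E d × E d → ℝ} (hf : ∀ x, ‖f x‖ₑ = ‖expInc2 φ x‖ₑ) : jointTotal b f ≠ ∞ := by
  have hk := measurable_suppInd hφ
  have hm : Measurable fun x => (pairRate b x : ℝ≥0∞) * sum2 (suppInd φ) x :=
    (measurable_pairRate hb).coe_nnreal_ennreal.mul (measurable_sum2 hk)
  have h1 := incBound_ne_top L
  have h2 := lintegral_suppInd_ne_top hs
  refine ne_top_of_le_ne_top (b := incBound L * (2 * (∫⁻ x, b x) * ∫⁻ x, suppInd φ x))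
    (by finiteness) ?_
  rw [← lintegral_pairRate_sum2 hb hbe hk, ← lintegral_const_mul _ hm]
  refine lintegral_mono fun x => ?_
  rw [mul_left_comm]
  gcongr
  exact (ofReal_le_enorm _).trans ((hf x).trans_le (enorm_expInc2_le hL x))

include hL in
lemma lintegral_ofReal_expInc_ne_top (hφ : Continuous φ) (hs : HasCompactSupport φ)
    {f : E d → ℝ} (hf : ∀ x, ‖f x‖ₑ = ‖expInc φ x‖ₑ) : ∫⁻ x, ENNReal.ofReal (f x) ≠ ∞ := by
  have h1 := incBound_ne_top L
  have h2 := lintegral_suppInd_ne_top hs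
  refine ne_top_of_le_ne_top (b := incBound L * ∫⁻ x, suppInd φ x) (by finiteness) ?_
  rw [← lintegral_const_mul _ (measurable_suppInd hφ)]
  exact lintegral_mono fun x => (ofReal_le_enorm _).trans ((hf x).trans_le (enorm_expInc_le hL x))

include hL in
lemma integral_jointBirths {b : E d → ℝ≥0} (hb : Measurable b) (hbe : ∀ x, b (-x) = b x)
    (hbi : ∫⁻ x, (b x : ℝ≥0∞) ≠ ∞) (hφ : Continuous φ) (hs : HasCompactSupport φ) :
    Integrable (fun p => (pairRate b p : ℝ) * expInc2 φ p)
      ((intensity d z).prod (intensity d z)) ∧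
    ∫ p, (pairRate b p : ℝ) * expInc2 φ p ∂((intensity d z).prod (intensity d z))
      = z ^ 2 * ((jointTotal b (expInc2 φ)).toReal
        - (jointTotal b fun x => -expInc2 φ x).toReal) := by
  have hf := (continuous_expInc2 hφ).measurable
  have hm : ∀ {f : E d × E d → ℝ}, Measurable f →
      Measurable fun x => (pairRate b x : ℝ≥0∞) * ENNReal.ofReal (f x) := fun hf =>
    (measurable_pairRate hb).coe_nnreal_ennreal.mul hf.ennreal_ofReal
  have h1 : jointTotal b (expInc2 φ) ≠ ∞ := jointTotal_ne_top hL hb hbe hbi hφ hs fun x => rfl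
  have h2 : (jointTotal b fun x => -expInc2 φ x) ≠ ∞ :=
    jointTotal_ne_top hL hb hbe hbi hφ hs fun x => enorm_neg _
  have e1 := lintegral_intensity_prod z (hm hf)
  have e2 := lintegral_intensity_prod z (hm hf.neg)
  have h := integral_eq_toReal_sub (μ := (intensity d z).prod (intensity d z))
    (f := fun p => (pairRate b p : ℝ) * expInc2 φ p) (hm hf) (hm hf.neg)
    (by rw [e1]; exact ENNReal.mul_ne_top (by finiteness) h1)
    (by rw [e2]; exact ENNReal.mul_ne_top (by finiteness) h2)
    (fun p => toReal_mul_ofReal_sub _ _)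
  refine ⟨h.1, h.2.trans ?_⟩
  rw [e1, e2, ENNReal.toReal_mul, ENNReal.toReal_mul, ENNReal.toReal_pow, ENNReal.coe_toReal,
    mul_sub]
  rfl

include hL in
lemma integral_singleBirths (hφ : Continuous φ) (hs : HasCompactSupport φ) :
    Integrable (expInc φ) (intensity d z) ∧
    ∫ x, expInc φ x ∂(intensity d z)
      = z * ((∫⁻ x, ENNReal.ofReal (expInc φ x)).toReal
        - (∫⁻ x, ENNReal.ofReal (-expInc φ x)).toReal) := by
  have hf := (continuous_expInc hφ).measurable
  have h1 : ∫⁻ x, ENNReal.ofReal (expInc φ x) ≠ ∞ :=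
    lintegral_ofReal_expInc_ne_top hL hφ hs fun x => rfl
  have h2 : ∫⁻ x, ENNReal.ofReal (-expInc φ x) ≠ ∞ :=
    lintegral_ofReal_expInc_ne_top hL hφ hs fun x => enorm_neg _
  have e1 := lintegral_intensity z fun x => ENNReal.ofReal (expInc φ x)
  have e2 := lintegral_intensity z fun x => ENNReal.ofReal (-expInc φ x)
  have h := integral_eq_toReal_sub (μ := intensity d z) (f := expInc φ) hf.ennreal_ofReal
    hf.neg.ennreal_ofReal (by rw [e1]; exact ENNReal.mul_ne_top (by finiteness) h1)
    (by exact e2.trans_ne (ENNReal.mul_ne_top (by finiteness) h2))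
    (fun x => by
      rw [Pi.neg_apply, ENNReal.toReal_ofReal', ENNReal.toReal_ofReal',
        max_zero_sub_max_neg_zero_eq_self])
  refine ⟨h.1, h.2.trans ?_⟩
  simp only [Pi.neg_apply]
  rw [e1, e2, ENNReal.toReal_mul, ENNReal.toReal_mul, ENNReal.coe_toReal, mul_sub]

include hL in
/-- The limiting generator on exponential functions. -/
lemma birthDeathGen_eq [Nonempty (Fin d)] (z : ℝ≥0) (hab : Admissible a b) (hφ : Continuous φ)
    (hs : HasCompactSupport φ) {γ : Config d} (hγ : RegularPairs b γ) :
    birthDeathGen a b z (expFun φ) γ = expFun φ γ * (mass a ^ 2 *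
      (1 / 2 * ∑' p : γ.orderedPairs, pairRate (boundedRate b) p.1 * expInc2 (-φ) p
      + 1 / 2 * (z ^ 2 * ((jointTotal (boundedRate b) (expInc2 φ)).toReal
        - (jointTotal (boundedRate b) fun x => -expInc2 φ x).toReal))
      + z * mass b * ∑' x : γ.1, expInc (-φ) x
      + z * mass b * (z * ((∫⁻ x, ENNReal.ofReal (expInc φ x)).toReal
        - (∫⁻ x, ENNReal.ofReal (-expInc φ x)).toReal)))) := by
  have hbm := measurable_boundedRate hab.meas_b
  have hbi : ∫⁻ x, (boundedRate b x : ℝ≥0∞) ≠ ∞ := by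
    rw [lintegral_boundedRate hab.bdd_b]; exact hab.int_b
  have e1 : ∑' p : γ.orderedPairs, (b (p.1.2 - p.1.1)).toReal
      * (expFun φ ((γ.remove p.1.1).remove p.1.2) - expFun φ γ)
      = expFun φ γ * ∑' p : γ.orderedPairs, pairRate (boundedRate b) p.1 * expInc2 (-φ) p := by
    rw [← tsum_mul_left]
    refine tsum_congr fun p => ?_
    rw [expFun_remove_remove hs p.2, hγ p p.2, ENNReal.coe_toReal, pairRate]
    ring
  have e3 : ∑' x : γ.1, (expFun φ (γ.remove x) - expFun φ γ)
      = expFun φ γ * ∑' x : γ.1, expInc (-φ) x := by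
    rw [← tsum_mul_left]
    exact tsum_congr fun x => expFun_remove hs x.2
  rw [birthDeathGen, pairSum, e1, e3, integral_congr_ae (ae_expFun_add_add hab.meas_b hab.bdd_b hs γ),
    integral_congr_ae (ae_expFun_add hs γ), integral_const_mul, integral_const_mul,
    (integral_jointBirths hL hbm (boundedRate_neg hab.even_b) hbi hφ hs).2,
    (integral_singleBirths hL hφ hs).2]
  ring

/-! ### The deaths -/

/-- The majorant of the terms describing the deaths of pairs. -/
def deathMajorant (b : E d → ℝ≥0) (φ : E d → ℝ) (x : E d × E d) : ℝ≥0∞ :=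
  pairRate b x * sum2 (suppInd φ) x

lemma measurable_deathMajorant {b : E d → ℝ≥0} (hb : Measurable b) (hφ : Continuous φ) :
    Measurable (deathMajorant b φ) :=
  (measurable_pairRate hb).coe_nnreal_ennreal.mul (measurable_sum2 (measurable_suppInd hφ))

include hL in
lemma enorm_pairDeath_le (b : E d → ℝ≥0) (x : E d × E d) :
    ‖(pairRate b x : ℝ) * expInc2 (-φ) x‖ₑ ≤ incBound L * deathMajorant b φ x := by
  have h := enorm_expInc2_le (abs_neg_le hL) x
  rw [suppInd_neg] at h
  rw [enorm_mul, Real.enorm_eq_ofReal (NNReal.coe_nonneg _), ENNReal.ofReal_coe_nnreal,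
    deathMajorant, mul_left_comm]
  gcongr

include hL in
lemma summable_pairDeath {b : E d → ℝ≥0} {γ : Config d}
    (h : sumPairs (deathMajorant b φ) γ ≠ ∞) :
    Summable fun p : γ.orderedPairs => (pairRate b p.1 : ℝ) * expInc2 (-φ) p := by
  refine summable_of_enorm_ne_top (ne_top_of_le_ne_top
    (ENNReal.mul_ne_top (incBound_ne_top L) h) ?_)
  rw [sumPairs_eq, ← ENNReal.tsum_mul_left]
  exact ENNReal.tsum_le_tsum fun p => enorm_pairDeath_le hL b p

include hL in
/-- Existence of the limiting generator. -/
lemma birthDeathGenConverges [Nonempty (Fin d)] (z : ℝ≥0) (hab : Admissible a b)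
    (hφ : Continuous φ) (hs : HasCompactSupport φ) {γ : Config d} (hγ : RegularPairs b γ)
    (h : sumPairs (deathMajorant (boundedRate b) φ) γ ≠ ∞) :
    BirthDeathGenConverges b z (expFun φ) γ := by
  have hbm := measurable_boundedRate hab.meas_b
  have hbi : ∫⁻ x, (boundedRate b x : ℝ≥0∞) ≠ ∞ := by
    rw [lintegral_boundedRate hab.bdd_b]; exact hab.int_b
  refine ⟨fun p hp => ?_, ?_, ?_, ?_, ?_⟩
  · rw [hγ p hp]; exact ENNReal.coe_ne_top
  · refine ((summable_pairDeath hL h).mul_left (expFun φ γ)).congr fun p => ?_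
    rw [expFun_remove_remove hs p.2, hγ p p.2, ENNReal.coe_toReal, pairRate]
    ring
  · refine (((integral_jointBirths hL hbm (boundedRate_neg hab.even_b) hbi hφ hs).1.const_mul
      (expFun φ γ)).congr ?_)
    filter_upwards [ae_expFun_add_add hab.meas_b hab.bdd_b hs γ] with p hp
    exact hp.symm
  · refine ((γ.summable_pair (hasCompactSupport_expInc (φ := -φ) ?_)).mul_left
      (expFun φ γ)).congr fun x => (expFun_remove hs x.2).symm
    exact hs.comp_left (g := fun t => -t) (by simp)
  · refine (((integral_singleBirths hL hφ hs).1.const_mul (expFun φ γ)).congr ?_)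
    filter_upwards [ae_expFun_add hs γ] with p hp
    exact hp.symm

/-- Summation of the smeared death rate over the second particle. -/
lemma enorm_tsum_death_sub_le {B : E d × E d → ℝ≥0∞} (hB : ∀ x, B x ≠ ∞) {f : E d → ℝ}
    (hf : HasCompactSupport f) {γ : Config d} (h : sumPairs (fun x => ‖f x.1‖ₑ * B x) γ ≠ ∞)
    (β : ℝ) :
    ‖∑' p : γ.orderedPairs, f p.1.1 * (B p).toReal - β * ∑' x : γ.1, f x‖ₑ
      ≤ ∫⁻ x, ‖f x‖ₑ * sqDev (Function.curry B) β γ x ^ (1 / 2 : ℝ) ∂γ.toMeasure := by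
  classical
  let F : γ.1 × γ.1 → ℝ := fun q => if q.1.1 = q.2.1 then 0 else f q.1 * (B (q.1, q.2)).toReal
  have hBe : ∀ x, ‖(B x).toReal‖ₑ = B x := fun x => by
    rw [Real.enorm_eq_ofReal ENNReal.toReal_nonneg, ENNReal.ofReal_toReal (hB x)]
  have hF : Summable F := by
    refine summable_of_enorm_ne_top ?_
    have e := tsum_orderedPairs_eq γ fun x y => ‖f x‖ₑ * B (x, y)
    have h' : ∑' p : γ.orderedPairs, ‖f p.1.1‖ₑ * B (p.1.1, p.1.2) ≠ ∞ := h
    rw [e] at h'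
    convert h' using 3 with q
    simp only [F]
    split_ifs
    · simp
    · rw [enorm_mul, hBe]
  have e1 : ∑' p : γ.orderedPairs, f p.1.1 * (B p).toReal = ∑' q, F q := by
    have := tsum_orderedPairs_eq γ fun x y => f x * (B (x, y)).toReal
    exact this.trans (tsum_congr fun q => by simp only [F])
  -- No summability over `y` is needed, which matters where `f x = 0`: for an infinite inner sum
  -- both the real `tsum` and `toReal` give zero.
  have e2 : ∀ x : γ.1, ∑' y : γ.1, F (x, y)
      = f x * (∫⁻ y, offDiag (Function.curry B) x y ∂γ.toMeasure).toReal := by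
    intro x
    have h1 : ∀ y : γ.1, offDiag (Function.curry B) x y ≠ ∞ := fun y =>
      ne_top_of_le_ne_top (hB (x, y)) (offDiag_le _ _ _)
    rw [lintegral_toMeasure]
    refine Eq.trans ?_ (congrArg (f x * ·) (ENNReal.tsum_toReal_eq h1).symm)
    refine Eq.trans (tsum_congr fun y => ?_) tsum_mul_left
    simp only [F, offDiag]
    split_ifs <;> simp [Function.curry]
  have hs1 : Summable fun x : γ.1 =>
      f x * (∫⁻ y, offDiag (Function.curry B) x y ∂γ.toMeasure).toReal :=
    hF.prod.congr e2
  have hs2 := (γ.summable_pair hf).mul_left β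
  rw [e1, hF.tsum_prod, tsum_congr e2, ← tsum_mul_left, ← hs1.tsum_sub hs2, lintegral_toMeasure]
  refine enorm_tsum_le_tsum_enorm.trans (ENNReal.tsum_le_tsum fun x => le_of_eq ?_)
  rw [mul_comm β, ← mul_sub, enorm_mul, sqDev, ← enorm_sq_eq, ← ENNReal.rpow_natCast,
    ← ENNReal.rpow_mul]
  norm_num

/-- Exchange of the particles in a sum over pairs. -/
lemma tsum_orderedPairs_swap {β : Type*} [AddCommMonoid β] [TopologicalSpace β] (γ : Config d)
    (f : E d × E d → β) :
    ∑' p : γ.orderedPairs, f p.1.swap = ∑' p : γ.orderedPairs, f p := by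
  let e : γ.orderedPairs ≃ γ.orderedPairs :=
    { toFun := fun p => ⟨p.1.swap, p.2.2.1, p.2.1, p.2.2.2.symm⟩
      invFun := fun p => ⟨p.1.swap, p.2.2.1, p.2.1, p.2.2.2.symm⟩
      left_inv := fun p => rfl
      right_inv := fun p => rfl }
  exact e.tsum_eq fun p : γ.orderedPairs => f p

end

end
end BinaryJumps

namespace BinaryJumps

noncomputable section

variable {d : ℕ}

open Config

/-! ### The difference of the generators -/

lemma hasSum_toReal_sumPairs {K : E d × E d → ℝ≥0∞} {γ : Config d} (h : sumPairs K γ ≠ ∞) :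
    HasSum (fun p : γ.orderedPairs => (K p).toReal) (sumPairs K γ).toReal := by
  have h' : ∑' p : γ.orderedPairs, K p ≠ ∞ := h
  rw [sumPairs_eq, ENNReal.tsum_toReal_eq (ENNReal.ne_top_of_tsum_ne_top h')]
  exact (ENNReal.summable_toReal h').hasSum

section

variable {z : ℝ≥0} {π : Measure (Config d)} {φ : E d → ℝ} {L : ℝ} {α : Measure (E d)}
  {b : E d → ℝ≥0} {M : ℝ≥0} {A s : ℝ≥0∞}

lemma jumpInt_const_mul (μ : Measure (E d × E d)) (b : E d → ℝ≥0)
    (q : E d × E d → E d × E d → ℝ) (c : ℝ) (x : E d × E d) :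
    jumpInt μ b (fun x y => c * q x y) x = c * jumpInt μ b q x := by
  rw [jumpInt, jumpInt, ← integral_const_mul]
  exact integral_congr_ae (ae_of_all _ fun h => mul_left_comm _ _ _)

/-- The sums occurring in the decomposition of the jump generator converge. -/
structure FiniteSums (α : Measure (E d)) (b : E d → ℝ≥0) (φ : E d → ℝ) (γ : Config d) : Prop where
  death : sumPairs (deathMajorant b φ) γ ≠ ∞
  single_pos : sumPairs (jumpPre (α.prod α) b (singleBirth (expInc φ))) γ ≠ ∞
  single_neg : sumPairs (jumpPre (α.prod α) b (singleBirth fun u => -expInc φ u)) γ ≠ ∞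
  joint_pos : sumPairs (jumpPost (α.prod α) b (jointBirth (expInc2 φ))) γ ≠ ∞
  joint_neg : sumPairs (jumpPost (α.prod α) b (jointBirth fun u => -expInc2 φ u)) γ ≠ ∞
  smeared : sumPairs (fun x => ‖expInc (-φ) x.1‖ₑ * smearRate α b x) γ ≠ ∞
  mixed : sumPairs (mixedMajorant (α.prod α) b φ) γ ≠ ∞

lemma SmearBound.smearRate_ne_top (h : SmearBound α b M φ A s) (x : E d × E d) :
    smearRate α b x ≠ ∞ := by
  have := h.finite
  have hA := h.ne_top.1
  have hs := h.ne_top.2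
  refine ne_top_of_le_ne_top ?_ (smearRate_le h.meas h.rate x)
  rw [h.univ]
  finiteness

/-- The pointwise decomposition is summed term by term, each part converging separately. The smeared
rate is symmetric, so the deaths of the first and of the second particle have equal sums, hence the
factor `2`. -/
lemma SmearBound.tsum_jumpInt (h : SmearBound α b M φ A s) (hφ : Continuous φ)
    (hL : ∀ x, |φ x| ≤ L) {γ : Config d} (hγ : FiniteSums α b φ γ) :
    ∑' p : γ.orderedPairs, jumpInt (α.prod α) b (expJump φ) p
      = A.toReal ^ 2 * ∑' p : γ.orderedPairs, pairRate b p.1 * expInc2 (-φ) p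
        + ((sumPairs (jumpPre (α.prod α) b (singleBirth (expInc φ))) γ).toReal
          - (sumPairs (jumpPre (α.prod α) b (singleBirth fun u => -expInc φ u)) γ).toReal)
        + ((sumPairs (jumpPost (α.prod α) b (jointBirth (expInc2 φ))) γ).toReal
          - (sumPairs (jumpPost (α.prod α) b (jointBirth fun u => -expInc2 φ u)) γ).toReal)
        + 2 * ∑' p : γ.orderedPairs, expInc (-φ) p.1.1 * (smearRate α b p).toReal
        + ∑' p : γ.orderedPairs, mixedInt (α.prod α) b φ p := by
  have := h.finite
  have hA : α.real Set.univ = A.toReal := by rw [Measure.real, h.univ]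
  have s1 := (summable_pairDeath hL hγ.death).hasSum.mul_left (A.toReal ^ 2)
  have s2 := (hasSum_toReal_sumPairs hγ.single_pos).sub (hasSum_toReal_sumPairs hγ.single_neg)
  have s3 := (hasSum_toReal_sumPairs hγ.joint_pos).sub (hasSum_toReal_sumPairs hγ.joint_neg)
  have hsm : Summable fun p : γ.orderedPairs => expInc (-φ) p.1.1 * (smearRate α b p).toReal := by
    refine summable_of_enorm_ne_top ?_
    convert hγ.smeared using 1
    rw [sumPairs_eq]
    refine tsum_congr fun p => ?_
    rw [enorm_mul, Real.enorm_eq_ofReal ENNReal.toReal_nonneg,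
      ENNReal.ofReal_toReal (h.smearRate_ne_top _)]
  have hsw : ∀ p : γ.orderedPairs, expInc (-φ) p.1.swap.1 * (smearRate α b p.1.swap).toReal
      = expInc (-φ) p.1.2 * (smearRate α b p).toReal := fun p => by
    rw [smearRate_swap h.even]; rfl
  have hsm' : Summable fun p : γ.orderedPairs =>
      expInc (-φ) p.1.2 * (smearRate α b p).toReal := by
    let e : γ.orderedPairs ≃ γ.orderedPairs :=
      { toFun := fun p => ⟨p.1.swap, p.2.2.1, p.2.1, p.2.2.2.symm⟩
        invFun := fun p => ⟨p.1.swap, p.2.2.1, p.2.1, p.2.2.2.symm⟩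
        left_inv := fun p => rfl
        right_inv := fun p => rfl }
    exact (e.summable_iff.2 hsm).congr fun p => hsw p
  have hsum : ∑' p : γ.orderedPairs, expInc (-φ) p.1.2 * (smearRate α b p).toReal
      = ∑' p : γ.orderedPairs, expInc (-φ) p.1.1 * (smearRate α b p).toReal := by
    rw [← tsum_orderedPairs_swap γ fun x => expInc (-φ) x.1 * (smearRate α b x).toReal]
    exact tsum_congr fun p => (hsw p).symm
  have s4 := hsm.hasSum.add hsm'.hasSum
  rw [hsum, ← two_mul] at s4
  have s5 : Summable fun p : γ.orderedPairs => mixedInt (α.prod α) b φ p := by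
    refine summable_of_enorm_ne_top (ne_top_of_le_ne_top (ENNReal.mul_ne_top
      (ENNReal.pow_ne_top (incBound_ne_top L) (n := 2)) hγ.mixed) ?_)
    rw [sumPairs_eq, ← ENNReal.tsum_mul_left]
    exact ENNReal.tsum_le_tsum fun p => enorm_mixedInt_le hL h.meas hφ p
  refine (((((s1.add s2).add s3).add s4).add s5.hasSum).tsum_eq.symm.trans
    (tsum_congr fun p => ?_)).symm
  rw [jumpInt_expJump hL h.meas h.le hφ, hA]
  ring

lemma enorm_tsum_mixedInt_le {μ : Measure (E d × E d)} (hb : Measurable b) (hφ : Continuous φ)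
    (hL : ∀ x, |φ x| ≤ L) (γ : Config d) :
    ‖∑' p : γ.orderedPairs, mixedInt μ b φ p‖ₑ ≤ incBound L ^ 2 * sumPairs (mixedMajorant μ b φ) γ := by
  refine enorm_tsum_le_tsum_enorm.trans ?_
  rw [sumPairs_eq, ← ENNReal.tsum_mul_left]
  exact ENNReal.tsum_le_tsum fun p => enorm_mixedInt_le hL hb hφ p

/-- The bound for the difference of the generators. -/
def errorBound (z : ℝ≥0) (α : Measure (E d)) (b : E d → ℝ≥0) (φ : E d → ℝ) (L : ℝ) (A : ℝ≥0∞)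
    (γ : Config d) : ℝ≥0∞ :=
  deviation z (jumpPre (α.prod α) b (singleBirth (expInc φ))) γ
    + deviation z (jumpPre (α.prod α) b (singleBirth fun u => -expInc φ u)) γ
    + deviation z (jumpPost (α.prod α) b (jointBirth (expInc2 φ))) γ
    + deviation z (jumpPost (α.prod α) b (jointBirth fun u => -expInc2 φ u)) γ
    + 2 * deathError α b φ (z * (A ^ 2 * ∫⁻ x, (b x : ℝ≥0∞))).toReal γ
    + incBound L ^ 2 * sumPairs (mixedMajorant (α.prod α) b φ) γ

/-- Pair deaths cancel exactly. The other coefficients match because `½ · z² · 2A²β = A² · zβ · z`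
for single births and `½ · 2 · zA²β = A² · zβ` for single deaths, where `β` is the integral of `b`.
Only fluctuations and mixed terms remain. -/
lemma SmearBound.enorm_tsum_sub_le (h : SmearBound α b M φ A s) (z : ℝ≥0) (hφ : Continuous φ)
    (hs : HasCompactSupport φ) (hL : ∀ x, |φ x| ≤ L) {γ : Config d} (hγ : FiniteSums α b φ γ) :
    ‖1 / 2 * ∑' p : γ.orderedPairs, jumpInt (α.prod α) b (expJump φ) p
      - A.toReal ^ 2 * (1 / 2 * ∑' p : γ.orderedPairs, pairRate b p.1 * expInc2 (-φ) p
        + 1 / 2 * (z ^ 2 * ((jointTotal b (expInc2 φ)).toReal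
          - (jointTotal b fun x => -expInc2 φ x).toReal))
        + z * (∫⁻ x, (b x : ℝ≥0∞)).toReal * ∑' x : γ.1, expInc (-φ) x
        + z * (∫⁻ x, (b x : ℝ≥0∞)).toReal * (z * ((∫⁻ x, ENNReal.ofReal (expInc φ x)).toReal
          - (∫⁻ x, ENNReal.ofReal (-expInc φ x)).toReal)))‖ₑ
      ≤ errorBound z α b φ L A γ := by
  have := h.finite
  have hm1 := (continuous_expInc hφ).measurable
  have hm2 := (continuous_expInc2 hφ).measurable
  have hχ : HasCompactSupport (expInc (-φ)) :=
    hasCompactSupport_expInc (hs.comp_left (g := fun t => -t) (by simp))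
  have hd := enorm_tsum_death_sub_le h.smearRate_ne_top hχ hγ.smeared
    (z * (A ^ 2 * ∫⁻ x, (b x : ℝ≥0∞))).toReal
  have hmix := enorm_tsum_mixedInt_le (μ := α.prod α) h.meas hφ hL γ
  rw [h.tsum_jumpInt hφ hL hγ]
  have t1 := lintegral_jumpPre_singleBirth (α := α) h.meas h.even hm1
  have t2 := lintegral_jumpPre_singleBirth (α := α) h.meas h.even hm1.neg
  have t3 := lintegral_jumpPost_jointBirth h.map_neg h.meas hm2
  have t4 := lintegral_jumpPost_jointBirth h.map_neg h.meas hm2.neg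
  rw [h.univ] at t1 t2 t3 t4
  set D := ∑' p : γ.orderedPairs, (pairRate b p.1 : ℝ) * expInc2 (-φ) p
  set U := ∑' p : γ.orderedPairs, expInc (-φ) p.1.1 * (smearRate α b p).toReal
  set X := ∑' x : γ.1, expInc (-φ) x
  set N := ∑' p : γ.orderedPairs, mixedInt (α.prod α) b φ p
  set β := ∫⁻ x, (b x : ℝ≥0∞)
  have e1 : (z : ℝ) ^ 2 * (∫⁻ x, jumpPre (α.prod α) b (singleBirth (expInc φ)) x).toReal
      = z ^ 2 * (2 * A.toReal ^ 2 * β.toReal * (∫⁻ x, ENNReal.ofReal (expInc φ x)).toReal) := by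
    rw [t1]; simp only [ENNReal.toReal_mul, ENNReal.toReal_pow, ENNReal.toReal_ofNat]
  have e2 : (z : ℝ) ^ 2 * (∫⁻ x, jumpPre (α.prod α) b (singleBirth fun u => -expInc φ u) x).toReal
      = z ^ 2 * (2 * A.toReal ^ 2 * β.toReal * (∫⁻ x, ENNReal.ofReal (-expInc φ x)).toReal) := by
    refine congrArg _ ((congrArg ENNReal.toReal t2).trans ?_)
    simp only [ENNReal.toReal_mul, ENNReal.toReal_pow, ENNReal.toReal_ofNat]
    rfl
  have e3 : (z : ℝ) ^ 2 * (∫⁻ x, jumpPost (α.prod α) b (jointBirth (expInc2 φ)) x).toReal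
      = z ^ 2 * (A.toReal ^ 2 * (jointTotal b (expInc2 φ)).toReal) := by
    rw [t3]; simp only [ENNReal.toReal_mul, ENNReal.toReal_pow]; rfl
  have e4 : (z : ℝ) ^ 2 * (∫⁻ x, jumpPost (α.prod α) b (jointBirth fun u => -expInc2 φ u) x).toReal
      = z ^ 2 * (A.toReal ^ 2 * (jointTotal b fun u => -expInc2 φ u).toReal) := by
    refine congrArg _ ((congrArg ENNReal.toReal t4).trans ?_)
    simp only [ENNReal.toReal_mul, ENNReal.toReal_pow]
    rfl
  have e5 : ((z : ℝ≥0∞) * (A ^ 2 * β)).toReal = z * (A.toReal ^ 2 * β.toReal) := by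
    simp only [ENNReal.toReal_mul, ENNReal.toReal_pow, ENNReal.coe_toReal]
  rw [errorBound]
  set S1 := (sumPairs (jumpPre (α.prod α) b (singleBirth (expInc φ))) γ).toReal with hS1
  set S2 := (sumPairs (jumpPre (α.prod α) b (singleBirth fun u => -expInc φ u)) γ).toReal with hS2
  set S3 := (sumPairs (jumpPost (α.prod α) b (jointBirth (expInc2 φ))) γ).toReal with hS3
  set S4 := (sumPairs (jumpPost (α.prod α) b (jointBirth fun u => -expInc2 φ u)) γ).toReal with hS4
  rw [deviation, deviation, deviation, deviation, ← hS1, ← hS2, ← hS3, ← hS4, e1, e2, e3, e4]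
  set J1 := (∫⁻ x, ENNReal.ofReal (expInc φ x)).toReal
  set J2 := (∫⁻ x, ENNReal.ofReal (-expInc φ x)).toReal
  set I1 := (jointTotal b (expInc2 φ)).toReal
  set I2 := (jointTotal b fun u => -expInc2 φ u).toReal
  have key : ∀ u1 u2 u3 u4 u5 u6 : ℝ, ‖1 / 2 * (u1 - u2 + u3 - u4 + 2 * u5 + u6)‖ₑ
      ≤ ‖u1‖ₑ + ‖u2‖ₑ + ‖u3‖ₑ + ‖u4‖ₑ + 2 * ‖u5‖ₑ + ‖u6‖ₑ := by
    intro u1 u2 u3 u4 u5 u6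
    have h2 : ‖(2 : ℝ)‖ₑ = 2 := by rw [Real.enorm_eq_ofReal (by norm_num)]; norm_num
    have h12 : ‖(1 / 2 : ℝ)‖ₑ ≤ 1 := by
      rw [Real.enorm_eq_ofReal (by norm_num)]
      exact ENNReal.ofReal_le_one.2 (by norm_num)
    calc _ ≤ 1 * ‖u1 - u2 + u3 - u4 + 2 * u5 + u6‖ₑ := by rw [enorm_mul]; gcongr
      _ ≤ _ := by
        rw [one_mul]
        refine (enorm_add_le _ _).trans (add_le_add ((enorm_add_le _ _).trans (add_le_add
          (enorm_sub_le.trans (add_le_add ((enorm_add_le _ _).trans (add_le_add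
          enorm_sub_le le_rfl)) le_rfl)) ?_)) le_rfl)
        rw [enorm_mul, h2]
  -- The six arguments are the deviations of positive and negative parts of the single births, the
  -- same for the joint births, the deviation of the single deaths, and the mixed terms.
  refine le_trans (le_of_eq ?_) ((key
    (S1 - z ^ 2 * (2 * A.toReal ^ 2 * β.toReal * J1))
    (S2 - z ^ 2 * (2 * A.toReal ^ 2 * β.toReal * J2))
    (S3 - z ^ 2 * (A.toReal ^ 2 * I1)) (S4 - z ^ 2 * (A.toReal ^ 2 * I2))
    (U - (z * (A ^ 2 * β)).toReal * X) N).trans ?_)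
  · rw [e5]
    congr 1
    ring
  · exact add_le_add (add_le_add le_rfl (mul_le_mul_right hd _)) hmix

end

end
end BinaryJumps

namespace BinaryJumps

noncomputable section

variable {d : ℕ}

open Config

/-! ### Convergence of the generators -/

section

variable {z : ℝ≥0} {π : Measure (Config d)} {φ : E d → ℝ} {L : ℝ} {α : Measure (E d)}
  {b : E d → ℝ≥0} {M : ℝ≥0} {A s : ℝ≥0∞}

lemma singleBirth_swap (f : E d → ℝ) (x y : E d × E d) :
    singleBirth f x.swap y.swap = singleBirth f x y := by
  rw [singleBirth, singleBirth, sum2_swap]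

lemma expInc2_swap (φ : E d → ℝ) (x : E d × E d) : expInc2 φ x.swap = expInc2 φ x := by
  simp only [expInc2, pairVal, Prod.fst_swap, Prod.snd_swap, add_comm]

lemma singleBirth_expInc_le (hL : ∀ x, |φ x| ≤ L) (x y : E d × E d) :
    singleBirth (expInc φ) x y ≤ incBound L * majBirth (suppInd φ) x y :=
  singleBirth_le (enorm_expInc_le hL) x y

lemma singleBirth_neg_expInc_le (hL : ∀ x, |φ x| ≤ L) (x y : E d × E d) :
    singleBirth (fun u => -expInc φ u) x y ≤ incBound L * majBirth (suppInd φ) x y :=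
  singleBirth_le (fun x => (enorm_neg _).trans_le (enorm_expInc_le hL x)) x y

lemma jointBirth_expInc2_le (hL : ∀ x, |φ x| ≤ L) (x y : E d × E d) :
    jointBirth (expInc2 φ) x y ≤ incBound L * majBirth (suppInd φ) x y :=
  jointBirth_le (enorm_expInc2_le hL) x y

lemma jointBirth_neg_expInc2_le (hL : ∀ x, |φ x| ≤ L) (x y : E d × E d) :
    jointBirth (fun u => -expInc2 φ u) x y ≤ incBound L * majBirth (suppInd φ) x y :=
  jointBirth_le (fun x => (enorm_neg _).trans_le (enorm_expInc2_le hL x)) x y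

lemma ae_sumPairs_deathMajorant_ne_top [Nonempty (Fin d)] (hπ : IsPoisson z π)
    (hb : Measurable b) (hbe : ∀ x, b (-x) = b x) (hbi : ∫⁻ x, (b x : ℝ≥0∞) ≠ ∞)
    (hφ : Continuous φ) (hs : HasCompactSupport φ) :
    ∀ᵐ γ ∂π, sumPairs (deathMajorant b φ) γ ≠ ∞ := by
  have h3 := lintegral_suppInd_ne_top hs
  refine ae_sumPairs_ne_top hπ (measurable_deathMajorant hb hφ) ?_
  simp only [deathMajorant]
  rw [lintegral_pairRate_sum2 hb hbe (measurable_suppInd hφ)]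
  finiteness

lemma SmearBound.ae_finiteSums [Nonempty (Fin d)] (h : SmearBound α b M φ A s)
    (hπ : IsPoisson z π) (hφ : Continuous φ) (hs : HasCompactSupport φ) (hL : ∀ x, |φ x| ≤ L) :
    ∀ᵐ γ ∂π, FiniteSums α b φ γ := by
  have := h.finite
  have hA := h.ne_top.1
  have hs' := h.ne_top.2
  have hbi := h.int
  have h2 := incBound_ne_top L
  have h3 := lintegral_suppInd_ne_top hs
  have hm1 := (continuous_expInc hφ).measurable
  have hm2 := (continuous_expInc2 hφ).measurable
  have hT := birthTotal_ne_top hs h.int L hA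
  have hχ := measurable_enorm_expInc hφ.neg
  have hB := measurable_smearRate (α := α) h.meas
  have hχB : Measurable fun x : E d × E d => ‖expInc (-φ) x.1‖ₑ * smearRate α b x :=
    (hχ.comp measurable_fst).mul hB
  have p1 := ae_sumPairs_ne_top hπ (measurable_jumpPre (μ := α.prod α) h.meas
    (measurable_singleBirth hm1))
    (ne_top_of_le_ne_top hT (h.lintegral_jumpPre_le hφ (singleBirth_expInc_le hL)))
  have p2 := ae_sumPairs_ne_top hπ (measurable_jumpPre (μ := α.prod α) h.meas
    (measurable_singleBirth hm1.neg))
    (ne_top_of_le_ne_top hT (h.lintegral_jumpPre_le hφ (singleBirth_neg_expInc_le hL)))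
  have p3 := ae_sumPairs_ne_top hπ (measurable_jumpPost (μ := α.prod α) h.meas
    (measurable_jointBirth hm2))
    (ne_top_of_le_ne_top hT (h.lintegral_jumpPost_le hφ (jointBirth_expInc2_le hL)))
  have p4 := ae_sumPairs_ne_top hπ (measurable_jumpPost (μ := α.prod α) h.meas
    (measurable_jointBirth hm2.neg))
    (ne_top_of_le_ne_top hT (h.lintegral_jumpPost_le hφ (jointBirth_neg_expInc2_le hL)))
  have p5 : ∀ᵐ γ ∂π, sumPairs (fun x => ‖expInc (-φ) x.1‖ₑ * smearRate α b x) γ ≠ ∞ := by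
    refine ae_sumPairs_ne_top hπ hχB ?_
    rw [Measure.volume_eq_prod, lintegral_prod _ hχB.aemeasurable]
    refine ne_top_of_le_ne_top (b := (incBound L * ∫⁻ x, suppInd φ x) * (A ^ 2 * ∫⁻ x, b x))
      (by finiteness) ?_
    rw [← lintegral_const_mul _ (measurable_suppInd hφ),
      ← lintegral_mul_const _ ((measurable_suppInd hφ).const_mul _)]
    refine lintegral_mono fun x => ?_
    have hBx : Measurable fun y => smearRate α b (x, y) := hB.comp measurable_prodMk_left
    simp only
    rw [lintegral_const_mul _ hBx, lintegral_smearRate_right h.meas, h.univ]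
    gcongr
    have := enorm_expInc_le (abs_neg_le hL) x
    rwa [suppInd_neg] at this
  have p6 := ae_sumPairs_ne_top hπ (measurable_mixedMajorant (μ := α.prod α) h.meas hφ)
    (ne_top_of_le_ne_top (by finiteness) (h.lintegral_mixedMajorant_le hφ))
  filter_upwards [ae_sumPairs_deathMajorant_ne_top hπ h.meas h.even h.int hφ hs, p1, p2, p3, p4, p5,
    p6] with γ q0 q1 q2 q3 q4 q5 q6
  exact ⟨q0, q1, q2, q3, q4, q5, q6⟩

lemma measurable_errorBound [IsFiniteMeasure α] (hb : Measurable b) (hφ : Continuous φ) (z : ℝ≥0)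
    (L : ℝ) (A : ℝ≥0∞) : Measurable (errorBound z α b φ L A) := by
  have hm1 := (continuous_expInc hφ).measurable
  have hm2 := (continuous_expInc2 hφ).measurable
  exact (((((measurable_deviation z (measurable_jumpPre hb (measurable_singleBirth hm1))).add
    (measurable_deviation z (measurable_jumpPre hb (measurable_singleBirth hm1.neg)))).add
    (measurable_deviation z (measurable_jumpPost hb (measurable_jointBirth hm2)))).add
    (measurable_deviation z (measurable_jumpPost hb (measurable_jointBirth hm2.neg)))).add
    ((measurable_deathError hb hφ _).const_mul 2)).add
    ((measurable_sumPairs (measurable_mixedMajorant hb hφ)).const_mul _)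

lemma lintegral_add_sq_le {Ω : Type*} [MeasurableSpace Ω] {μ : Measure Ω} {f g : Ω → ℝ≥0∞}
    (hf : Measurable f) {F G : ℝ≥0∞} (h1 : ∫⁻ x, f x ^ 2 ∂μ ≤ F) (h2 : ∫⁻ x, g x ^ 2 ∂μ ≤ G) :
    ∫⁻ x, (f x + g x) ^ 2 ∂μ ≤ 2 * (F + G) := by
  have h : ∀ u w : ℝ≥0∞, (u + w) ^ 2 ≤ 2 * u ^ 2 + 2 * w ^ 2 := fun u w => by
    have := ENNReal.rpow_add_le_mul_rpow_add_rpow u w (p := 2) (by norm_num)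
    norm_num at this
    rwa [mul_add] at this
  have hm : Measurable fun x => 2 * f x ^ 2 := (hf.pow_const 2).const_mul 2
  refine (lintegral_mono fun x => h (f x) (g x)).trans ?_
  rw [lintegral_add_left hm, lintegral_const_mul' _ _ (by finiteness),
    lintegral_const_mul' _ _ (by finiteness), ← mul_add]
  gcongr

/-- The constant in the bound for the difference of the generators. -/
def errorConst (π : Measure (Config d)) (z : ℝ≥0) (b : E d → ℝ≥0) (M : ℝ≥0) (φ : E d → ℝ)
    (L : ℝ) (A : ℝ≥0∞) : ℝ≥0∞ :=
  2 * (2 * (2 * (2 * (2 * (birthDeviation π z b M φ L A + birthDeviation π z b M φ L A)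
    + birthDeviation π z b M φ L A) + birthDeviation π z b M φ L A)
    + 2 ^ 2 * deathConst π z b φ L A) + (incBound L ^ 2) ^ 2 * mixedConst π z b M φ L A)

lemma errorConst_ne_top (hπ : IsPoisson z π) (hφ : Continuous φ) (hs : HasCompactSupport φ)
    (hb : ∫⁻ x, (b x : ℝ≥0∞) ≠ ∞) (M : ℝ≥0) (L : ℝ) (hA : A ≠ ∞) :
    errorConst π z b M φ L A ≠ ∞ := by
  have h1 : birthDeviation π z b M φ L A ≠ ∞ := deviationConst_ne_top hπ hφ hs L
    (birthTotal_ne_top hs hb L hA) (birthConst_ne_top hs hb M L hA)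
  have h2 := deathConst_ne_top hπ hφ hs hb L hA
  have h3 := mixedConst_ne_top hπ hφ hs hb M L hA
  have h4 := incBound_ne_top L
  unfold errorConst
  finiteness

/-- Every summand of the error has squared norm `O(s)`, with constants depending on the jump measure
only through its mass. -/
lemma SmearBound.lintegral_errorBound_sq_le [Nonempty (Fin d)] (h : SmearBound α b M φ A s)
    (hπ : IsPoisson z π) (hφ : Continuous φ) (hs : HasCompactSupport φ) (hL : ∀ x, |φ x| ≤ L) :
    ∫⁻ γ, errorBound z α b φ L A γ ^ 2 ∂(tilted π φ) ≤ errorConst π z b M φ L A * s := by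
  have := h.finite
  have hm1 := (continuous_expInc hφ).measurable
  have hm2 := (continuous_expInc2 hφ).measurable
  have d1 := measurable_deviation z (measurable_jumpPre (μ := α.prod α) h.meas
    (measurable_singleBirth hm1))
  have d2 := measurable_deviation z (measurable_jumpPre (μ := α.prod α) h.meas
    (measurable_singleBirth hm1.neg))
  have d3 := measurable_deviation z (measurable_jumpPost (μ := α.prod α) h.meas
    (measurable_jointBirth hm2))
  have d4 := measurable_deviation z (measurable_jumpPost (μ := α.prod α) h.meas
    (measurable_jointBirth hm2.neg))
  have d5 := (measurable_deathError (α := α) h.meas hφ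
    (z * (A ^ 2 * ∫⁻ x, (b x : ℝ≥0∞))).toReal)
  have d6 := measurable_sumPairs (measurable_mixedMajorant (μ := α.prod α) h.meas hφ)
  have q1 := h.lintegral_deviation_pre_le hπ hφ hs hL (measurable_singleBirth hm1)
    (singleBirth_expInc_le hL) (singleBirth_swap _)
  have q2 := h.lintegral_deviation_pre_le hπ hφ hs hL (measurable_singleBirth hm1.neg)
    (singleBirth_neg_expInc_le hL) (singleBirth_swap _)
  have q3 := h.lintegral_deviation_post_le hπ hφ hs hL (measurable_jointBirth hm2)
    (jointBirth_expInc2_le hL) (fun x y => by rw [jointBirth, jointBirth, expInc2_swap])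
  have q4 := h.lintegral_deviation_post_le hπ hφ hs hL (measurable_jointBirth hm2.neg)
    (jointBirth_neg_expInc2_le hL)
    (fun x y => by simp only [jointBirth, Pi.neg_apply, expInc2_swap])
  have q5 : ∫⁻ γ, (2 * deathError α b φ (z * (A ^ 2 * ∫⁻ x, (b x : ℝ≥0∞))).toReal γ) ^ 2
      ∂(tilted π φ) ≤ 2 ^ 2 * (deathConst π z b φ L A * s) := by
    simp only [mul_pow _ (deathError _ _ _ _ _)]
    rw [lintegral_const_mul _ (d5.pow_const 2)]
    exact mul_le_mul_right (h.lintegral_deathError_sq_le hπ hφ hs hL) _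
  have q6 : ∫⁻ γ, (incBound L ^ 2 * sumPairs (mixedMajorant (α.prod α) b φ) γ) ^ 2
      ∂(tilted π φ) ≤ (incBound L ^ 2) ^ 2 * (mixedConst π z b M φ L A * s) := by
    simp only [mul_pow _ (sumPairs _ _)]
    rw [lintegral_const_mul _ (d6.pow_const 2)]
    exact mul_le_mul_right (h.lintegral_mixedMajorant_sq_le hπ hφ hs hL) _
  -- The six summands associate to the left, and each addition costs a factor `2`; this produces the
  -- nested shape of `errorConst`.
  refine (lintegral_add_sq_le ((((d1.add d2).add d3).add d4).add (d5.const_mul 2))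
    (lintegral_add_sq_le (((d1.add d2).add d3).add d4)
    (lintegral_add_sq_le ((d1.add d2).add d3)
    (lintegral_add_sq_le (d1.add d2) (lintegral_add_sq_le d1 q1 q2) q3) q4) q5) q6).trans_eq ?_
  rw [errorConst]
  ring

end

section

variable {z : ℝ≥0} {π : Measure (Config d)} {φ : E d → ℝ} {L : ℝ} {a b : E d → ℝ≥0∞}

/-- The supremum of the smeared indicator of the support of `φ` and of the smeared rate. -/
def smearSup (a b : E d → ℝ≥0∞) (φ : E d → ℝ) (ε : ℝ) : ℝ≥0∞ :=
  (⨆ x, smear (scaledMeasure a ε) (suppInd φ) x)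
    + ⨆ x, smear (scaledMeasure a ε) (fun y => boundedRate b y) x

/-- Both the indicator of the support of `φ` and the bounded rate are bounded and integrable, which
is all that smearing requires. -/
lemma tendsto_smearSup (hd : d ≠ 0) (hab : Admissible a b) (hφ : Continuous φ)
    (hs : HasCompactSupport φ) : Tendsto (smearSup a b φ) (𝓝[>] 0) (𝓝 0) := by
  have hbi : ∫⁻ x, (boundedRate b x : ℝ≥0∞) ≠ ∞ := by
    rw [lintegral_boundedRate hab.bdd_b]; exact hab.int_b
  have h1 := tendsto_iSup_smear hd hab.meas_a hab.int_a (measurable_suppInd hφ)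
    (lintegral_suppInd_ne_top hs) ENNReal.one_ne_top (suppInd_le_one φ)
  have h2 := tendsto_iSup_smear hd hab.meas_a hab.int_a
    (measurable_boundedRate hab.meas_b).coe_nnreal_ennreal hbi ENNReal.coe_ne_top
    (fun x => ENNReal.coe_le_coe.2 (boundedRate_le hab.bdd_b x))
  have h3 := h1.add h2
  rw [add_zero] at h3
  exact h3

lemma smearBound {ε : ℝ} (hab : Admissible a b) (hε : 0 < ε) (h1 : smearSup a b φ ε ≤ 1) :
    SmearBound (scaledMeasure a ε) (boundedRate b) (essSup b volume).toNNReal φ (∫⁻ x, a x)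
      (smearSup a b φ ε) := by
  have := isFiniteMeasure_scaledMeasure hab.meas_a hε hab.int_a
  exact
  { finite := this
    map_neg := map_neg_prod (map_neg_scaledMeasure hab.meas_a hab.even_a ε)
    univ := scaledMeasure_univ hab.meas_a hε
    meas := measurable_boundedRate hab.meas_b
    even := boundedRate_neg hab.even_b
    le := boundedRate_le hab.bdd_b
    int := by rw [lintegral_boundedRate hab.bdd_b]; exact hab.int_b
    supp := fun x => (le_iSup (fun x => smear (scaledMeasure a ε) (suppInd φ) x) x).trans le_self_add
    rate := fun x => (le_iSup (fun x =>
      smear (scaledMeasure a ε) (fun y => boundedRate b y) x) x).trans le_add_self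
    le_one := h1 }

variable [Nonempty (Fin d)]

/-- Both generators applied to `e^{⟨φ,·⟩}` contain the factor `e^{⟨φ,γ⟩}`, which is pulled out and
becomes the weight of the tilted measure. -/
lemma ae_enorm_generator_sub_le {ε : ℝ} (hab : Admissible a b) (hε : 0 < ε)
    (h1 : smearSup a b φ ε ≤ 1) (hπ : IsPoisson z π) (hφ : Continuous φ)
    (hs : HasCompactSupport φ) (hL : ∀ x, |φ x| ≤ L) :
    ∀ᵐ γ ∂π, ‖(jumpGen (scaledKernel a b ε) (expFun φ) - birthDeathGen a b z (expFun φ)) γ‖ₑ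
      ≤ expWeight 1 φ γ
        * errorBound z (scaledMeasure a ε) (boundedRate b) φ L (∫⁻ x, a x) γ := by
  have h := smearBound hab hε h1
  filter_upwards [h.ae_finiteSums hπ hφ hs hL, ae_regularPairs hπ hab.meas_b hab.bdd_b]
    with γ h2 h3
  have e1 : jumpGen (scaledKernel a b ε) (expFun φ) γ = expFun φ γ * (1 / 2 *
      ∑' p : γ.orderedPairs, jumpInt ((scaledMeasure a ε).prod (scaledMeasure a ε))
        (boundedRate b) (expJump φ) p) := by
    have e : increment Real.exp φ (pair φ γ) = fun x y => expFun φ γ * expJump φ x y := by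
      ext x y
      rw [increment, expFun, expJump, Real.exp_add]; ring
    refine (jumpGen_eq (g := Real.exp) hab hε hs h3).trans ?_
    simp only [e, jumpInt_const_mul]
    rw [tsum_mul_left]; ring
  have hX : ‖expFun φ γ‖ₑ = expWeight 1 φ γ := by
    rw [expFun, expWeight, one_mul, Real.enorm_eq_ofReal (Real.exp_nonneg _)]
  have hmb : mass b = (∫⁻ x, (boundedRate b x : ℝ≥0∞)).toReal := by
    rw [mass, lintegral_boundedRate hab.bdd_b]
  rw [Pi.sub_apply, e1, birthDeathGen_eq hL z hab hφ hs h3, ← mul_sub, enorm_mul, hX, hmb]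
  exact mul_le_mul_right (h.enorm_tsum_sub_le z hφ hs hL h2) _

lemma eLpNorm_generator_sub_le {ε : ℝ} (hab : Admissible a b) (hε : 0 < ε)
    (h1 : smearSup a b φ ε ≤ 1) (hπ : IsPoisson z π) (hφ : Continuous φ)
    (hs : HasCompactSupport φ) (hL : ∀ x, |φ x| ≤ L) :
    eLpNorm (jumpGen (scaledKernel a b ε) (expFun φ) - birthDeathGen a b z (expFun φ)) 2 π
      ≤ (errorConst π z (boundedRate b) (essSup b volume).toNNReal φ L (∫⁻ x, a x)
        * smearSup a b φ ε) ^ (1 / 2 : ℝ) := by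
  have h := smearBound hab hε h1
  have := h.finite
  refine (eLpNorm_le_tilted hφ hs (measurable_errorBound h.meas hφ z L _)
    (ae_enorm_generator_sub_le hab hε h1 hπ hφ hs hL)).trans (eLpNorm_two_le_of_sq_le ?_)
  simp only [enorm_eq_self]
  exact h.lintegral_errorBound_sq_le hπ hφ hs hL

lemma eventually_smearSup_le_one (hab : Admissible a b) (hφ : Continuous φ)
    (hs : HasCompactSupport φ) : ∀ᶠ ε in 𝓝[>] (0 : ℝ), 0 < ε ∧ smearSup a b φ ε ≤ 1 := by
  have hd : d ≠ 0 := fun h => by subst h; exact (Fin.elim0 (Classical.arbitrary (Fin 0)))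
  filter_upwards [ENNReal.tendsto_nhds_zero.1 (tendsto_smearSup hd hab hφ hs) 1 one_pos,
    self_mem_nhdsWithin] with ε h1 h2
  exact ⟨h2, h1⟩

/-- The bound is `(C s)^{1/2}`, and `C` does not involve `ε` because the mass of the scaled jump
measure is `∫ a`. -/
lemma tendsto_generator (hab : Admissible a b) (hπ : IsPoisson z π) (hφ : Continuous φ)
    (hs : HasCompactSupport φ) (hL : ∀ x, |φ x| ≤ L) :
    Tendsto (fun ε : ℝ => eLpNorm
      (jumpGen (scaledKernel a b ε) (expFun φ) - birthDeathGen a b z (expFun φ)) 2 π)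
      (𝓝[>] 0) (𝓝 0) := by
  have hd : d ≠ 0 := fun h => by subst h; exact (Fin.elim0 (Classical.arbitrary (Fin 0)))
  have hbi : ∫⁻ x, (boundedRate b x : ℝ≥0∞) ≠ ∞ := by
    rw [lintegral_boundedRate hab.bdd_b]; exact hab.int_b
  have h1 := ENNReal.Tendsto.const_mul (tendsto_smearSup hd hab hφ hs)
    (Or.inr (errorConst_ne_top (z := z) hπ hφ hs hbi (essSup b volume).toNNReal L hab.int_a))
  rw [mul_zero] at h1
  have h2 := ((ENNReal.continuous_rpow_const (y := (1 / 2 : ℝ))).tendsto 0).comp h1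
  rw [ENNReal.zero_rpow_of_pos (by norm_num)] at h2
  refine tendsto_of_tendsto_of_tendsto_of_le_of_le' tendsto_const_nhds h2
    (Eventually.of_forall fun _ => zero_le) ?_
  filter_upwards [eventually_smearSup_le_one hab hφ hs] with ε hε
  exact eLpNorm_generator_sub_le hab hε.1 hε.2 hπ hφ hs hL

lemma ae_birthDeathGenConverges (hab : Admissible a b) (hπ : IsPoisson z π) (hφ : Continuous φ)
    (hs : HasCompactSupport φ) (hL : ∀ x, |φ x| ≤ L) :
    ∀ᵐ γ ∂π, BirthDeathGenConverges b z (expFun φ) γ := by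
  have hbi : ∫⁻ x, (boundedRate b x : ℝ≥0∞) ≠ ∞ := by
    rw [lintegral_boundedRate hab.bdd_b]; exact hab.int_b
  filter_upwards [ae_regularPairs hπ hab.meas_b hab.bdd_b,
    ae_sumPairs_deathMajorant_ne_top hπ (measurable_boundedRate hab.meas_b)
      (boundedRate_neg hab.even_b) hbi hφ hs] with γ h1 h2
  exact birthDeathGenConverges hL z hab hφ hs h1 h2

lemma aestronglyMeasurable_birthDeathGen (hab : Admissible a b) (hπ : IsPoisson z π)
    (hφ : Continuous φ) (hs : HasCompactSupport φ) (hL : ∀ x, |φ x| ≤ L) :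
    AEStronglyMeasurable (birthDeathGen a b z (expFun φ)) π := by
  have hbm := measurable_boundedRate hab.meas_b
  have hbi : ∫⁻ x, (boundedRate b x : ℝ≥0∞) ≠ ∞ := by
    rw [lintegral_boundedRate hab.bdd_b]; exact hab.int_b
  have hF : Measurable (expFun φ) := Real.measurable_exp.comp (measurable_pair hφ hs)
  have hχ : Measurable fun γ : Config d => ∑' x : γ.1, expInc (-φ) x :=
    measurable_pair (continuous_expInc hφ.neg)
      (hasCompactSupport_expInc (hs.comp_left (g := fun t => -t) (by simp)))
  have hD : AEStronglyMeasurable (fun γ : Config d => ∑' p : γ.orderedPairs,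
      (pairRate (boundedRate b) p.1 : ℝ) * expInc2 (-φ) p) π := by
    refine aestronglyMeasurable_tsum
      (f := fun _ x => (pairRate (boundedRate b) x : ℝ) * expInc2 (-φ) x)
      ((((measurable_pairRate hbm).coe_nnreal_real).mul
        (continuous_expInc2 hφ.neg).measurable).comp measurable_snd) ?_
    filter_upwards [ae_sumPairs_deathMajorant_ne_top hπ hbm (boundedRate_neg hab.even_b) hbi hφ hs]
      with γ hγ
    exact summable_pairDeath hL hγ
  refine (hF.aestronglyMeasurable.mul (((((hD.const_mul (1 / 2)).add
    (aestronglyMeasurable_const (b := 1 / 2 * ((z : ℝ) ^ 2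
      * ((jointTotal (boundedRate b) (expInc2 φ)).toReal
        - (jointTotal (boundedRate b) fun x => -expInc2 φ x).toReal))))).add
    (hχ.aestronglyMeasurable.const_mul (z * mass b))).add
    (aestronglyMeasurable_const (b := z * mass b * (z
      * ((∫⁻ x, ENNReal.ofReal (expInc φ x)).toReal
        - (∫⁻ x, ENNReal.ofReal (-expInc φ x)).toReal))))).const_mul (mass a ^ 2))).congr ?_
  filter_upwards [ae_regularPairs hπ hab.meas_b hab.bdd_b] with γ hγ
  exact (birthDeathGen_eq hL z hab hφ hs hγ).symm

/-- A single `ε` with `s ≤ 1` suffices: `L₀F = L_εF - (L_εF - L₀F)`, and both terms on the right are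
square integrable. -/
lemma memLp_birthDeathGen (hab : Admissible a b) (hπ : IsPoisson z π) (hφ : Continuous φ)
    (hs : HasCompactSupport φ) (hL : ∀ x, |φ x| ≤ L) :
    MemLp (birthDeathGen a b z (expFun φ)) 2 π := by
  obtain ⟨ε, hε, h1⟩ := (eventually_smearSup_le_one hab hφ hs).exists
  have hJ : MemLp (jumpGen (scaledKernel a b ε) (expFun φ)) 2 π :=
    memLp_jumpGen hπ hab hε hφ hs hL Real.continuous_exp fun _ _ => le_rfl
  have hB := aestronglyMeasurable_birthDeathGen hab hπ hφ hs hL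
  have hbi : ∫⁻ x, (boundedRate b x : ℝ≥0∞) ≠ ∞ := by
    rw [lintegral_boundedRate hab.bdd_b]; exact hab.int_b
  have hD : MemLp (jumpGen (scaledKernel a b ε) (expFun φ) - birthDeathGen a b z (expFun φ)) 2 π := by
    refine ⟨hJ.1.sub hB, (eLpNorm_generator_sub_le hab hε h1 hπ hφ hs hL).trans_lt ?_⟩
    refine ENNReal.rpow_lt_top_of_nonneg (by norm_num) (ENNReal.mul_ne_top
      (errorConst_ne_top (z := z) hπ hφ hs hbi (essSup b volume).toNNReal L hab.int_a)
      (ne_top_of_le_ne_top ENNReal.one_ne_top h1))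
  have e := hJ.sub hD
  rwa [sub_sub_cancel] at e

end

end

end BinaryJumps

theorem theorem5p1 (d : ℕ) (hd : 1 ≤ d) (z : ℝ≥0) (hz : 0 < z)
    (π : Measure (Config d)) (hπ : IsPoisson z π)
    (a b : E d → ℝ≥0∞) (ha : Measurable a) (hb : Measurable b)
    (ha_even : ∀ x, a (-x) = a x) (hb_even : ∀ x, b (-x) = b x)
    (ha_int : ∫⁻ x, a x ≠ ∞) (hb_int : ∫⁻ x, b x ≠ ∞)
    (hb_bdd : essSup b volume ≠ ∞)
    (hb_lim : Tendsto b (cocompact (E d)) (𝓝 0))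
    (φ : E d → ℝ) (hφ : Continuous φ) (hφ_supp : HasCompactSupport φ) :
    (∀ ε : ℝ, 0 < ε →
      (∀ᵐ γ ∂π, JumpGenConverges (scaledKernel a b ε) (expFun φ) γ) ∧
      InGenerator (scaledKernel a b ε) π (expFun φ)
        (jumpGen (scaledKernel a b ε) (expFun φ))) ∧
    (∀ᵐ γ ∂π, BirthDeathGenConverges b z (expFun φ) γ) ∧
    MemLp (birthDeathGen a b z (expFun φ)) 2 π ∧
    Tendsto
      (fun ε : ℝ => eLpNorm
        (jumpGen (scaledKernel a b ε) (expFun φ) - birthDeathGen a b z (expFun φ)) 2 π)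
      (𝓝[>] 0) (𝓝 0) := by
  -- In positive dimension Lebesgue measure has no atoms, so that new points almost surely avoid the
  -- configuration, and `εᵈ → 0`.
  have hne : Nonempty (Fin d) := ⟨⟨0, hd⟩⟩
  obtain ⟨L, hL⟩ := hφ_supp.exists_bound_of_continuous hφ
  have hab : Admissible a b := ⟨ha, hb, ha_even, hb_even, ha_int, hb_int, hb_bdd⟩
  exact ⟨fun ε hε => ⟨ae_jumpGenConverges hπ hab hε hφ hφ_supp hL Real.continuous_exp
      fun _ _ => le_rfl, inGenerator_expFun hπ hab hε hφ hφ_supp hL⟩,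
    ae_birthDeathGenConverges hab hπ hφ hφ_supp hL, memLp_birthDeathGen hab hπ hφ hφ_supp hL,
    tendsto_generator hab hπ hφ hφ_supp hL⟩
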